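/- Let $k$ be an algebraically closed field of characteristic $2$. Let $\overline X$ be a projective variety over $k$ of even dimension $n>0$, $\mathcal L$ a line bundle on $\overline X$, and $M\subset H^0(\overline X,\mathcal L)$ a linear subspace of dimension $m+1$ with $m>n$. Let $\mathbf P=\mathbf P_*(M)$ be the $m$-dimensional projective space of lines in $M$. Let $X$ be the complement in $\overline X$ of the singular locus and of the base locus of $|M|$, let $\Psi:X\to\mathbf P^\vee$ be the morphism given by $M$, and let $X^\circ\subset X$ be the open set of points $p$ at which $d_p\Psi$ is injective. Assume that $X^\circ$ is dense in $\overline X$. Let $\mathcal D\subset X\times\mathbf P$ be the universal family of the divisors of $|M|$, that is, the zero scheme of the canonical section $\sigma$ of $\mathrm{pr}_1^*\mathcal L\otimes\mathrm{pr}_2^*\mathcal O_{\mathbf P}(1)$ (for a basis $s_0,\dots,s_m$ of $M$ with dual coordinates $Y_0,\dots,Y_m$ one has $\sigma=\sum_i s_i\otimes Y_i$). Let $\mathcal C$ be the critical subscheme of the projection $\mathcal D\to\mathbf P$, defined locally by the $m$-minors of its differential, let $\mathcal C^\circ=\mathcal C\cap(X^\circ\times\mathbf P)$, and let $\pi_2:\mathcal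 C^\circ\to\mathbf P$ be the projection. The universal Hessian on $\mathcal C^\circ$ is the bilinear form $(\partial,\partial')\mapsto(\partial\partial'\sigma)|_{\mathcal C^\circ}$ on the pull-back of the tangent bundle of $X^\circ$; it is anti-symmetric. Let $\mathcal R\subset\mathcal C^\circ$ be its degeneracy subscheme, defined locally by the square root of the determinant of a matrix of the form. Let $\mathcal R^{\mathrm{sm}}$ be the set of closed points of $\mathcal R$ at which $\mathcal R$ is smooth of dimension $m-2$. For a closed point $Q$ of a scheme $Z$ over $k$ write $(Z,Q)^\wedge=\operatorname{Spec}\,(\mathcal O_{Z,Q})^\wedge$. Let $P=(p,[f])$ be a point of $\mathcal R^{\mathrm{sm}}$. Then $m\ge 4$. Put $R=k[[t_1,\dots,t_{m-4}]]$, let $$(\gamma^R)^*:R[[u_1,v_1,u_2,v_2,w,y]]\to R[[x_1,x_2,z]]$$ be the continuous $R$-algebra homomorphism with $$u_1\mapsto x_1^2,\quad v_1\mapsto x_1z,\quad u_2\mapsto x_2^2,\quad v_2\mapsto x_2z,\quad w\mapsto x_1x_2z,\quad y\mapsto z,$$ let $\Gamma_{m-1}=\operatorname{Spec}\bigl(R[[u_1,v_1,u_2,v_2,w,y]]/\operatorname{Ker}(\gamma^R)^*\bigr)$,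 and let $\gamma^R:\operatorname{Spec}k[[w_1,\dots,w_{m-1}]]\to\Gamma_{m-1}$ be the induced morphism, where $w_1,\dots,w_{m-1}$ are the variables $t_1,\dots,t_{m-4},x_1,x_2,z$. Then there exist an isomorphism $$\iota:(\mathcal C^\circ,P)^\wedge\;\xrightarrow{\ \sim\ }\;\operatorname{Spec}k[[w_1,\dots,w_{m-1}]]$$ and a morphism $\psi:\Gamma_{m-1}\to(\mathbf P,[f])^\wedge$, both over $k$, such that the formal completion $(\pi_2)_P^\wedge:(\mathcal C^\circ,P)^\wedge\to(\mathbf P,[f])^\wedge$ of $\pi_2$ at $P$ is equal to $\psi\circ\gamma^R\circ\iota$. -/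

import Mathlib

open CategoryTheory AlgebraicGeometry IsLocalRing

universe u

noncomputable section

namespace DualVar

/-! ### Local rings, completions -/

section Completion

/-- The scheme `Spec` of the completion of a local ring `A` along its maximal ideal. -/
abbrev formalCompletion (A : Type u) [CommRing A] [IsLocalRing A] : Scheme.{u} :=
  Spec (.of (AdicCompletion (maximalIdeal A) A))

lemma pow_maximalIdeal_le_comap {A C : Type u} [CommRing A] [IsLocalRing A] [CommRing C]
    [IsLocalRing C] (φ : A →+* C) [IsLocalHom φ] (n : ℕ) :
    maximalIdeal A ^ n ≤ (maximalIdeal C ^ n).comap φ := by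
  rw [← Ideal.map_le_iff_le_comap, Ideal.map_pow]
  refine Ideal.pow_right_mono (Ideal.map_le_iff_le_comap.mpr fun a ha => ?_) n
  exact map_nonunit φ a ha

/-- The homomorphism `Â → C / 𝔪_C ^ n` induced by a local homomorphism `A → C`. -/
def completionToQuotient {A C : Type u} [CommRing A] [IsLocalRing A] [CommRing C] [IsLocalRing C]
    (φ : A →+* C) [IsLocalHom φ] (n : ℕ) :
    AdicCompletion (maximalIdeal A) A →+* C ⧸ maximalIdeal C ^ n :=
  (Ideal.quotientMap (maximalIdeal C ^ n) φ (pow_maximalIdeal_le_comap φ n)).comp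
    (AdicCompletion.evalₐ (maximalIdeal A) n : _ →+* _)

lemma factorPow_comp_completionToQuotient {A C : Type u} [CommRing A] [IsLocalRing A]
    [CommRing C] [IsLocalRing C] (φ : A →+* C) [IsLocalHom φ] {a b : ℕ} (hab : a ≤ b) :
    (Ideal.Quotient.factorPow (maximalIdeal C) hab).comp (completionToQuotient φ b) =
      completionToQuotient φ a := by
  refine RingHom.ext fun x => ?_
  have hx : Ideal.Quotient.factorPow (maximalIdeal A) hab
      (AdicCompletion.evalₐ (maximalIdeal A) b x) =
        AdicCompletion.evalₐ (maximalIdeal A) a x := by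
    obtain ⟨x, rfl⟩ := AdicCompletion.mk_surjective (maximalIdeal A) A x
    rw [AdicCompletion.evalₐ_mk, AdicCompletion.evalₐ_mk, Ideal.Quotient.factor_mk,
      Ideal.Quotient.eq]
    have h := (SModEq.sub_mem.mp (x.property hab).symm)
    simpa using h
  obtain ⟨y, hy⟩ := Ideal.Quotient.mk_surjective (AdicCompletion.evalₐ (maximalIdeal A) b x)
  simp only [completionToQuotient, RingHom.comp_apply, RingHom.coe_coe]
  rw [← hx, ← hy]
  rfl

/-- The ring homomorphism between completed local rings induced by a local homomorphism. -/
def completionMap {A C : Type u} [CommRing A] [IsLocalRing A] [CommRing C] [IsLocalRing C]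
    (φ : A →+* C) [IsLocalHom φ] :
    AdicCompletion (maximalIdeal A) A →+* AdicCompletion (maximalIdeal C) C :=
  AdicCompletion.liftRingHom (maximalIdeal C) (completionToQuotient φ)
    (factorPow_comp_completionToQuotient φ)

/-- The structure homomorphism `k → 𝒪_{X, x}` of a `k`-scheme `X`. -/
def baseToStalk {k : Type u} [Field k] {X : Scheme.{u}} (str : X ⟶ Spec (.of k)) (x : X) : k →+* X.presheaf.stalk x :=
  ((Scheme.ΓSpecIso (.of k)).inv ≫ str.appTop ≫ X.presheaf.germ ⊤ x (TopologicalSpace.Opens.mem_top x)).hom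

end Completion

/-! ### Projective space -/

section ProjectiveSpace

variable (k : Type u) [Field k]

attribute [local instance] MvPolynomial.gradedAlgebra

/-- Projective space of dimension `m` over `k`, with homogeneous coordinates `Y 0, …, Y m`. -/
abbrev PSpace (m : ℕ) : Scheme.{u} := Proj (MvPolynomial.homogeneousSubmodule (Fin (m + 1)) k)

/-- The structure morphism of projective space. -/
def PSpace.str (m : ℕ) : PSpace k m ⟶ Spec (.of k) :=
  Proj.toSpecZero (MvPolynomial.homogeneousSubmodule (Fin (m + 1)) k) ≫
    Spec.map (CommRingCat.ofHom
      (algebraMap k (MvPolynomial.homogeneousSubmodule (Fin (m + 1)) k 0)))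

variable {k}

/-- `Y j` does not vanish at the point `y`. -/
def PSpace.CoordNe {m : ℕ} (y : PSpace k m) (j : Fin (m + 1)) : Prop :=
  (MvPolynomial.X j : MvPolynomial (Fin (m + 1)) k) ∉ y.asHomogeneousIdeal.toIdeal

/-- The regular function `Y i / Y j` as an element of the local ring at a point `y`
where `Y j` does not vanish. -/
def PSpace.coordRatio {m : ℕ} (y : PSpace k m) (i j : Fin (m + 1)) (hj : PSpace.CoordNe y j) :
    (PSpace k m).presheaf.stalk y :=
  (Proj.stalkIso (MvPolynomial.homogeneousSubmodule (Fin (m + 1)) k) y).inv.hom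
    (HomogeneousLocalization.mk
      { deg := 1
        num := ⟨MvPolynomial.X i, MvPolynomial.isHomogeneous_X k i⟩
        den := ⟨MvPolynomial.X j, MvPolynomial.isHomogeneous_X k j⟩
        den_mem := hj })

/-- A `k`-scheme is projective if it is a closed subscheme of some projective space. -/
def IsProjective {X : Scheme.{u}} (str : X ⟶ Spec (.of k)) : Prop :=
  ∃ (N : ℕ) (i : X ⟶ PSpace k N), IsClosedImmersion i ∧ i ≫ PSpace.str k N = str

end ProjectiveSpace

/-! ### Line bundles -/

section LineBundle

variable {X : Scheme.{u}} (L : X.Modules)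

/-- A local frame of `L` at `p`: a section `e` of `L` over an open neighbourhood `U` of `p` such
that `g ↦ g e` is an isomorphism of sheaves `𝒪_U ≅ L|_U`. -/
structure LocalFrame (p : X) where
  U : X.Opens
  mem : p ∈ U
  e : Γ(L, U)
  bijective : ∀ (V : X.Opens) (h : V ≤ U),
    Function.Bijective fun g : Γ(X, V) => g • (L.presheaf.map (homOfLE h).op e : Γ(L, V))

/-- `L` is a line bundle: it is locally isomorphic to the structure sheaf. -/
def IsLineBundle : Prop := ∀ p : X, Nonempty (LocalFrame L p)

variable {L}

/-- The germ at `p` of the function `s / e`, for a global section `s` of `L` and a frame `e`. -/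
def LocalFrame.coord {p : X} (F : LocalFrame L p) (s : Γ(L, ⊤)) : X.presheaf.stalk p :=
  X.presheaf.germ F.U p F.mem
    ((Equiv.ofBijective _ (F.bijective F.U le_rfl)).symm
      (L.presheaf.map (homOfLE (le_top : F.U ≤ ⊤)).op s))

end LineBundle

/-! ### Critical ideal and degeneracy of the Hessian, at the level of local rings -/

section LocalAlgebra

/-- The critical ideal of a homomorphism `π : A → D` corresponding to a morphism `f` from a smooth
germ with local ring `D` to an `m`-dimensional smooth germ with local ring `A`, where
`m ≤ dim D`. It is the ideal of all `m`-minors of `df : Θ_D → f^* Θ_A`; since `Θ_D` is the module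
of derivations of `D` and `f^* Θ_A` is free with dual generated by the differentials of the
elements of `A`, these are generated by the determinants `det (δ_i (π a_j))`. -/
def criticalIdeal (k : Type u) {A D : Type u} [Field k] [CommRing A] [CommRing D] [Algebra k D]
    (π : A →+* D) (m : ℕ) : Ideal D :=
  Ideal.span {x | ∃ (δ : Fin m → Derivation k D D) (a : Fin m → A),
    x = (Matrix.of fun i j => δ i (π (a j))).det}

variable (k A : Type u) {B : Type u} [Field k] [CommRing A] [CommRing B] [Algebra k B]
  [Algebra A B] (Φ : B) (m : ℕ)

/-- The local ring of the hypersurface `Φ = 0`. -/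
abbrev DRing : Type u := B ⧸ Ideal.span {Φ}

/-- The local ring of the critical subscheme of the projection of the hypersurface `Φ = 0` to the
`m`-dimensional smooth germ with local ring `A`. -/
abbrev CRing : Type u :=
  DRing Φ ⧸ criticalIdeal k ((Ideal.Quotient.mk (Ideal.span {Φ})).comp (algebraMap A B)) m

/-- The restriction of functions from the ambient germ to the critical subscheme. -/
def toCRing : B →+* CRing k A Φ m :=
  (Ideal.Quotient.mk _).comp (Ideal.Quotient.mk (Ideal.span {Φ}))

lemma toCRing_surjective : Function.Surjective (toCRing k A Φ m) :=
  Ideal.Quotient.mk_surjective.comp Ideal.Quotient.mk_surjective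

instance [IsLocalRing B] [Nontrivial (CRing k A Φ m)] : IsLocalRing (CRing k A Φ m) :=
  .of_surjective' (toCRing k A Φ m) (toCRing_surjective k A Φ m)

instance [IsLocalRing B] [Nontrivial (CRing k A Φ m)] : IsLocalHom (toCRing k A Φ m) :=
  .of_surjective _ (toCRing_surjective k A Φ m)

variable {A} in
/-- The matrix over the local ring of the critical subscheme of the Hessian
`∂ ⊗ ∂' ↦ (∂ ∂' Φ)|_C`, with respect to a frame `∂ 0, …, ∂ (d - 1)` of the module
`Der_A(B, B)` of vector fields relative to `A`. -/
def hessianMatrix {d : ℕ} (b : Module.Basis (Fin d) B (Derivation A B B)) :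
    Matrix (Fin d) (Fin d) (CRing k A Φ m) :=
  Matrix.of fun i j => toCRing k A Φ m (b i (b j Φ))

/-- The degeneracy ideal of the anti-symmetric Hessian form: it is generated by the square
root of the determinant of the matrix of the form in a frame. -/
def degeneracyIdeal : Ideal (CRing k A Φ m) :=
  Ideal.span {g | ∃ (d : ℕ) (b : Module.Basis (Fin d) B (Derivation A B B)),
    g ^ 2 = (hessianMatrix k Φ m b).det}

/-- The local ring of the degeneracy subscheme of the Hessian. -/
abbrev RRing : Type u := CRing k A Φ m ⧸ degeneracyIdeal k A Φ m

end LocalAlgebra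

/-! ### The linear system -/

/-- A projective variety `X` over `k` with a line bundle `L` and a linear subspace `M` of
`H⁰(X, L)` of dimension `m + 1`, given by a basis `s 0, …, s m`. -/
structure LinearSystem (k : Type u) [Field k] where
  X : Scheme.{u}
  str : X ⟶ Spec (.of k)
  integral : IsIntegral X
  projective : IsProjective str
  L : X.Modules
  lineBundle : IsLineBundle L
  m : ℕ
  s : Fin (m + 1) → Γ(L, ⊤)
  linearIndependent : ∀ c : Fin (m + 1) → k,
    ∑ i, (((Scheme.ΓSpecIso (.of k)).inv ≫ str.appTop).hom (c i) : Γ(X, ⊤)) • s i = 0 → c = 0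

namespace LinearSystem

variable {k : Type u} [Field k] (S : LinearSystem k)

/-- `p` is not a base point, and the differential at `p` of the rational map `Ψ` to the dual
projective space given by the linear system is injective. In a chart where the section `s j` does
not vanish, `Ψ` has the affine coordinates `s i / s j`; injectivity of `dΨ` says that a tangent
vector at `p`, a linear form on `𝔪_p / 𝔪_p²`, vanishes if it kills all
`s i / s j - (s i / s j)(p)`. -/
def ImmersedAt (p : S.X) : Prop :=
  ∃ (F : LocalFrame S.L p) (j : Fin (S.m + 1)) (hj : IsUnit (F.coord (S.s j))),
    ∀ v : Module.Dual (ResidueField (S.X.presheaf.stalk p))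
        (CotangentSpace (S.X.presheaf.stalk p)),
      (∀ (i : Fin (S.m + 1)) (c : k)
        (h : F.coord (S.s i) * ((hj.unit⁻¹ : (S.X.presheaf.stalk p)ˣ) : S.X.presheaf.stalk p)
          - baseToStalk S.str p c ∈ maximalIdeal (S.X.presheaf.stalk p)),
        v ((maximalIdeal (S.X.presheaf.stalk p)).toCotangent ⟨_, h⟩) = 0) → v = 0

/-- The set `X°` of closed points `p` that are smooth points of the variety, not base points, and
at which the differential of `Ψ` is injective. -/
def immersionPoints : Set S.X :=
  {p | IsClosed {p} ∧ (∃ U : S.X.Opens, p ∈ U ∧ Smooth (U.ι ≫ S.str)) ∧ S.ImmersedAt p}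

/-- The product of the variety with the space `𝐏` parametrizing the linear system. The point of
`𝐏` with homogeneous coordinates `(c 0 : … : c m)` corresponds to the section `∑ i, c i * s i`. -/
abbrev Prod : Scheme.{u} := Limits.pullback S.str (PSpace.str k S.m)

/-- The first projection. -/
abbrev pr₁ : S.Prod ⟶ S.X := Limits.pullback.fst S.str (PSpace.str k S.m)

/-- The second projection. -/
abbrev pr₂ : S.Prod ⟶ PSpace k S.m := Limits.pullback.snd S.str (PSpace.str k S.m)

variable (P : S.Prod)

/-- The local ring of `𝐏` at the image of `P`. -/
def BaseRing : Type u := (PSpace k S.m).presheaf.stalk (S.pr₂ P)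

instance : CommRing (S.BaseRing P) :=
  inferInstanceAs (CommRing ((PSpace k S.m).presheaf.stalk (S.pr₂ P)))

instance : IsLocalRing (S.BaseRing P) :=
  inferInstanceAs (IsLocalRing ((PSpace k S.m).presheaf.stalk (S.pr₂ P)))

instance : Algebra k (S.BaseRing P) := (baseToStalk (PSpace.str k S.m) (S.pr₂ P)).toAlgebra

/-- The local ring of the product at `P`. -/
def ProdRing : Type u := S.Prod.presheaf.stalk P

instance : CommRing (S.ProdRing P) := inferInstanceAs (CommRing (S.Prod.presheaf.stalk P))

instance : IsLocalRing (S.ProdRing P) := inferInstanceAs (IsLocalRing (S.Prod.presheaf.stalk P))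

instance : Algebra k (S.ProdRing P) := (baseToStalk (S.pr₁ ≫ S.str) P).toAlgebra

/-- The pullback of functions along the first projection. -/
def fromX : S.X.presheaf.stalk (S.pr₁ P) →+* S.ProdRing P := (S.pr₁.stalkMap P).hom

/-- The pullback of functions along the second projection. -/
def fromBase : S.BaseRing P →+* S.ProdRing P := (S.pr₂.stalkMap P).hom

instance : Algebra (S.BaseRing P) (S.ProdRing P) := (S.fromBase P).toAlgebra

instance : IsLocalHom (algebraMap (S.BaseRing P) (S.ProdRing P)) :=
  inferInstanceAs (IsLocalHom (S.pr₂.stalkMap P).hom)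

/-- A local trivialization at `P` of the line bundle `pr₁^* L ⊗ pr₂^* 𝒪(1)` on the product: a
frame `e` of `L` at the image of `P`, and a homogeneous coordinate `Y j` that does not vanish at
the image of `P`. -/
structure Trivialization where
  frame : LocalFrame S.L (S.pr₁ P)
  chart : Fin (S.m + 1)
  chart_ne : PSpace.CoordNe (S.pr₂ P) chart

variable {S P} (τ : S.Trivialization P)

/-- The function `σ / (e ⊗ Y j)` for the canonical section `σ = ∑ i, s i ⊗ Y i`; it is a local
equation at `P` of the universal family `𝒟` of the divisors of the linear system. -/
def Trivialization.equation : S.ProdRing P :=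
  ∑ i, S.fromX P (τ.frame.coord (S.s i)) *
    S.fromBase P (PSpace.coordRatio (S.pr₂ P) i τ.chart τ.chart_ne)

/-- The local ring at `P` of the critical subscheme `𝒞` of the projection of `𝒟` to `𝐏`
(the zero ring if `P` is not a point of `𝒞`). -/
abbrev Trivialization.OC : Type u := CRing k (S.BaseRing P) τ.equation S.m

/-- The local ring at `P` of the degeneracy subscheme `ℛ ⊆ 𝒞` of the universal Hessian
(the zero ring if `P` is not a point of `ℛ`). -/
abbrev Trivialization.OR : Type u := RRing k (S.BaseRing P) τ.equation S.m

/-- The homomorphism `𝒪_{𝐏, [f]} → 𝒪_{𝒞, P}` of local rings given by the projection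
`π₂ : 𝒞 → 𝐏`. -/
def Trivialization.π₂ : S.BaseRing P →+* τ.OC :=
  (toCRing k (S.BaseRing P) τ.equation S.m).comp (algebraMap (S.BaseRing P) (S.ProdRing P))

instance [Nontrivial τ.OC] : IsLocalHom τ.π₂ :=
  inferInstanceAs (IsLocalHom
    ((toCRing k (S.BaseRing P) τ.equation S.m).comp (algebraMap (S.BaseRing P) (S.ProdRing P))))

/-- `P` is a closed point of `ℛ ⊆ 𝒞 ∩ (X° × 𝐏)` at which `ℛ` is smooth of dimension `m - 2`
(as the ground field is algebraically closed, smooth at a closed point means regular). -/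
def Trivialization.IsSmoothPointOfR : Prop :=
  IsClosed {P} ∧ S.pr₁ P ∈ S.immersionPoints ∧
    IsRegularLocalRing τ.OR ∧ ringKrullDim τ.OR = ((S.m - 2 : ℕ) : WithBot ℕ∞)

end LinearSystem

/-! ### The singular scheme `Γ` -/

section Gamma

open MvPowerSeries

variable (k : Type u) [Field k] (r : ℕ)

/-- The power series ring over `k` in the variables `t 0, …, t (r - 1), x₁, x₂, z`, that is
`R[[x₁, x₂, z]]` for `R = k[[t 0, …, t (r - 1)]]`. -/
abbrev SourceRing : Type u := MvPowerSeries (Fin r ⊕ Fin 3) k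

/-- The power series ring over `k` in the variables `t 0, …, t (r - 1), u₁, v₁, u₂, v₂, w, y`,
that is `R[[u₁, v₁, u₂, v₂, w, y]]` for `R = k[[t 0, …, t (r - 1)]]`. -/
abbrev TargetRing : Type u := MvPowerSeries (Fin r ⊕ Fin 6) k

/-- The images of the variables: `t i ↦ t i`, `u₁ ↦ x₁²`, `v₁ ↦ x₁ z`, `u₂ ↦ x₂²`,
`v₂ ↦ x₂ z`, `w ↦ x₁ x₂ z`, `y ↦ z`. -/
def gammaVars : Fin r ⊕ Fin 6 → SourceRing k r :=
  let x₁ : SourceRing k r := X (Sum.inr 0)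
  let x₂ : SourceRing k r := X (Sum.inr 1)
  let z : SourceRing k r := X (Sum.inr 2)
  Sum.elim (fun i => X (Sum.inl i)) ![x₁ ^ 2, x₁ * z, x₂ ^ 2, x₂ * z, x₁ * x₂ * z, z]

lemma gammaVars_hasSubst : HasSubst (gammaVars k r) := by
  refine hasSubst_of_constantCoeff_zero fun i => ?_
  rcases i with i | i
  · simp [gammaVars]
  · fin_cases i <;> simp [gammaVars]

/-- The homomorphism `(γ^R)^* : R[[u₁, v₁, u₂, v₂, w, y]] → R[[x₁, x₂, z]]`, substitution of
`gammaVars`. -/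
def gammaStar : TargetRing k r →ₐ[k] SourceRing k r := substAlgHom (gammaVars_hasSubst k r)

/-- The scheme `Γ`, the scheme-theoretic image of `Spec (γ^R)^*`. For `r = m - 4` it is
`(m - 1)`-dimensional. -/
def Gamma : Scheme.{u} := Spec (.of (TargetRing k r ⧸ RingHom.ker (gammaStar k r)))

/-- The structure morphism of `Γ`. -/
def Gamma.str : Gamma k r ⟶ Spec (.of k) :=
  Spec.map (CommRingCat.ofHom (algebraMap k (TargetRing k r ⧸ RingHom.ker (gammaStar k r))))

/-- The morphism `γ^R` from `Spec R[[x₁, x₂, z]]` onto its scheme-theoretic image `Γ`. -/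
def gammaMap : Spec (.of (SourceRing k r)) ⟶ Gamma k r :=
  Spec.map (CommRingCat.ofHom (RingHom.kerLift (gammaStar k r : TargetRing k r →+* SourceRing k r)))

end Gamma

end DualVar

end

noncomputable section

namespace DualVar

/-! ### Powers of the maximal ideal of a power series ring -/

section PowerSeries

variable {k : Type*} [Field k] {σ : Type*}

/-! Near P take étale coordinates x on X and y on the parameter space, and let Φ be the local
equation of the universal divisor. Since P lies over no base point, some derivative of Φ in y is a
unit, and the minors defining the critical scheme reduce to the equations Φ = 0 and ∂Φ/∂xᵢ = 0
(`ker_toCRing`). Injectivity of dΨ makes the y-linear parts of these equations independent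
(`linearIndependent_lin_critEqs`), so the critical scheme has m - 1 formal coordinates
(`exists_formalCoords_CRing`). Since the degeneracy scheme is regular of dimension m - 2, the square
root of the Hessian determinant has a nonzero linear part (`exists_sq_eq_det_hessian`).

The Hessian at P has an invertible principal block of maximal size. Setting the derivatives of Φ in
the corresponding x to zero eliminates these x and leaves a function F of the other x and of y. The
Hessian of F is a Schur complement: it vanishes at the origin and has the same determinant up to a
unit. Its diagonal is zero because ∂² = 0 in characteristic two. A determinant whose square root has
order one then forces exactly two x to remain (`exists_normalForm_of_block`).

In characteristic two F = a + b x₀ + c x₁ + d x₀x₁ with a, b, c, d in k[[x₀², x₁², y]]. On the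
critical scheme F and its two derivatives vanish. With z = d = ∂₀∂₁F this says c = x₀z, b = x₁z, a =
x₀x₁z. The projection to the y-space factors through Spec k[[x₀², x₁², y]]. There x₀², x₁², a, b, c,
d and m - 4 of the y are coordinates, while x₀, x₁, z and the same y are coordinates on the critical
scheme. In these coordinates the first factor of the projection is γ^R (`exists_normalForm`). The
inequality 4 ≤ m comes from the independence of the y-linear parts of F, ∂₀F, ∂₁F and ∂₀∂₁F.

Local rings are compared with power series through `IsFormalCoords`: étale coordinates are formal
coordinates (`IsEtaleCoords.isFormalCoords`), a homomorphism to power series is determined by its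
values on them, and `exists_iso_of_normalForm` passes to completions. -/

lemma MvPowerSeries.mem_maximalIdeal_iff {f : MvPowerSeries σ k} :
    f ∈ maximalIdeal (MvPowerSeries σ k) ↔ MvPowerSeries.constantCoeff f = 0 := by
  rw [mem_maximalIdeal, mem_nonunits_iff, MvPowerSeries.isUnit_iff_constantCoeff, isUnit_iff_ne_zero,
    not_not]

lemma MvPowerSeries.X_mem_maximalIdeal (i : σ) :
    (MvPowerSeries.X i : MvPowerSeries σ k) ∈ maximalIdeal (MvPowerSeries σ k) := by
  rw [MvPowerSeries.mem_maximalIdeal_iff, MvPowerSeries.constantCoeff_X]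

lemma MvPowerSeries.le_order_of_mem_pow {f : MvPowerSeries σ k} {n : ℕ}
    (hf : f ∈ maximalIdeal (MvPowerSeries σ k) ^ n) : (n : ℕ∞) ≤ f.order := by
  induction n generalizing f with
  | zero => simp
  | succ n ih =>
    rw [pow_succ'] at hf
    induction hf using Submodule.mul_induction_on' with
    | mem_mul_mem a ha b hb =>
      have h1 : (1 : ℕ∞) ≤ a.order :=
        MvPowerSeries.one_le_order_iff_constCoeff_eq_zero.mpr
          (MvPowerSeries.mem_maximalIdeal_iff.mp ha)
      have h2 := ih hb
      refine le_trans ?_ MvPowerSeries.le_order_mul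
      push_cast
      rw [add_comm]
      exact add_le_add h1 h2
    | add a ha b hb h1 h2 =>
      exact le_trans (le_min h1 h2) MvPowerSeries.min_order_le_add

/-- Power series are the adic completion of polynomials. As the ideal of variables is finitely
generated, its n-th power generates the kernel of reduction modulo that power. -/
lemma MvPowerSeries.mem_span_X_pow [Finite σ] {f : MvPowerSeries σ k} {n : ℕ}
    (hf : ∀ d, Finsupp.degree d < n → f.coeff d = 0) :
    f ∈ (Ideal.span (Set.range MvPowerSeries.X) : Ideal (MvPowerSeries σ k)) ^ n := by
  let e := MvPowerSeries.toAdicCompletionAlgEquiv σ k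
  have h1 : e f ∈ (MvPolynomial.idealOfVars σ k ^ n • ⊤ :
      Submodule (MvPolynomial σ k) (AdicCompletion (MvPolynomial.idealOfVars σ k)
        (MvPolynomial σ k))) := by
    rw [AdicCompletion.pow_smul_top_eq_ker_eval (MvPolynomial.idealOfVars_fg σ k)]
    change (MvPowerSeries.toAdicCompletion σ k f).val n = 0
    rw [MvPowerSeries.toAdicCompletion_apply_eq_mk_truncTotal]
    have h0 : f.truncTotal n = 0 := by
      ext d
      rw [MvPowerSeries.coeff_truncTotal_eq_ite]
      split_ifs with h
      · simpa using hf d h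
      · simp
    rw [h0]
    rfl
  have h2 : ∀ g ∈ (MvPolynomial.idealOfVars σ k ^ n • ⊤ :
      Submodule (MvPolynomial σ k) (AdicCompletion (MvPolynomial.idealOfVars σ k)
        (MvPolynomial σ k))), e.symm g ∈
        (Ideal.span (Set.range MvPowerSeries.X) : Ideal (MvPowerSeries σ k)) ^ n := by
    intro g hg
    induction hg using Submodule.smul_induction_on' with
    | smul r hr g _ =>
      rw [map_smul, Algebra.smul_def]
      refine Ideal.mul_mem_right _ _ ?_
      have hle : (MvPolynomial.idealOfVars σ k).map
          (algebraMap (MvPolynomial σ k) (MvPowerSeries σ k)) ≤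
            Ideal.span (Set.range MvPowerSeries.X) := by
        rw [Ideal.map_span, Ideal.span_le]
        rintro _ ⟨_, ⟨i, rfl⟩, rfl⟩
        rw [MvPowerSeries.algebraMap_apply']
        simpa using Ideal.subset_span (Set.mem_range_self i)
      refine Ideal.pow_right_mono hle n ?_
      rw [← Ideal.map_pow]
      exact Ideal.mem_map_of_mem _ hr
    | add a _ b _ h1 h2 => rw [map_add]; exact add_mem h1 h2
  rw [← e.symm_apply_apply f]
  exact h2 _ h1

lemma MvPowerSeries.span_X_eq_maximalIdeal [Finite σ] :
    (Ideal.span (Set.range MvPowerSeries.X) : Ideal (MvPowerSeries σ k)) = maximalIdeal _ := by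
  refine le_antisymm ?_ fun f hf => ?_
  · rw [Ideal.span_le]
    rintro _ ⟨i, rfl⟩
    exact MvPowerSeries.X_mem_maximalIdeal i
  · rw [← pow_one (Ideal.span _)]
    refine MvPowerSeries.mem_span_X_pow fun d hd => ?_
    obtain rfl : d = 0 := by simpa [Finsupp.degree_eq_zero_iff] using hd
    exact MvPowerSeries.mem_maximalIdeal_iff.mp hf

lemma MvPowerSeries.mem_pow_maximalIdeal_iff [Finite σ] {f : MvPowerSeries σ k} {n : ℕ} :
    f ∈ maximalIdeal (MvPowerSeries σ k) ^ n ↔ ∀ d, Finsupp.degree d < n → f.coeff d = 0 := by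
  constructor
  · intro hf d hd
    exact MvPowerSeries.coeff_of_lt_order
      (lt_of_lt_of_le (by exact_mod_cast hd) (MvPowerSeries.le_order_of_mem_pow hf))
  · intro hf
    rw [← MvPowerSeries.span_X_eq_maximalIdeal]
    exact MvPowerSeries.mem_span_X_pow hf

lemma MvPowerSeries.mem_pow_maximalIdeal_iff_le_order [Finite σ] {f : MvPowerSeries σ k} {n : ℕ} :
    f ∈ maximalIdeal (MvPowerSeries σ k) ^ n ↔ (n : ℕ∞) ≤ f.order := by
  refine ⟨MvPowerSeries.le_order_of_mem_pow, fun h => ?_⟩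
  exact MvPowerSeries.mem_pow_maximalIdeal_iff.mpr fun d hd =>
    MvPowerSeries.coeff_of_lt_order (lt_of_lt_of_le (by exact_mod_cast hd) h)

lemma MvPowerSeries.eq_of_forall_sub_mem_pow [Finite σ] {f g : MvPowerSeries σ k}
    (h : ∀ n, f - g ∈ maximalIdeal (MvPowerSeries σ k) ^ n) : f = g := by
  ext d
  have := MvPowerSeries.mem_pow_maximalIdeal_iff.mp (h (d.degree + 1)) d (Nat.lt_succ_self _)
  rwa [map_sub, sub_eq_zero] at this

lemma MvPowerSeries.coe_mem_pow_maximalIdeal_iff [Finite σ] {p : MvPolynomial σ k} {n : ℕ} :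
    (p : MvPowerSeries σ k) ∈ maximalIdeal (MvPowerSeries σ k) ^ n ↔
      p ∈ MvPolynomial.idealOfVars σ k ^ n := by
  rw [MvPowerSeries.mem_pow_maximalIdeal_iff, MvPolynomial.mem_pow_idealOfVars_iff']
  simp

lemma MvPowerSeries.sub_truncTotal_mem [Finite σ] (f : MvPowerSeries σ k) (n : ℕ) :
    f - (f.truncTotal n : MvPolynomial σ k) ∈ maximalIdeal (MvPowerSeries σ k) ^ n := by
  rw [MvPowerSeries.mem_pow_maximalIdeal_iff]
  intro d hd
  rw [map_sub, MvPolynomial.coeff_coe, MvPowerSeries.coeff_truncTotal _ hd, sub_self]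

end PowerSeries

/-! ### Formal coordinates -/

section FormalCoords

variable (k : Type*) [Field k] {A : Type*} [CommRing A] [IsLocalRing A] [Algebra k A]
  {σ : Type*}

/-- A family `v` of elements of the maximal ideal of a local `k`-algebra is a system of formal
coordinates if it induces isomorphisms `k[σ] / (σ) ^ n ≅ A / 𝔪 ^ n`. -/
structure IsFormalCoords (v : σ → A) : Prop where
  mem : ∀ i, v i ∈ maximalIdeal A
  surj : ∀ (n : ℕ) (a : A), ∃ p : MvPolynomial σ k, a - MvPolynomial.aeval v p ∈ maximalIdeal A ^ n
  inj : ∀ (n : ℕ) (p : MvPolynomial σ k), MvPolynomial.aeval v p ∈ maximalIdeal A ^ n →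
    p ∈ MvPolynomial.idealOfVars σ k ^ n

/-- A homomorphism to a local ring that induces isomorphisms modulo all powers of the maximal
ideals. -/
structure IsCompletionMap {B : Type*} [CommRing B] [IsLocalRing B] [Algebra k B]
    (j : A →ₐ[k] B) : Prop where
  mem_iff : ∀ (n : ℕ) (a : A), j a ∈ maximalIdeal B ^ n ↔ a ∈ maximalIdeal A ^ n
  dense : ∀ (n : ℕ) (b : B), ∃ a, b - j a ∈ maximalIdeal B ^ n

variable {k}

lemma aeval_mem_pow {v : σ → A} (hv : ∀ i, v i ∈ maximalIdeal A) {n : ℕ} {p : MvPolynomial σ k}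
    (hp : p ∈ MvPolynomial.idealOfVars σ k ^ n) : MvPolynomial.aeval v p ∈ maximalIdeal A ^ n := by
  have hle : (MvPolynomial.idealOfVars σ k).map (MvPolynomial.aeval (R := k) v) ≤
      maximalIdeal A := by
    rw [Ideal.map_span, Ideal.span_le]
    rintro _ ⟨_, ⟨i, rfl⟩, rfl⟩
    simpa using hv i
  refine Ideal.pow_right_mono hle n ?_
  rw [← Ideal.map_pow]
  exact Ideal.mem_map_of_mem _ hp

lemma IsFormalCoords.aeval_mem_iff {v : σ → A} (hv : IsFormalCoords k v) {n : ℕ}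
    {p : MvPolynomial σ k} :
    MvPolynomial.aeval v p ∈ maximalIdeal A ^ n ↔ p ∈ MvPolynomial.idealOfVars σ k ^ n :=
  ⟨hv.inj n p, aeval_mem_pow hv.mem⟩

lemma MvPowerSeries.isFormalCoords_X [Finite σ] :
    IsFormalCoords k (fun i : σ => (MvPowerSeries.X i : MvPowerSeries σ k)) := by
  have key : ∀ p : MvPolynomial σ k,
      MvPolynomial.aeval (fun i : σ => (MvPowerSeries.X i : MvPowerSeries σ k)) p = p := by
    intro p
    have : MvPolynomial.aeval (fun i : σ => (MvPowerSeries.X i : MvPowerSeries σ k)) =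
        (MvPolynomial.coeToMvPowerSeries.algHom k : MvPolynomial σ k →ₐ[k] MvPowerSeries σ k) := by
      ext i : 1
      simp
    rw [this]
    simp
  refine ⟨MvPowerSeries.X_mem_maximalIdeal, fun n a => ⟨a.truncTotal n, ?_⟩, fun n p hp => ?_⟩
  · rw [key]
    exact MvPowerSeries.sub_truncTotal_mem a n
  · rw [key] at hp
    exact MvPowerSeries.coe_mem_pow_maximalIdeal_iff.mp hp

/-- Two local homomorphisms to a power series ring which agree on formal coordinates are equal. -/
lemma IsFormalCoords.algHom_ext {τ : Type*} [Finite τ] {v : σ → A} (hv : IsFormalCoords k v)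
    {f g : A →ₐ[k] MvPowerSeries τ k} (hf : ∀ a ∈ maximalIdeal A, f a ∈ maximalIdeal _)
    (hg : ∀ a ∈ maximalIdeal A, g a ∈ maximalIdeal _) (h : ∀ i, f (v i) = g (v i)) : f = g := by
  have hpow : ∀ (f : A →ₐ[k] MvPowerSeries τ k) (_ : ∀ a ∈ maximalIdeal A, f a ∈ maximalIdeal _)
      (n : ℕ) (a : A), a ∈ maximalIdeal A ^ n → f a ∈ maximalIdeal (MvPowerSeries τ k) ^ n := by
    intro f hf n a ha
    have : (maximalIdeal A).map f ≤ maximalIdeal (MvPowerSeries τ k) :=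
      Ideal.map_le_iff_le_comap.mpr hf
    refine Ideal.pow_right_mono this n ?_
    rw [← Ideal.map_pow]
    exact Ideal.mem_map_of_mem _ ha
  refine AlgHom.ext fun a => MvPowerSeries.eq_of_forall_sub_mem_pow fun n => ?_
  obtain ⟨p, hp⟩ := hv.surj n a
  have h1 : f (MvPolynomial.aeval v p) = g (MvPolynomial.aeval v p) := by
    rw [MvPolynomial.comp_aeval_apply, MvPolynomial.comp_aeval_apply]
    simp only [h]
  have h2 := sub_mem (hpow f hf n _ hp) (hpow g hg n _ hp)
  rw [map_sub, map_sub, h1] at h2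
  simpa using h2

/-! ### Taylor expansion in formal coordinates -/

section ToPowerSeries

variable [Finite σ] {v : σ → A} (hv : IsFormalCoords k v)

/-- The Taylor series of an element in formal coordinates. -/
def IsFormalCoords.taylor (a : A) : MvPowerSeries σ k :=
  -- Precision `d.degree + 1` determines the coefficient at d: by `inj` it does not depend on the
  -- chosen polynomial.
  fun d => (hv.surj (d.degree + 1) a).choose.coeff d

lemma IsFormalCoords.taylor_sub_mem {a : A} {p : MvPolynomial σ k} {n : ℕ}
    (h : a - MvPolynomial.aeval v p ∈ maximalIdeal A ^ n) :
    hv.taylor a - p ∈ maximalIdeal (MvPowerSeries σ k) ^ n := by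
  rw [MvPowerSeries.mem_pow_maximalIdeal_iff]
  intro d hd
  have h1 := (hv.surj (d.degree + 1) a).choose_spec
  have h2 := sub_mem (Ideal.pow_le_pow_right hd h) h1
  rw [sub_sub_sub_cancel_left, ← map_sub, hv.aeval_mem_iff, MvPolynomial.mem_pow_idealOfVars_iff']
    at h2
  have h3 := h2 d (Nat.lt_succ_self _)
  rw [map_sub, MvPolynomial.coeff_coe]
  rwa [MvPolynomial.coeff_sub] at h3

/-- Additivity and multiplicativity of the Taylor series follow from this criterion by adding and
multiplying polynomial approximations. -/
lemma IsFormalCoords.taylor_eq {a : A} {f : MvPowerSeries σ k}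
    (h : ∀ n, ∃ p : MvPolynomial σ k, a - MvPolynomial.aeval v p ∈ maximalIdeal A ^ n ∧
      f - p ∈ maximalIdeal (MvPowerSeries σ k) ^ n) : hv.taylor a = f := by
  refine MvPowerSeries.eq_of_forall_sub_mem_pow fun n => ?_
  obtain ⟨p, h1, h2⟩ := h n
  simpa using sub_mem (hv.taylor_sub_mem h1) h2

lemma IsFormalCoords.taylor_aeval (p : MvPolynomial σ k) :
    hv.taylor (MvPolynomial.aeval v p) = p :=
  hv.taylor_eq fun n => ⟨p, by simp, by simp⟩

/-- The Taylor expansion in formal coordinates. -/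
def IsFormalCoords.toPowerSeries : A →ₐ[k] MvPowerSeries σ k where
  toFun := hv.taylor
  map_one' := by simpa using hv.taylor_aeval 1
  map_zero' := by simpa using hv.taylor_aeval 0
  map_add' a b := hv.taylor_eq fun n => by
    obtain ⟨p, hp⟩ := hv.surj n a
    obtain ⟨q, hq⟩ := hv.surj n b
    refine ⟨p + q, ?_, ?_⟩
    · rw [map_add, add_sub_add_comm]
      exact add_mem hp hq
    · rw [MvPolynomial.coe_add, add_sub_add_comm]
      exact add_mem (hv.taylor_sub_mem hp) (hv.taylor_sub_mem hq)
  map_mul' a b := hv.taylor_eq fun n => by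
    obtain ⟨p, hp⟩ := hv.surj n a
    obtain ⟨q, hq⟩ := hv.surj n b
    refine ⟨p * q, ?_, ?_⟩
    · have : a * b - MvPolynomial.aeval v (p * q) = a * (b - MvPolynomial.aeval v q) +
          (a - MvPolynomial.aeval v p) * MvPolynomial.aeval v q := by rw [map_mul]; ring
      rw [this]
      exact add_mem (Ideal.mul_mem_left _ _ hq) (Ideal.mul_mem_right _ _ hp)
    · have : hv.taylor a * hv.taylor b - ((p * q : MvPolynomial σ k) : MvPowerSeries σ k) =
          hv.taylor a * (hv.taylor b - q) + (hv.taylor a - p) * q := by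
        rw [MvPolynomial.coe_mul]; ring
      rw [this]
      exact add_mem (Ideal.mul_mem_left _ _ (hv.taylor_sub_mem hq))
        (Ideal.mul_mem_right _ _ (hv.taylor_sub_mem hp))
  commutes' r := by simpa [MvPowerSeries.algebraMap_apply] using hv.taylor_aeval (MvPolynomial.C r)

lemma IsFormalCoords.toPowerSeries_coord (i : σ) : hv.toPowerSeries (v i) = MvPowerSeries.X i := by
  have := hv.taylor_aeval (MvPolynomial.X i)
  rwa [MvPolynomial.aeval_X, MvPolynomial.coe_X] at this

lemma IsFormalCoords.isCompletionMap : IsCompletionMap k hv.toPowerSeries where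
  mem_iff n a := by
    obtain ⟨p, hp⟩ := hv.surj n a
    have h1 : hv.toPowerSeries a - p ∈ _ := hv.taylor_sub_mem hp
    rw [← sub_add_cancel (hv.toPowerSeries a) (p : MvPowerSeries σ k), Ideal.add_mem_iff_right _ h1,
      MvPowerSeries.coe_mem_pow_maximalIdeal_iff, ← hv.aeval_mem_iff,
      ← Ideal.add_mem_iff_right _ hp, sub_add_cancel]
  dense n b := by
    refine ⟨MvPolynomial.aeval v (b.truncTotal n), ?_⟩
    have h1 : hv.toPowerSeries (MvPolynomial.aeval v (b.truncTotal n)) = (b.truncTotal n) :=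
      hv.taylor_aeval _
    rw [h1]
    exact MvPowerSeries.sub_truncTotal_mem b n

end ToPowerSeries

/-! #### Change of coordinates and quotients -/

lemma IsFormalCoords.exists_sub_C_mem {v : σ → A} (hv : IsFormalCoords k v) (a : A) :
    ∃ c : k, a - algebraMap k A c ∈ maximalIdeal A := by
  obtain ⟨p, hp⟩ := hv.surj 1 a
  rw [pow_one] at hp
  refine ⟨MvPolynomial.constantCoeff p, ?_⟩
  have h1 : p - MvPolynomial.C (MvPolynomial.constantCoeff p) ∈
      MvPolynomial.idealOfVars σ k ^ 1 := by
    rw [MvPolynomial.mem_pow_idealOfVars_iff']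
    intro d hd
    obtain rfl : d = 0 := by simpa [Finsupp.degree_eq_zero_iff] using hd
    simp [MvPolynomial.constantCoeff_eq]
  have h2 := aeval_mem_pow hv.mem h1
  rw [pow_one, map_sub, MvPolynomial.aeval_C] at h2
  simpa using add_mem hp h2

/-- Elements spanning the cotangent space generate the ring formally. -/
lemma exists_sub_aeval_mem {w : σ → A}
    (hres : ∀ a : A, ∃ c : k, a - algebraMap k A c ∈ maximalIdeal A)
    (hspan : ∀ a ∈ maximalIdeal A, ∃ p : MvPolynomial σ k,
      a - MvPolynomial.aeval w p ∈ maximalIdeal A ^ 2) (n : ℕ) (a : A) :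
    ∃ p : MvPolynomial σ k, a - MvPolynomial.aeval w p ∈ maximalIdeal A ^ n := by
  -- Successive approximation: products of approximations of the factors approximate a product of n
  -- elements of 𝔪 to order n + 1.
  have step : ∀ n, ∀ a ∈ maximalIdeal A ^ n, ∃ p : MvPolynomial σ k,
      a - MvPolynomial.aeval w p ∈ maximalIdeal A ^ (n + 1) := by
    intro n
    induction n with
    | zero =>
      intro a _
      obtain ⟨c, hc⟩ := hres a
      exact ⟨MvPolynomial.C c, by simpa using hc⟩
    | succ n ih =>
      intro a ha
      rw [pow_succ'] at ha
      induction ha using Submodule.mul_induction_on' with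
      | mem_mul_mem b hb c hc =>
        obtain ⟨p, hp⟩ := hspan b hb
        obtain ⟨q, hq⟩ := ih c hc
        refine ⟨p * q, ?_⟩
        have hq' : MvPolynomial.aeval w q ∈ maximalIdeal A ^ n := by
          have := sub_mem hc (Ideal.pow_le_pow_right n.le_succ hq)
          rwa [sub_sub_cancel] at this
        have : b * c - MvPolynomial.aeval w (p * q) = b * (c - MvPolynomial.aeval w q) +
            (b - MvPolynomial.aeval w p) * MvPolynomial.aeval w q := by
          rw [map_mul]; ring
        rw [this]
        refine add_mem ?_ ?_
        · rw [pow_succ']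
          exact Ideal.mul_mem_mul hb hq
        · rw [show n + 1 + 1 = 2 + n by ring, pow_add]
          exact Ideal.mul_mem_mul hp hq'
      | add b _ c _ h1 h2 =>
        obtain ⟨p, hp⟩ := h1
        obtain ⟨q, hq⟩ := h2
        refine ⟨p + q, ?_⟩
        rw [map_add, add_sub_add_comm]
        exact add_mem hp hq
  induction n with
  | zero => exact ⟨0, by simp⟩
  | succ n ih =>
    obtain ⟨p, hp⟩ := ih
    obtain ⟨q, hq⟩ := step n _ hp
    exact ⟨p + q, by rwa [map_add, ← sub_sub]⟩

/-- The finitely many coefficients in degree less than n embed the quotient into a finite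
dimensional space. This dimension count is what `IsFormalCoords.of_span` rests on. -/
instance finite_quotient_idealOfVars_pow [Finite σ] (n : ℕ) :
    Module.Finite k (MvPolynomial σ k ⧸ MvPolynomial.idealOfVars σ k ^ n) := by
  have hfin : Finite {d : σ →₀ ℕ // d.degree < n} := (Finsupp.finite_of_degree_lt n).to_subtype
  let F : MvPolynomial σ k →ₗ[k] ({d : σ →₀ ℕ // d.degree < n} → k) :=
    LinearMap.pi fun d => MvPolynomial.lcoeff k d.1
  let G := Submodule.liftQ ((MvPolynomial.idealOfVars σ k ^ n).restrictScalars k) F (by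
    intro p hp
    rw [LinearMap.mem_ker]
    funext d
    exact (MvPolynomial.mem_pow_idealOfVars_iff' n p).mp hp d.1 d.2)
  have hG : Function.Injective G := by
    rw [← LinearMap.ker_eq_bot, Submodule.ker_liftQ_eq_bot']
    ext p
    rw [Submodule.restrictScalars_mem, MvPolynomial.mem_pow_idealOfVars_iff', LinearMap.mem_ker]
    refine ⟨fun h => funext fun d => h d.1 d.2, fun h d hd => congrFun h ⟨d, hd⟩⟩
  exact Module.Finite.of_injective G hG

/-- As many elements as there are formal coordinates are formal coordinates as soon as they span
the cotangent space. -/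
lemma IsFormalCoords.of_span [Finite σ] {τ : Type*} {v : σ → A} (hv : IsFormalCoords k v)
    (e : τ ≃ σ) {w : τ → A} (hw : ∀ i, w i ∈ maximalIdeal A)
    (hspan : ∀ a ∈ maximalIdeal A, ∃ p : MvPolynomial τ k,
      a - MvPolynomial.aeval w p ∈ maximalIdeal A ^ 2) : IsFormalCoords k w := by
  have hfin : Finite τ := Finite.of_equiv _ e.symm
  have hsurj := exists_sub_aeval_mem hv.exists_sub_C_mem hspan
  refine ⟨hw, hsurj, fun n p hp => ?_⟩
  let I := (MvPolynomial.idealOfVars τ k ^ n).restrictScalars k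
  let J := (maximalIdeal A ^ n).restrictScalars k
  let F : (MvPolynomial τ k ⧸ I) →ₗ[k] (A ⧸ J) :=
    Submodule.mapQ I J (MvPolynomial.aeval w).toLinearMap fun p hp => aeval_mem_pow hw hp
  let v' : τ → A := v ∘ e
  have hv' : ∀ p : MvPolynomial τ k, MvPolynomial.aeval v' p =
      MvPolynomial.aeval v (MvPolynomial.rename e p) := fun p => by
    rw [MvPolynomial.aeval_rename]
  have hmem' : ∀ i, v' i ∈ maximalIdeal A := fun i => hv.mem _
  let G : (MvPolynomial τ k ⧸ I) →ₗ[k] (A ⧸ J) :=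
    Submodule.mapQ I J (MvPolynomial.aeval v').toLinearMap fun p hp => aeval_mem_pow hmem' hp
  have hG : Function.Bijective G := by
    constructor
    · rw [injective_iff_map_eq_zero]
      rintro ⟨p⟩ hp
      have h1 : MvPolynomial.aeval v' p ∈ maximalIdeal A ^ n :=
        (Submodule.Quotient.mk_eq_zero J).mp hp
      rw [hv', hv.aeval_mem_iff] at h1
      have h2 : p ∈ MvPolynomial.idealOfVars τ k ^ n := by
        rw [MvPolynomial.mem_pow_idealOfVars_iff'] at h1 ⊢
        intro d hd
        rw [← MvPolynomial.coeff_rename_mapDomain e e.injective]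
        exact h1 _ (by rwa [Finsupp.degree_mapDomain])
      exact (Submodule.Quotient.mk_eq_zero I).mpr h2
    · rintro ⟨a⟩
      obtain ⟨q, hq⟩ := hv.surj n a
      refine ⟨Submodule.Quotient.mk (MvPolynomial.rename e.symm q), ?_⟩
      refine ((Submodule.Quotient.eq J).mpr ?_).symm
      change a - MvPolynomial.aeval v' _ ∈ maximalIdeal A ^ n
      rw [hv', MvPolynomial.rename_rename]
      simpa using hq
  have hF : Function.Surjective F := by
    rintro ⟨a⟩
    obtain ⟨q, hq⟩ := hsurj n a
    exact ⟨Submodule.Quotient.mk q, ((Submodule.Quotient.eq J).mpr hq).symm⟩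
  let G' := LinearEquiv.ofBijective G hG
  have hfd : Module.Finite k (MvPolynomial τ k ⧸ I) := finite_quotient_idealOfVars_pow n
  -- A surjective endomorphism of a finite dimensional space is injective.
  have h1 : Function.Injective (G'.symm.toLinearMap ∘ₗ F) :=
    LinearMap.injective_iff_surjective.mpr (G'.symm.surjective.comp hF)
  have h2 : Function.Injective F := Function.Injective.of_comp (f := G'.symm) h1
  have h3 : F (Submodule.Quotient.mk p) = 0 := (Submodule.Quotient.mk_eq_zero J).mpr hp
  exact (Submodule.Quotient.mk_eq_zero I).mp ((map_eq_zero_iff F h2).mp h3)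

/-- Dividing by some of the formal coordinates leaves the others. -/
lemma IsFormalCoords.quotient {ρ : Type*} {v : σ ⊕ ρ → A} (hv : IsFormalCoords k v)
    {C : Type*} [CommRing C] [IsLocalRing C] [Algebra k C] (π : A →ₐ[k] C)
    (hπ : Function.Surjective π)
    (hker : RingHom.ker π = Ideal.span (Set.range (v ∘ Sum.inr))) :
    IsFormalCoords k (π ∘ v ∘ Sum.inl) := by
  have hloc : IsLocalHom (π : A →+* C) := .of_surjective _ hπ
  have hmem : ∀ a ∈ maximalIdeal A, π a ∈ maximalIdeal C := fun a ha =>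
    map_nonunit (π : A →+* C) a ha
  have hmap : (maximalIdeal A).map (π : A →+* C) = maximalIdeal C := by
    refine le_antisymm (Ideal.map_le_iff_le_comap.mpr hmem) fun c hc => ?_
    obtain ⟨a, rfl⟩ := hπ c
    refine Ideal.mem_map_of_mem (π : A →+* C) ?_
    by_contra h
    exact hc ((not_not.mp h : IsUnit a).map π)
  have haeval : ∀ p : MvPolynomial σ k, MvPolynomial.aeval (π ∘ v ∘ Sum.inl) p =
      π (MvPolynomial.aeval v (MvPolynomial.rename Sum.inl p)) := fun p => by
    rw [MvPolynomial.aeval_rename, MvPolynomial.comp_aeval_apply]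
    rfl
  -- Polynomial counterpart of π: it sets the variables of the killed coordinates to zero.
  let r : MvPolynomial (σ ⊕ ρ) k →ₐ[k] MvPolynomial σ k :=
    MvPolynomial.aeval (Sum.elim MvPolynomial.X 0)
  have hr : ∀ p : MvPolynomial (σ ⊕ ρ) k, π (MvPolynomial.aeval v p) =
      MvPolynomial.aeval (π ∘ v ∘ Sum.inl) (r p) := fun p => by
    rw [MvPolynomial.comp_aeval_apply, MvPolynomial.comp_aeval_apply]
    congr 2
    funext i
    rcases i with i | i
    · simp
    · have : v (Sum.inr i) ∈ RingHom.ker π := by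
        rw [hker]
        exact Ideal.subset_span ⟨i, rfl⟩
      simpa using this
  refine ⟨fun i => hmem _ (hv.mem _), fun n c => ?_, fun n p hp => ?_⟩
  · obtain ⟨a, rfl⟩ := hπ c
    obtain ⟨p, hp⟩ := hv.surj n a
    refine ⟨r p, ?_⟩
    rw [← hr, ← map_sub, ← hmap, ← Ideal.map_pow]
    exact Ideal.mem_map_of_mem (π : A →+* C) hp
  · rw [haeval, ← hmap, ← Ideal.map_pow] at hp
    obtain ⟨a, ha, hap⟩ := (Ideal.mem_map_iff_of_surjective (π : A →+* C) hπ).mp hp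
    have h1 : MvPolynomial.aeval v (MvPolynomial.rename Sum.inl p) - a ∈
        Ideal.span (Set.range (v ∘ Sum.inr)) := by
      rw [← hker, RingHom.mem_ker, map_sub, sub_eq_zero]
      exact hap.symm
    -- Elements of the kernel of π are approximated by polynomials in the kernel of r. Subtracting
    -- such a polynomial from p leaves one of order at least n whose image under r is still p.
    have h2 : ∀ b ∈ Ideal.span (Set.range (v ∘ Sum.inr)), ∃ q : MvPolynomial (σ ⊕ ρ) k, r q = 0 ∧
        b - MvPolynomial.aeval v q ∈ maximalIdeal A ^ n := by
      intro b hb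
      induction hb using Submodule.span_induction with
      | mem b hb =>
        obtain ⟨i, rfl⟩ := hb
        exact ⟨MvPolynomial.X (Sum.inr i), by simp [r], by simp⟩
      | zero => exact ⟨0, by simp, by simp⟩
      | add b c _ _ hb hc =>
        obtain ⟨q, hq, hq'⟩ := hb
        obtain ⟨q₂, hq₂, hq₂'⟩ := hc
        exact ⟨q + q₂, by rw [map_add, hq, hq₂, add_zero], by
          rw [map_add, add_sub_add_comm]; exact add_mem hq' hq₂'⟩
      | smul c b _ hb =>
        obtain ⟨q, hq, hq'⟩ := hb
        obtain ⟨s, hs⟩ := hv.surj n c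
        refine ⟨s * q, by rw [map_mul, hq, mul_zero], ?_⟩
        have : c • b - MvPolynomial.aeval v (s * q) = c * (b - MvPolynomial.aeval v q) +
            (c - MvPolynomial.aeval v s) * MvPolynomial.aeval v q := by
          rw [map_mul, smul_eq_mul]; ring
        rw [this]
        exact add_mem (Ideal.mul_mem_left _ _ hq') (Ideal.mul_mem_right _ _ hs)
    obtain ⟨q, hq, hq'⟩ := h2 _ h1
    have h3 := hv.inj n (MvPolynomial.rename Sum.inl p - q) (by
      have := add_mem hq' ha
      rw [map_sub]
      convert this using 1
      ring)
    have h4 : p = r (MvPolynomial.rename Sum.inl p - q) := by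
      rw [map_sub, hq, sub_zero, MvPolynomial.aeval_rename]
      simp [Function.comp_def]
    rw [h4]
    have hle : (MvPolynomial.idealOfVars (σ ⊕ ρ) k).map r ≤ MvPolynomial.idealOfVars σ k := by
      rw [Ideal.map_span, Ideal.span_le]
      rintro _ ⟨_, ⟨i, rfl⟩, rfl⟩
      rcases i with i | i
      · simpa [r] using Ideal.subset_span (Set.mem_range_self i)
      · simp [r]
    refine Ideal.pow_right_mono hle n ?_
    rw [← Ideal.map_pow]
    exact Ideal.mem_map_of_mem _ h3

end FormalCoords

/-! ### Linear parts in formal coordinates -/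

section Linear

variable {k : Type*} [Field k] {A : Type*} [CommRing A] [IsLocalRing A] [Algebra k A]
  {σ : Type*} [Finite σ] {v : σ → A} (hv : IsFormalCoords k v)

/-- The linear coefficients of the Taylor series. -/
def IsFormalCoords.lin : A →ₗ[k] (σ → k) :=
  LinearMap.pi fun i =>
    MvPowerSeries.coeff (Finsupp.single i 1) ∘ₗ hv.toPowerSeries.toLinearMap

lemma IsFormalCoords.lin_apply (a : A) (i : σ) :
    hv.lin a i = MvPowerSeries.coeff (Finsupp.single i 1) (hv.toPowerSeries a) := rfl

lemma IsFormalCoords.toPowerSeries_mem {a : A} (ha : a ∈ maximalIdeal A) :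
    hv.toPowerSeries a ∈ maximalIdeal (MvPowerSeries σ k) := by
  have := (hv.isCompletionMap.mem_iff 1 a).mpr (by rwa [pow_one])
  rwa [pow_one] at this

lemma IsFormalCoords.mem_sq_iff {a : A} (ha : a ∈ maximalIdeal A) :
    a ∈ maximalIdeal A ^ 2 ↔ hv.lin a = 0 := by
  rw [← hv.isCompletionMap.mem_iff, MvPowerSeries.mem_pow_maximalIdeal_iff]
  constructor
  · intro h
    funext i
    exact h _ (by simp)
  · intro h d hd
    have hd' : d.degree = 0 ∨ d.degree = 1 := by omega
    rcases hd' with hd' | hd'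
    · obtain rfl : d = 0 := by simpa [Finsupp.degree_eq_zero_iff] using hd'
      exact MvPowerSeries.mem_maximalIdeal_iff.mp (hv.toPowerSeries_mem ha)
    · obtain ⟨i, rfl⟩ : d ∈ Set.range (fun i : σ => Finsupp.single i 1) := by
        rw [Finsupp.range_single_one]
        exact hd'
      exact congrFun h i

lemma IsFormalCoords.lin_coord [DecidableEq σ] (i : σ) : hv.lin (v i) = Pi.single i 1 := by
  funext j
  rw [hv.lin_apply, hv.toPowerSeries_coord, MvPowerSeries.coeff_index_single_X, Pi.single_apply]

/-- As many elements as there are formal coordinates are formal coordinates as soon as their linear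
parts are independent. -/
lemma IsFormalCoords.of_linearIndependent {τ : Type*} (e : τ ≃ σ) {w : τ → A}
    (hw : ∀ i, w i ∈ maximalIdeal A) (hli : LinearIndependent k (hv.lin ∘ w)) :
    IsFormalCoords k w := by
  have hfin : Finite τ := Finite.of_equiv _ e.symm
  have := Fintype.ofFinite τ
  have := Fintype.ofFinite σ
  refine hv.of_span e hw fun a ha => ?_
  have htop : Submodule.span k (Set.range (hv.lin ∘ w)) = ⊤ := by
    refine hli.span_eq_top_of_card_eq_finrank' ?_
    rw [Module.finrank_fintype_fun_eq_card, Fintype.card_congr e]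
  have h1 : hv.lin a ∈ Submodule.span k (Set.range (hv.lin ∘ w)) := htop ▸ Submodule.mem_top
  obtain ⟨c, hc⟩ := (Submodule.mem_span_range_iff_exists_fun k).mp h1
  refine ⟨∑ i, MvPolynomial.C (c i) * MvPolynomial.X i, ?_⟩
  have h2 : MvPolynomial.aeval w (∑ i, MvPolynomial.C (c i) * MvPolynomial.X i) =
      ∑ i, c i • w i := by
    simp [Algebra.smul_def]
  have h3 : a - ∑ i, c i • w i ∈ maximalIdeal A :=
    sub_mem ha (sum_mem fun i _ => by
      rw [Algebra.smul_def]
      exact Ideal.mul_mem_left _ _ (hw i))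
  rw [h2, hv.mem_sq_iff h3, map_sub, map_sum, ← hc]
  simp

lemma IsFormalCoords.linearIndependent_lin {τ : Type*} [Fintype τ] {w : τ → A}
    (hw : ∀ i, w i ∈ maximalIdeal A)
    (h : ∀ c : τ → k, ∑ i, c i • w i ∈ maximalIdeal A ^ 2 → c = 0) :
    LinearIndependent k (hv.lin ∘ w) := by
  rw [Fintype.linearIndependent_iff]
  intro c hc
  have h3 : ∑ i, c i • w i ∈ maximalIdeal A :=
    sum_mem fun i _ => by
      rw [Algebra.smul_def]
      exact Ideal.mul_mem_left _ _ (hw i)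
  refine fun i => congrFun (h c ((hv.mem_sq_iff h3).mpr ?_)) i
  rw [map_sum, ← hc]
  simp

end Linear

/-- A linearly independent family can be completed to a basis by standard basis vectors. -/
lemma exists_linearIndependent_sumElim_single {k σ τ : Type*} [Field k] [Fintype σ] [DecidableEq σ]
    [Fintype τ] {u : τ → σ → k} (hu : LinearIndependent k u) :
    ∃ (r : ℕ) (g : Fin r → σ), r + Fintype.card τ = Fintype.card σ ∧
      LinearIndependent k (Sum.elim u fun i => (Pi.single (g i) 1 : σ → k)) := by
  let W := Submodule.span k (Set.range u)
  -- Standard vectors whose classes form a basis of the quotient by the span of u.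
  obtain ⟨κ, a, ha, hspan, hli⟩ := exists_linearIndependent' k
    (fun i : σ => W.mkQ (Pi.single i 1))
  have : Finite κ := Finite.of_injective a ha
  have := Fintype.ofFinite κ
  have htop : Submodule.span k (Set.range (fun i : σ => W.mkQ (Pi.single i 1))) = ⊤ := by
    rw [show (fun i : σ => W.mkQ (Pi.single i 1)) = W.mkQ ∘ (Pi.basisFun k σ) by
      funext i; simp, Set.range_comp, ← Submodule.map_span, Module.Basis.span_eq,
      Submodule.map_top, Submodule.range_mkQ]
  let e : Fin (Fintype.card κ) ≃ κ := (Fintype.equivFin κ).symm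
  refine ⟨Fintype.card κ, a ∘ e, ?_, ?_⟩
  · have h1 := finrank_span_eq_card hli
    rw [hspan, htop, finrank_top] at h1
    have h2 := finrank_span_eq_card hu
    have h3 := Submodule.finrank_quotient_add_finrank W
    rw [Module.finrank_fintype_fun_eq_card] at h3
    rw [← h3, ← h1, ← h2]
  · exact LinearIndependent.sumElim_of_quotient (M' := W)
      (f := fun i => ⟨u i, Submodule.subset_span ⟨i, rfl⟩⟩)
      (LinearIndependent.of_comp W.subtype hu) _ (hli.comp e e.injective)

/-! ### Completions -/

section Completion

variable {k : Type*} [Field k]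

instance MvPowerSeries.isAdicComplete_maximalIdeal {σ : Type*} [Finite σ] :
    IsAdicComplete (maximalIdeal (MvPowerSeries σ k)) (MvPowerSeries σ k) := by
  rw [← MvPowerSeries.span_X_eq_maximalIdeal]
  infer_instance

variable {A B : Type*} [CommRing A] [IsLocalRing A] [Algebra k A] [CommRing B] [IsLocalRing B]
  [Algebra k B] {j : A →ₐ[k] B} (hj : IsCompletionMap k j)

lemma IsCompletionMap.pow_le_comap (hj : IsCompletionMap k j) (n : ℕ) :
    maximalIdeal A ^ n ≤ Ideal.comap j (maximalIdeal B ^ n) :=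
  fun a ha => (hj.mem_iff n a).mpr ha

/-- The isomorphism `A / 𝔪 ^ n ≅ B / 𝔪 ^ n`. -/
def IsCompletionMap.quotientEquiv (n : ℕ) :
    (A ⧸ maximalIdeal A ^ n) ≃ₐ[k] (B ⧸ maximalIdeal B ^ n) :=
  AlgEquiv.ofBijective
    (Ideal.quotientMapₐ (maximalIdeal B ^ n) j (hj.pow_le_comap n)) (by
      constructor
      · rw [injective_iff_map_eq_zero]
        intro a ha
        obtain ⟨a, rfl⟩ := Ideal.Quotient.mk_surjective a
        rw [Ideal.quotient_map_mkₐ] at ha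
        exact Ideal.Quotient.eq_zero_iff_mem.mpr
          ((hj.mem_iff n a).mp (Ideal.Quotient.eq_zero_iff_mem.mp ha))
      · intro b
        obtain ⟨b, rfl⟩ := Ideal.Quotient.mk_surjective b
        obtain ⟨a, ha⟩ := hj.dense n b
        refine ⟨Ideal.Quotient.mk _ a, ?_⟩
        rw [Ideal.quotient_map_mkₐ]
        exact (Ideal.Quotient.eq.mpr ha).symm)

lemma IsCompletionMap.quotientEquiv_mk (n : ℕ) (a : A) :
    hj.quotientEquiv n (Ideal.Quotient.mk _ a) = Ideal.Quotient.mk _ (j a) := rfl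

lemma factor_evalₐ {A : Type*} [CommRing A] {I : Ideal A} {m n : ℕ} (hle : m ≤ n)
    (x : AdicCompletion I A) :
    Ideal.Quotient.factor (Ideal.pow_le_pow_right hle) (AdicCompletion.evalₐ I n x) =
      AdicCompletion.evalₐ I m x := by
  obtain ⟨x, rfl⟩ := AdicCompletion.mk_surjective I A x
  rw [AdicCompletion.evalₐ_mk, AdicCompletion.evalₐ_mk, Ideal.Quotient.factor_mk,
    Ideal.Quotient.eq]
  simpa using SModEq.sub_mem.mp (x.property hle).symm

variable [IsAdicComplete (maximalIdeal B) B]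

/-- The homomorphism from the completion induced by a completion map to a complete ring. -/
def IsCompletionMap.lift : AdicCompletion (maximalIdeal A) A →ₐ[k] B :=
  IsAdicComplete.liftAlgHom (maximalIdeal B)
    (fun n => (hj.quotientEquiv n).toAlgHom.comp
      ((AdicCompletion.evalₐ (maximalIdeal A) n).restrictScalars k)) fun {m n} hle => by
    refine AlgHom.ext fun x => ?_
    obtain ⟨a, ha⟩ := Ideal.Quotient.mk_surjective (AdicCompletion.evalₐ (maximalIdeal A) n x)
    have h := factor_evalₐ hle x
    simp only [AlgHom.comp_apply, AlgHom.restrictScalars_apply, ← h, ← ha]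
    rfl

lemma IsCompletionMap.mk_lift (n : ℕ) (x : AdicCompletion (maximalIdeal A) A) :
    Ideal.Quotient.mk (maximalIdeal B ^ n) (hj.lift x) =
      hj.quotientEquiv n (AdicCompletion.evalₐ (maximalIdeal A) n x) := by
  unfold IsCompletionMap.lift
  refine (IsAdicComplete.mk_liftAlgHom _ _ (fun {m n} hle => ?_) n x).trans rfl
  refine AlgHom.ext fun x => ?_
  obtain ⟨a, ha⟩ := Ideal.Quotient.mk_surjective (AdicCompletion.evalₐ (maximalIdeal A) n x)
  have h := factor_evalₐ hle x
  simp only [AlgHom.comp_apply, AlgHom.restrictScalars_apply, ← h, ← ha]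
  rfl

/-- Injectivity is checked modulo each power. A preimage of b is the Cauchy sequence of its
approximations from A. -/
lemma IsCompletionMap.lift_bijective : Function.Bijective hj.lift := by
  constructor
  · rw [injective_iff_map_eq_zero]
    intro x hx
    refine AdicCompletion.ext_evalₐ fun n => ?_
    have := hj.mk_lift n x
    rw [hx, map_zero] at this
    rw [map_zero]
    exact ((map_eq_zero_iff _ (hj.quotientEquiv n).injective).mp this.symm)
  · intro b
    choose a ha using fun n => hj.dense n b
    have hcauchy : AdicCompletion.IsAdicCauchy (maximalIdeal A) A a := by
      intro m n hle
      rw [SModEq.sub_mem, smul_eq_mul, Ideal.mul_top, ← hj.mem_iff, map_sub]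
      have := sub_mem (Ideal.pow_le_pow_right hle (ha n)) (ha m)
      rwa [sub_sub_sub_cancel_left] at this
    let s : AdicCompletion.AdicCauchySequence (maximalIdeal A) A := ⟨a, @hcauchy⟩
    refine ⟨AdicCompletion.mk _ _ s, ?_⟩
    refine IsHausdorff.eq_iff_smodEq (I := maximalIdeal B) |>.mpr fun n => ?_
    rw [SModEq.sub_mem, smul_eq_mul, Ideal.mul_top, ← Ideal.Quotient.eq, hj.mk_lift,
      AdicCompletion.evalₐ_mk]
    change hj.quotientEquiv n (Ideal.Quotient.mk _ (a n)) = _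
    rw [hj.quotientEquiv_mk]
    exact (Ideal.Quotient.eq.mpr (ha n)).symm

/-- A completion map to a complete ring extends to an isomorphism from the completion. -/
def IsCompletionMap.completionEquiv : AdicCompletion (maximalIdeal A) A ≃ₐ[k] B :=
  AlgEquiv.ofBijective hj.lift hj.lift_bijective

lemma IsCompletionMap.mk_completionEquiv (n : ℕ) (x : AdicCompletion (maximalIdeal A) A) :
    Ideal.Quotient.mk (maximalIdeal B ^ n) (hj.completionEquiv x) =
      hj.quotientEquiv n (AdicCompletion.evalₐ (maximalIdeal A) n x) :=
  hj.mk_lift n x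

/-- A square of local homomorphisms extends to the completions. -/
lemma IsCompletionMap.completionEquiv_completionMap
    {A B A' B' : Type u} [CommRing A] [IsLocalRing A] [Algebra k A] [CommRing B] [IsLocalRing B]
    [Algebra k B] [IsAdicComplete (maximalIdeal B) B] [CommRing A'] [IsLocalRing A'] [Algebra k A']
    [CommRing B'] [IsLocalRing B'] [Algebra k B'] [IsAdicComplete (maximalIdeal B') B']
    {j : A →ₐ[k] B} (hj : IsCompletionMap k j) {j' : A' →ₐ[k] B'}
    (hj' : IsCompletionMap k j') (φ : A →+* A') [IsLocalHom φ] (γ : B →+* B') [IsLocalHom γ]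
    (h : ∀ a, γ (j a) = j' (φ a)) (x : AdicCompletion (maximalIdeal A) A) :
    γ (hj.completionEquiv x) = hj'.completionEquiv (completionMap φ x) := by
  refine IsHausdorff.eq_iff_smodEq (I := maximalIdeal B') |>.mpr fun n => ?_
  rw [SModEq.sub_mem, smul_eq_mul, Ideal.mul_top, ← Ideal.Quotient.eq, hj'.mk_completionEquiv,
    completionMap, AdicCompletion.evalₐ_liftRingHom]
  obtain ⟨a, ha⟩ := Ideal.Quotient.mk_surjective (AdicCompletion.evalₐ (maximalIdeal A) n x)
  have h1 := hj.mk_completionEquiv n x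
  rw [← ha, hj.quotientEquiv_mk, Ideal.Quotient.eq] at h1
  have h2 : completionToQuotient φ n x = Ideal.Quotient.mk _ (φ a) := by
    rw [completionToQuotient, RingHom.comp_apply, RingHom.coe_coe, ← ha, Ideal.quotientMap_mk]
  rw [h2, hj'.quotientEquiv_mk, ← h, Ideal.Quotient.eq, ← map_sub]
  exact pow_maximalIdeal_le_comap γ n h1

end Completion

/-! ### Étale coordinates -/

section EtaleCoords

open scoped TensorProduct

variable (k : Type u) [Field k] {B : Type u} [CommRing B] [IsLocalRing B] [Algebra k B]
  {σ : Type}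

/-- Elements of the maximal ideal of a local `k`-algebra with residue field `k` that define a
formally étale homomorphism from the polynomial ring. -/
structure IsEtaleCoords (v : σ → B) : Prop where
  mem : ∀ i, v i ∈ maximalIdeal B
  residue : ∀ b : B, ∃ c : k, b - algebraMap k B c ∈ maximalIdeal B
  formallyEtale : (MvPolynomial.aeval v : MvPolynomial σ k →ₐ[k] B).toRingHom.FormallyEtale

variable {k} {v : σ → B}

/-- Formal étaleness identifies the differentials of B with the base change of those of the
polynomial ring. -/
lemma IsEtaleCoords.exists_basis (hv : IsEtaleCoords k v) :
    ∃ b : Module.Basis σ B (Ω[B⁄k]), ∀ i, b i = KaehlerDifferential.D k B (v i) := by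
  let : Algebra (MvPolynomial σ k) B :=
    (MvPolynomial.aeval v : MvPolynomial σ k →ₐ[k] B).toRingHom.toAlgebra
  have : IsScalarTower k (MvPolynomial σ k) B :=
    .of_algebraMap_eq' (MvPolynomial.aeval v : MvPolynomial σ k →ₐ[k] B).comp_algebraMap.symm
  have : Algebra.FormallyEtale (MvPolynomial σ k) B := hv.formallyEtale
  let e := KaehlerDifferential.tensorKaehlerEquivOfFormallyEtale k (MvPolynomial σ k) B
  refine ⟨(Algebra.TensorProduct.basis B (KaehlerDifferential.mvPolynomialBasis k σ)).map e,
    fun i => ?_⟩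
  rw [Module.Basis.map_apply, Algebra.TensorProduct.basis_apply,
    KaehlerDifferential.mvPolynomialBasis_apply,
    KaehlerDifferential.tensorKaehlerEquivOfFormallyEtale_apply,
    KaehlerDifferential.mapBaseChange_tmul, one_smul, KaehlerDifferential.map_D]
  congr 1
  exact MvPolynomial.aeval_X v i

/-- Infinitesimal lifting. The truncated polynomial ring is a nilpotent thickening of the residue
field, so formal smoothness gives an algebra map L over the polynomial ring from B to it. Existence
of L yields injectivity; surjectivity follows because L followed by the map to B modulo a power of 𝔪
is the quotient map, by unramifiedness. -/
lemma IsEtaleCoords.isFormalCoords (hv : IsEtaleCoords k v) : IsFormalCoords k v := by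
  let : Algebra (MvPolynomial σ k) B :=
    (MvPolynomial.aeval v : MvPolynomial σ k →ₐ[k] B).toRingHom.toAlgebra
  have : IsScalarTower k (MvPolynomial σ k) B :=
    .of_algebraMap_eq' (MvPolynomial.aeval v : MvPolynomial σ k →ₐ[k] B).comp_algebraMap.symm
  have : Algebra.FormallyEtale (MvPolynomial σ k) B := hv.formallyEtale
  have halg : ∀ p, algebraMap (MvPolynomial σ k) B p = MvPolynomial.aeval v p := fun _ => rfl
  have hconst : ∀ p : MvPolynomial σ k, MvPolynomial.aeval v p ∈ maximalIdeal B →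
      p ∈ MvPolynomial.idealOfVars σ k := by
    intro p hp
    have h1 : p - MvPolynomial.C (MvPolynomial.constantCoeff p) ∈
        MvPolynomial.idealOfVars σ k ^ 1 := by
      rw [MvPolynomial.mem_pow_idealOfVars_iff']
      intro d hd
      obtain rfl : d = 0 := by simpa [Finsupp.degree_eq_zero_iff] using hd
      simp [MvPolynomial.constantCoeff_eq]
    have h2 := aeval_mem_pow hv.mem h1
    rw [pow_one] at h1 h2
    have h3 := sub_mem hp h2
    rw [map_sub, sub_sub_cancel, MvPolynomial.aeval_C] at h3
    have h4 : MvPolynomial.constantCoeff p = 0 := by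
      by_contra h
      exact h3 ((IsUnit.mk0 _ h).map (algebraMap k B))
    simpa [h4] using h1
  have key : ∀ n, ∃ L : B →ₐ[MvPolynomial σ k]
      (MvPolynomial σ k ⧸ MvPolynomial.idealOfVars σ k ^ (n + 1)),
      ∀ b ∈ maximalIdeal B, L b ∈ (MvPolynomial.idealOfVars σ k).map
        (Ideal.Quotient.mk (MvPolynomial.idealOfVars σ k ^ (n + 1))) := by
    intro n
    let Q := MvPolynomial σ k ⧸ MvPolynomial.idealOfVars σ k ^ (n + 1)
    let g : Q →ₐ[MvPolynomial σ k] ResidueField B :=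
      Ideal.Quotient.liftₐ _ (IsScalarTower.toAlgHom (MvPolynomial σ k) B (ResidueField B) |>.comp
        (Algebra.ofId (MvPolynomial σ k) B)) (by
          intro p hp
          have := aeval_mem_pow hv.mem hp
          have := Ideal.pow_le_self n.succ_ne_zero this
          exact (residue_eq_zero_iff _).mpr this)
    have hgmk : ∀ p, g (Ideal.Quotient.mk _ p) = IsLocalRing.residue B (MvPolynomial.aeval v p) :=
      fun p => rfl
    have hgs : Function.Surjective g := by
      intro y
      obtain ⟨b, rfl⟩ := residue_surjective y
      obtain ⟨c, hc⟩ := hv.residue b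
      refine ⟨Ideal.Quotient.mk _ (MvPolynomial.C c), ?_⟩
      rw [hgmk, MvPolynomial.aeval_C]
      rw [← residue_eq_zero_iff, map_sub, sub_eq_zero] at hc
      exact hc.symm
    have hker : RingHom.ker (g : Q →+* ResidueField B) ≤ (MvPolynomial.idealOfVars σ k).map
        (Ideal.Quotient.mk (MvPolynomial.idealOfVars σ k ^ (n + 1))) := by
      intro q hq
      obtain ⟨p, rfl⟩ := Ideal.Quotient.mk_surjective q
      refine Ideal.mem_map_of_mem _ (hconst p ?_)
      rw [← residue_eq_zero_iff, ← hgmk]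
      exact hq
    have hnil : IsNilpotent (RingHom.ker (g : Q →+* ResidueField B)) := by
      refine ⟨n + 1, le_bot_iff.mp ((Ideal.pow_right_mono hker (n + 1)).trans ?_)⟩
      rw [← Ideal.map_pow, Ideal.map_quotient_self]
    refine ⟨Algebra.FormallySmooth.liftOfSurjective
      (IsScalarTower.toAlgHom (MvPolynomial σ k) B (ResidueField B)) g hgs hnil, fun b hb => ?_⟩
    refine hker ?_
    change g _ = 0
    refine (Algebra.FormallySmooth.liftOfSurjective_apply _ g hgs hnil b).trans ?_
    exact (residue_eq_zero_iff _).mpr hb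
  refine ⟨hv.mem, fun n b => ?_, fun n p hp => ?_⟩
  · rcases n with _ | n
    · exact ⟨0, by simp⟩
    obtain ⟨L, hL⟩ := key n
    let π : (MvPolynomial σ k ⧸ MvPolynomial.idealOfVars σ k ^ (n + 1)) →ₐ[MvPolynomial σ k]
        (B ⧸ maximalIdeal B ^ (n + 1)) :=
      Ideal.Quotient.liftₐ _ (Algebra.ofId (MvPolynomial σ k) (B ⧸ maximalIdeal B ^ (n + 1))) (by
        intro p hp
        exact Ideal.Quotient.eq_zero_iff_mem.mpr (aeval_mem_pow hv.mem hp))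
    have hπ : ∀ p, π (Ideal.Quotient.mk _ p) = Ideal.Quotient.mk _ (MvPolynomial.aeval v p) :=
      fun p => rfl
    have hnil : IsNilpotent ((maximalIdeal B).map
        (Ideal.Quotient.mk (maximalIdeal B ^ (n + 1)))) :=
      ⟨n + 1, by rw [← Ideal.map_pow, Ideal.map_quotient_self]; rfl⟩
    have heq : π.comp L = IsScalarTower.toAlgHom (MvPolynomial σ k) B
        (B ⧸ maximalIdeal B ^ (n + 1)) := by
      -- Two maps that agree modulo a nilpotent ideal are equal. These agree on constants, and both
      -- send 𝔪 into its nilpotent image.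
      refine Algebra.FormallyUnramified.ext _ hnil fun b => ?_
      rw [Ideal.Quotient.eq]
      obtain ⟨c, hc⟩ := hv.residue b
      have h1 : π.comp L (algebraMap k B c) = Ideal.Quotient.mk _ (algebraMap k B c) := by
        have : algebraMap k B c = algebraMap (MvPolynomial σ k) B (MvPolynomial.C c) := by
          rw [halg, MvPolynomial.aeval_C]
        rw [this, AlgHom.commutes]
        rfl
      have h2 : π.comp L (b - algebraMap k B c) ∈ (maximalIdeal B).map
          (Ideal.Quotient.mk (maximalIdeal B ^ (n + 1))) := by
        have h3 : ∀ q ∈ (MvPolynomial.idealOfVars σ k).map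
            (Ideal.Quotient.mk (MvPolynomial.idealOfVars σ k ^ (n + 1))), π q ∈
            (maximalIdeal B).map (Ideal.Quotient.mk (maximalIdeal B ^ (n + 1))) := by
          intro q hq
          obtain ⟨p, hp, rfl⟩ := (Ideal.mem_map_iff_of_surjective _
            Ideal.Quotient.mk_surjective).mp hq
          rw [hπ]
          refine Ideal.mem_map_of_mem _ ?_
          rw [← pow_one (maximalIdeal B)]
          exact aeval_mem_pow hv.mem (by rwa [pow_one])
        exact h3 _ (hL _ hc)
      have h4 : Ideal.Quotient.mk (maximalIdeal B ^ (n + 1)) (b - algebraMap k B c) ∈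
          (maximalIdeal B).map (Ideal.Quotient.mk (maximalIdeal B ^ (n + 1))) :=
        Ideal.mem_map_of_mem _ hc
      have h5 := sub_mem h2 h4
      rw [map_sub, map_sub, h1, sub_sub_sub_cancel_right] at h5
      exact h5
    obtain ⟨p, hp⟩ := Ideal.Quotient.mk_surjective (L b)
    refine ⟨p, ?_⟩
    have := AlgHom.congr_fun heq b
    rw [AlgHom.comp_apply, ← hp, hπ] at this
    exact Ideal.Quotient.eq.mp this.symm
  · rcases n with _ | n
    · simp
    obtain ⟨L, hL⟩ := key n
    have h1 : L (MvPolynomial.aeval v p) = Ideal.Quotient.mk _ p := L.commutes p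
    have h2 : (maximalIdeal B).map (L : B →+* _) ≤ (MvPolynomial.idealOfVars σ k).map
        (Ideal.Quotient.mk (MvPolynomial.idealOfVars σ k ^ (n + 1))) :=
      Ideal.map_le_iff_le_comap.mpr hL
    have h3 : L (MvPolynomial.aeval v p) ∈ ((maximalIdeal B) ^ (n + 1)).map (L : B →+* _) :=
      Ideal.mem_map_of_mem _ hp
    rw [Ideal.map_pow] at h3
    have h4 := Ideal.pow_right_mono h2 (n + 1) h3
    rw [← Ideal.map_pow, Ideal.map_quotient_self, h1] at h4
    exact Ideal.Quotient.eq_zero_iff_mem.mp h4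

/-- The partial derivatives with respect to étale coordinates. -/
def IsEtaleCoords.pd (hv : IsEtaleCoords k v) (i : σ) : Derivation k B B :=
  (hv.exists_basis.choose.coord i).compDer (KaehlerDifferential.D k B)

lemma IsEtaleCoords.pd_coord [DecidableEq σ] (hv : IsEtaleCoords k v) (i j : σ) :
    hv.pd i (v j) = if j = i then 1 else 0 := by
  change hv.exists_basis.choose.coord i (KaehlerDifferential.D k B (v j)) = _
  rw [← hv.exists_basis.choose_spec j, Module.Basis.coord_apply, Module.Basis.repr_self,
    Finsupp.single_apply]

/-- The chain rule. -/
lemma IsEtaleCoords.chain_rule [Fintype σ] (hv : IsEtaleCoords k v) {R : Type u} [CommRing R]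
    [Algebra k R] (f : B →ₐ[k] R) (D : Derivation k R R) (b : B) :
    D (f b) = ∑ i, f (hv.pd i b) * D (f (v i)) := by
  let : Algebra B R := f.toRingHom.toAlgebra
  have : IsScalarTower k B R := .of_algebraMap_eq' f.comp_algebraMap.symm
  let δ : Derivation k B R := D.compAlgebraMap B
  have h1 : ∀ b, D (f b) = δ.liftKaehlerDifferential (KaehlerDifferential.D k B b) := fun b => by
    rw [Derivation.liftKaehlerDifferential_comp_D]
    rfl
  rw [h1, ← hv.exists_basis.choose.sum_repr (KaehlerDifferential.D k B b), map_sum]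
  refine Finset.sum_congr rfl fun i _ => ?_
  rw [map_smul, hv.exists_basis.choose_spec i, ← h1, Algebra.smul_def]
  rfl

lemma IsEtaleCoords.derivation_apply [Fintype σ] (hv : IsEtaleCoords k v) (D : Derivation k B B)
    (b : B) : D b = ∑ i, hv.pd i b * D (v i) :=
  hv.chain_rule (AlgHom.id k B) D b

lemma IsEtaleCoords.derivation_ext [Fintype σ] (hv : IsEtaleCoords k v) {D D' : Derivation k B B}
    (h : ∀ i, D (v i) = D' (v i)) : D = D' := by
  refine Derivation.ext fun b => ?_
  rw [hv.derivation_apply, hv.derivation_apply]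
  simp only [h]

/-- The commutator is a derivation that kills all coordinates. -/
lemma IsEtaleCoords.pd_comm [Fintype σ] (hv : IsEtaleCoords k v) (i j : σ) (b : B) :
    hv.pd i (hv.pd j b) = hv.pd j (hv.pd i b) := by
  classical
  have : ⁅hv.pd i, hv.pd j⁆ = 0 := by
    refine hv.derivation_ext fun l => ?_
    rw [Derivation.commutator_apply, hv.pd_coord, hv.pd_coord]
    split_ifs <;> simp
  have := congrArg (fun D => D b) this
  rw [Derivation.commutator_apply] at this
  exact sub_eq_zero.mp this

lemma IsEtaleCoords.reindex {τ : Type} (hv : IsEtaleCoords k v) (e : τ ≃ σ) :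
    IsEtaleCoords k (v ∘ e) := by
  refine ⟨fun i => hv.mem _, hv.residue, ?_⟩
  have h1 : (MvPolynomial.aeval (v ∘ e) : MvPolynomial τ k →ₐ[k] B).toRingHom =
      (MvPolynomial.aeval v : MvPolynomial σ k →ₐ[k] B).toRingHom.comp
        (MvPolynomial.renameEquiv k e).toRingEquiv.toRingHom := by
    refine RingHom.ext fun p => ?_
    exact (MvPolynomial.aeval_rename (e : τ → σ) v p).symm
  rw [h1]
  refine RingHom.FormallyEtale.comp ?_ hv.formallyEtale
  exact (RingHom.Etale.of_bijective (MvPolynomial.renameEquiv k e).bijective).formallyEtale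

end EtaleCoords

/-! ### Power series in characteristic two -/

section CharTwo

variable {k : Type u} [Field k]

lemma MvPowerSeries.constantCoeff_pderiv {σ : Type*} (i : σ) (f : MvPowerSeries σ k) :
    MvPowerSeries.constantCoeff (MvPowerSeries.pderiv k i f) =
      MvPowerSeries.coeff (Finsupp.single i 1) f := by
  rw [← MvPowerSeries.coeff_zero_eq_constantCoeff_apply, MvPowerSeries.coeff_pderiv]
  simp

lemma MvPowerSeries.pderiv_comm {σ : Type*} (i j : σ) (f : MvPowerSeries σ k) :
    MvPowerSeries.pderiv k i (MvPowerSeries.pderiv k j f) =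
      MvPowerSeries.pderiv k j (MvPowerSeries.pderiv k i f) := by
  classical
  ext n
  simp only [MvPowerSeries.coeff_pderiv, Finsupp.add_apply, Finsupp.single_apply]
  rw [add_right_comm]
  by_cases h : i = j
  · subst h; ring
  · rw [if_neg h, if_neg (Ne.symm h)]
    push_cast
    ring

/-- The coefficients acquire a product of two consecutive integers as a factor. This is why the
Hessian is alternating. -/
lemma MvPowerSeries.pderiv_pderiv_self [CharP k 2] {σ : Type*} (i : σ) (f : MvPowerSeries σ k) :
    MvPowerSeries.pderiv k i (MvPowerSeries.pderiv k i f) = 0 := by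
  ext n
  simp only [MvPowerSeries.coeff_pderiv, Finsupp.add_apply, Finsupp.single_eq_same, map_zero]
  have h : (((n i + 1) * (n i + 2) : ℕ) : k) = 0 := by
    rw [CharP.cast_eq_zero_iff k 2]
    rcases Nat.even_or_odd (n i) with h | h
    · exact Dvd.dvd.mul_left (by obtain ⟨a, ha⟩ := h; omega) _
    · exact Dvd.dvd.mul_right (by obtain ⟨a, ha⟩ := h; omega) _
  push_cast at h ⊢
  linear_combination MvPowerSeries.coeff (n + Finsupp.single i 1 + Finsupp.single i 1) f * h

lemma MvPowerSeries.hasSubst_of_mem {σ τ : Type*} [Finite σ] {a : σ → MvPowerSeries τ k}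
    (ha : ∀ i, a i ∈ maximalIdeal (MvPowerSeries τ k)) : MvPowerSeries.HasSubst a :=
  MvPowerSeries.hasSubst_of_constantCoeff_zero fun i => MvPowerSeries.mem_maximalIdeal_iff.mp (ha i)

/-- A homomorphism of power series rings over `k` is local. -/
lemma MvPowerSeries.algHom_mem_maximalIdeal {σ τ : Type*}
    (f : MvPowerSeries σ k →ₐ[k] MvPowerSeries τ k) {a : MvPowerSeries σ k}
    (ha : a ∈ maximalIdeal _) : f a ∈ maximalIdeal _ := by
  by_contra h
  have h1 : MvPowerSeries.constantCoeff (f a) ≠ 0 := fun h' =>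
    h (MvPowerSeries.mem_maximalIdeal_iff.mpr h')
  -- Subtracting the nonzero value of f a from a gives a unit, yet its image has constant
  -- coefficient zero.
  have h2 : IsUnit (a - algebraMap k _ (MvPowerSeries.constantCoeff (f a))) := by
    rw [MvPowerSeries.isUnit_iff_constantCoeff, map_sub, MvPowerSeries.mem_maximalIdeal_iff.mp ha,
      MvPowerSeries.algebraMap_apply, MvPowerSeries.constantCoeff_C, zero_sub]
    exact (IsUnit.mk0 _ h1).neg
  have h3 := h2.map f
  rw [map_sub, AlgHom.commutes, MvPowerSeries.isUnit_iff_constantCoeff, map_sub,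
    MvPowerSeries.algebraMap_apply, MvPowerSeries.constantCoeff_C] at h3
  simp at h3

lemma MvPowerSeries.algHom_mem_pow {σ τ : Type*}
    (f : MvPowerSeries σ k →ₐ[k] MvPowerSeries τ k) {n : ℕ} {a : MvPowerSeries σ k}
    (ha : a ∈ maximalIdeal (MvPowerSeries σ k) ^ n) :
    f a ∈ maximalIdeal (MvPowerSeries τ k) ^ n := by
  have hle : (maximalIdeal (MvPowerSeries σ k)).map f ≤ maximalIdeal (MvPowerSeries τ k) :=
    Ideal.map_le_iff_le_comap.mpr fun a ha => MvPowerSeries.algHom_mem_maximalIdeal f ha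
  refine Ideal.pow_right_mono hle n ?_
  rw [← Ideal.map_pow]
  exact Ideal.mem_map_of_mem _ ha

variable {ι κ : Type} [Fintype ι] [Fintype κ]

/-- The exponent with the first part doubled. -/
def doubleLeft (d : ι ⊕ κ →₀ ℕ) : ι ⊕ κ →₀ ℕ :=
  Finsupp.equivFunOnFinite.symm (Sum.elim (fun i => 2 * d (Sum.inl i)) fun j => d (Sum.inr j))

lemma doubleLeft_injective : Function.Injective (doubleLeft : (ι ⊕ κ →₀ ℕ) → _) := by
  intro d d' h
  ext (i | j)
  · have := DFunLike.congr_fun h (Sum.inl i)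
    simpa [doubleLeft] using this
  · have := DFunLike.congr_fun h (Sum.inr j)
    simpa [doubleLeft] using this

variable (k) in
/-- The images of the variables under the Frobenius in the first group of variables. -/
def squareLeftVars (ι κ : Type) : ι ⊕ κ → MvPowerSeries (ι ⊕ κ) k :=
  Sum.elim (fun i => MvPowerSeries.X (Sum.inl i) ^ 2) fun j => MvPowerSeries.X (Sum.inr j)

lemma hasSubst_squareLeftVars : MvPowerSeries.HasSubst (squareLeftVars k ι κ) := by
  refine MvPowerSeries.hasSubst_of_constantCoeff_zero ?_
  rintro (i | j) <;> simp [squareLeftVars]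

variable (k) in
/-- The substitution squaring the first group of variables. -/
def squareLeft (ι κ : Type) [Fintype ι] [Fintype κ] :
    MvPowerSeries (ι ⊕ κ) k →ₐ[k] MvPowerSeries (ι ⊕ κ) k :=
  MvPowerSeries.substAlgHom (hasSubst_squareLeftVars (k := k))

lemma squareLeft_X (s : ι ⊕ κ) :
    squareLeft k ι κ (MvPowerSeries.X s) = squareLeftVars k ι κ s :=
  MvPowerSeries.substAlgHom_X _ s

lemma prod_squareLeftVars (d : ι ⊕ κ →₀ ℕ) :
    (d.prod fun s e => squareLeftVars k ι κ s ^ e) = MvPowerSeries.monomial (doubleLeft d) 1 := by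
  rw [MvPowerSeries.monomial_one_eq, Finsupp.prod_fintype _ _ (by simp),
    Finsupp.prod_fintype _ _ (by simp), Fintype.prod_sum_type, Fintype.prod_sum_type]
  congr 1
  refine Finset.prod_congr rfl fun i _ => ?_
  simp [squareLeftVars, doubleLeft, pow_mul]

open Classical in
lemma coeff_squareLeft (f : MvPowerSeries (ι ⊕ κ) k)
    (e : ι ⊕ κ →₀ ℕ) :
    MvPowerSeries.coeff e (squareLeft k ι κ f) =
      ∑ᶠ d, MvPowerSeries.coeff d f * if e = doubleLeft d then 1 else 0 := by
  rw [squareLeft, MvPowerSeries.substAlgHom_apply, MvPowerSeries.coeff_subst hasSubst_squareLeftVars]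
  refine finsum_congr fun d => ?_
  rw [prod_squareLeftVars, MvPowerSeries.coeff_monomial, smul_eq_mul]

lemma coeff_doubleLeft_squareLeft (f : MvPowerSeries (ι ⊕ κ) k) (d : ι ⊕ κ →₀ ℕ) :
    MvPowerSeries.coeff (doubleLeft d) (squareLeft k ι κ f) = MvPowerSeries.coeff d f := by
  classical
  rw [coeff_squareLeft, finsum_eq_single _ d]
  · simp
  · intro d' hd'
    rw [if_neg fun h => hd' (doubleLeft_injective h).symm, mul_zero]

/-- In characteristic two, a power series with vanishing derivatives is a power series in the
squares of the variables. -/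
lemma exists_squareLeft_eq [CharP k 2] {f : MvPowerSeries (ι ⊕ κ) k}
    (hf : ∀ i : ι, MvPowerSeries.pderiv k (Sum.inl i) f = 0) : ∃ g, squareLeft k ι κ g = f := by
  classical
  -- At an exponent that is odd in some variable of the first group, the derivative in that variable
  -- multiplies the coefficient by an odd number, so the coefficient of f is zero. Only the doubled
  -- exponents remain.
  let g : MvPowerSeries (ι ⊕ κ) k := fun d => MvPowerSeries.coeff (doubleLeft d) f
  refine ⟨g, ?_⟩
  ext e
  by_cases he : e ∈ Set.range (doubleLeft : (ι ⊕ κ →₀ ℕ) → _)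
  · obtain ⟨d, rfl⟩ := he
    rw [coeff_doubleLeft_squareLeft]
    rfl
  · rw [coeff_squareLeft, finsum_eq_zero_of_forall_eq_zero fun d => by
      rw [if_neg fun h => he ⟨d, h.symm⟩, mul_zero]]
    obtain ⟨i, hi⟩ : ∃ i : ι, ¬ Even (e (Sum.inl i)) := by
      by_contra! h
      refine he ⟨Finsupp.equivFunOnFinite.symm
        (Sum.elim (fun i => e (Sum.inl i) / 2) fun j => e (Sum.inr j)), ?_⟩
      ext (i | j)
      · simpa [doubleLeft] using Nat.mul_div_cancel' (h i).two_dvd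
      · simp [doubleLeft]
    rw [Nat.not_even_iff_odd] at hi
    have h1 : Finsupp.single (Sum.inl i) 1 ≤ e := by
      rw [Finsupp.single_le_iff]
      exact hi.pos
    have h2 := congrArg (MvPowerSeries.coeff (e - Finsupp.single (Sum.inl i) 1)) (hf i)
    rw [MvPowerSeries.coeff_pderiv, tsub_add_cancel_of_le h1, map_zero] at h2
    have h3 : (((e - Finsupp.single (Sum.inl i) 1 : ι ⊕ κ →₀ ℕ) (Sum.inl i) : ℕ) : k) + 1 = 1 := by
      have : (((e - Finsupp.single (Sum.inl i) 1 : ι ⊕ κ →₀ ℕ) (Sum.inl i) : ℕ) : k) = 0 := by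
        rw [CharP.cast_eq_zero_iff k 2, Finsupp.tsub_apply, Finsupp.single_eq_same]
        obtain ⟨a, ha⟩ := hi
        omega
      rw [this, zero_add]
    rw [h3, mul_one] at h2
    exact h2.symm

/-- The substitution does not touch the second group, so the y-linear part of a preimage can be read
off from its image. -/
lemma coeff_single_inr_squareLeft (f : MvPowerSeries (ι ⊕ κ) k) (j : κ) :
    MvPowerSeries.coeff (Finsupp.single (Sum.inr j) 1) (squareLeft k ι κ f) =
      MvPowerSeries.coeff (Finsupp.single (Sum.inr j) 1) f := by
  classical
  rw [← coeff_doubleLeft_squareLeft f]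
  congr 2
  ext (i | j') <;> simp [doubleLeft, Finsupp.single_apply]

lemma constantCoeff_squareLeft (f : MvPowerSeries (ι ⊕ κ) k) :
    MvPowerSeries.constantCoeff (squareLeft k ι κ f) = MvPowerSeries.constantCoeff f := by
  rw [← MvPowerSeries.coeff_zero_eq_constantCoeff_apply,
    ← MvPowerSeries.coeff_zero_eq_constantCoeff_apply, ← coeff_doubleLeft_squareLeft f]
  congr 2
  ext (i | j) <;> simp [doubleLeft]

end CharTwo

/-! ### The normal form of a function with a simply degenerate Hessian -/

section NormalForm

variable {k : Type u} [Field k]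

/-- Reorders a coordinate system. The equivalence `e` supplies the count, so g need not be shown
bijective. -/
lemma IsFormalCoords.of_comp {A : Type*} [CommRing A] [IsLocalRing A] [Algebra k A] {σ τ ρ : Type*}
    [Finite σ] {v : σ → A} (hv : IsFormalCoords k v) (e : τ ≃ σ) {w : τ → A}
    (hw : ∀ i, w i ∈ maximalIdeal A) {u : ρ → A} (hu : IsFormalCoords k u) (g : ρ → τ)
    (h : ∀ i, u i = w (g i)) : IsFormalCoords k w := by
  refine hv.of_span e hw fun a _ => ?_
  obtain ⟨p, hp⟩ := hu.surj 2 a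
  refine ⟨MvPolynomial.rename g p, ?_⟩
  rwa [MvPolynomial.aeval_rename, ← show u = w ∘ g from funext h]

variable {ι κ : Type}

lemma MvPowerSeries.mem_sq_of_coeff {σ : Type*} [Finite σ] {f : MvPowerSeries σ k}
    (h0 : f ∈ maximalIdeal (MvPowerSeries σ k))
    (h1 : ∀ i, MvPowerSeries.coeff (Finsupp.single i 1) f = 0) :
    f ∈ maximalIdeal (MvPowerSeries σ k) ^ 2 := by
  rw [MvPowerSeries.mem_pow_maximalIdeal_iff]
  intro d hd
  have hd' : d.degree = 0 ∨ d.degree = 1 := by omega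
  rcases hd' with hd' | hd'
  · obtain rfl : d = 0 := by simpa [Finsupp.degree_eq_zero_iff] using hd'
    exact MvPowerSeries.mem_maximalIdeal_iff.mp h0
  · obtain ⟨i, rfl⟩ : d ∈ Set.range (fun i : σ => Finsupp.single i 1) := by
      rw [Finsupp.range_single_one]
      exact hd'
    exact h1 i

lemma MvPowerSeries.coeff_single_of_mem_sq {σ : Type*} [Finite σ] {f : MvPowerSeries σ k}
    (h : f ∈ maximalIdeal (MvPowerSeries σ k) ^ 2) (i : σ) :
    MvPowerSeries.coeff (Finsupp.single i 1) f = 0 :=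
  MvPowerSeries.mem_pow_maximalIdeal_iff.mp h _ (by simp)

/-- The coefficients of the linear terms in the second group of variables. -/
def linRight : MvPowerSeries (ι ⊕ κ) k →ₗ[k] (κ → k) :=
  LinearMap.pi fun j => MvPowerSeries.coeff (Finsupp.single (Sum.inr j) 1)

lemma linRight_apply (f : MvPowerSeries (ι ⊕ κ) k) (j : κ) :
    linRight f j = MvPowerSeries.coeff (Finsupp.single (Sum.inr j) 1) f := rfl

lemma linRight_of_mem_sq [Finite ι] [Finite κ] {f : MvPowerSeries (ι ⊕ κ) k}
    (h : f ∈ maximalIdeal _ ^ 2) :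
    linRight f = 0 :=
  funext fun _ => MvPowerSeries.coeff_single_of_mem_sq h _

/-- The matrix of linear parts is block triangular, so next to the x only the y-linear parts of the
f matter. -/
lemma isFormalCoords_sumElim_X [Fintype ι] [Fintype κ] {τ : Type*} [Fintype τ] (e : τ ≃ κ)
    {f : τ → MvPowerSeries (ι ⊕ κ) k} (hf : ∀ t, f t ∈ maximalIdeal _)
    (hli : LinearIndependent k (linRight ∘ f)) :
    IsFormalCoords k (Sum.elim (fun i => MvPowerSeries.X (Sum.inl i)) f) := by
  classical
  have hw : ∀ i : ι ⊕ τ, Sum.elim (fun i => MvPowerSeries.X (Sum.inl i)) f i ∈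
      maximalIdeal (MvPowerSeries (ι ⊕ κ) k) := by
    rintro (i | t)
    · exact MvPowerSeries.X_mem_maximalIdeal _
    · exact hf t
  refine MvPowerSeries.isFormalCoords_X.of_linearIndependent (Equiv.sumCongr (Equiv.refl ι) e) hw
    (MvPowerSeries.isFormalCoords_X.linearIndependent_lin hw fun c hc => ?_)
  have h1 := fun i => MvPowerSeries.coeff_single_of_mem_sq hc i
  simp only [Fintype.sum_sum_type, Sum.elim_inl, Sum.elim_inr, map_add, map_sum, map_smul,
    MvPowerSeries.coeff_index_single_X, smul_eq_mul] at h1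
  have h2 : ∀ t, c (Sum.inr t) = 0 := by
    rw [Fintype.linearIndependent_iff] at hli
    refine hli (fun t => c (Sum.inr t)) ?_
    funext j
    have := h1 (Sum.inr j)
    simpa [linRight_apply] using this
  funext i
  rcases i with i | t
  · have := h1 (Sum.inl i)
    simpa [h2] using this
  · exact h2 t

variable [CharP k 2]

lemma MvPowerSeries.two_eq_zero {σ : Type*} : (2 : MvPowerSeries σ k) = 0 := by
  have : (MvPowerSeries.C (2 : k) : MvPowerSeries σ k) = 0 := by
    rw [CharTwo.two_eq_zero, map_zero]
  rw [← this, map_ofNat]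

/-- Here g is the restriction to the critical scheme, where F, F₀ and F₁ vanish. The source of
`squareLeft` plays the role of k[[x₀², x₁², y]]. The coefficients a, b, c, d of F with respect to 1,
x₀, x₁, x₀x₁ serve as coordinates on it, and g evaluates them to x₀x₁z, x₁z, x₀z, z. -/
theorem exists_normalForm {m n : ℕ} (hn : n + 1 = m) {F F₀ F₁ h : MvPowerSeries (Fin 2 ⊕ Fin m) k}
    (hF₀ : MvPowerSeries.pderiv k (Sum.inl 0) F = F₀)
    (hF₁ : MvPowerSeries.pderiv k (Sum.inl 1) F = F₁)
    (hh : MvPowerSeries.pderiv k (Sum.inl 0) F₁ = h)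
    (mF : F ∈ maximalIdeal _) (mF₀ : F₀ ∈ maximalIdeal _) (mF₁ : F₁ ∈ maximalIdeal _)
    (mh : h ∈ maximalIdeal _)
    (hind : ∀ a b c : k, a • F + b • F₀ + c • F₁ ∈ maximalIdeal _ ^ 2 → a = 0 ∧ b = 0 ∧ c = 0)
    (g : MvPowerSeries (Fin 2 ⊕ Fin m) k →ₐ[k] MvPowerSeries (Fin n) k)
    (hg : ∀ b ∈ maximalIdeal (MvPowerSeries (Fin n) k), ∃ a, b - g a ∈ maximalIdeal _ ^ 2)
    (gF : g F = 0) (gF₀ : g F₀ = 0) (gF₁ : g F₁ = 0) (gh : g h ∉ maximalIdeal _ ^ 2) :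
    4 ≤ m ∧ ∃ (ρ : MvPowerSeries (Fin 2 ⊕ Fin m) k →ₐ[k] TargetRing k (m - 4))
      (θ : MvPowerSeries (Fin n) k →ₐ[k] SourceRing k (m - 4)), IsCompletionMap k θ ∧
        (gammaStar k (m - 4)).comp ρ = (θ.comp g).comp (squareLeft k (Fin 2) (Fin m)) := by
  classical
  let x : Fin 2 → MvPowerSeries (Fin 2 ⊕ Fin m) k := fun i => MvPowerSeries.X (Sum.inl i)
  have mx : ∀ i, x i ∈ maximalIdeal _ := fun i => MvPowerSeries.X_mem_maximalIdeal _
  have d00 : MvPowerSeries.pderiv k (Sum.inl 0) F₀ = 0 := by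
    rw [← hF₀, MvPowerSeries.pderiv_pderiv_self]
  have d11 : MvPowerSeries.pderiv k (Sum.inl 1) F₁ = 0 := by
    rw [← hF₁, MvPowerSeries.pderiv_pderiv_self]
  have d10 : MvPowerSeries.pderiv k (Sum.inl 1) F₀ = h := by
    rw [← hF₀, MvPowerSeries.pderiv_comm, hF₁, hh]
  have d0h : MvPowerSeries.pderiv k (Sum.inl 0) h = 0 := by
    rw [← hh, MvPowerSeries.pderiv_pderiv_self]
  have d1h : MvPowerSeries.pderiv k (Sum.inl 1) h = 0 := by
    rw [← d10, MvPowerSeries.pderiv_pderiv_self]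
  have dx : ∀ i j, MvPowerSeries.pderiv k (Sum.inl i) (x j) = if i = j then 1 else 0 := by
    intro i j
    rw [MvPowerSeries.pderiv_X]
    simp [Pi.single_apply, eq_comm]
  have dx00 := dx 0 0
  have dx01 := dx 0 1
  have dx10 := dx 1 0
  have dx11 := dx 1 1
  simp only [↓reduceIte, Fin.isValue, zero_ne_one, one_ne_zero] at dx00 dx01 dx10 dx11
  have c0 : ∀ {f : MvPowerSeries (Fin 2 ⊕ Fin m) k}, f ∈ maximalIdeal _ →
      MvPowerSeries.constantCoeff f = 0 := fun hf => MvPowerSeries.mem_maximalIdeal_iff.mp hf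
  let U : Fin 4 → MvPowerSeries (Fin 2 ⊕ Fin m) k := ![F, F₀, F₁, h]
  have mU : ∀ i, U i ∈ maximalIdeal _ := by
    intro i
    fin_cases i
    exacts [mF, mF₀, mF₁, mh]
  -- The x-derivatives of F, F₀, F₁ and h lie in 𝔪, so a relation among y-linear parts is a relation
  -- modulo 𝔪². Applying g, which kills F, F₀ and F₁, shows that the coefficient of h is zero, and
  -- `hind` treats the others.
  have hU : LinearIndependent k (linRight ∘ U) := by
    rw [Fintype.linearIndependent_iff]
    intro c hc
    have hf : c 0 • F + c 1 • F₀ + c 2 • F₁ + c 3 • h ∈ maximalIdeal _ ^ 2 := by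
      refine MvPowerSeries.mem_sq_of_coeff ?_ ?_
      · rw [MvPowerSeries.mem_maximalIdeal_iff]
        simp [MvPowerSeries.smul_eq_C_mul, c0 mF, c0 mF₀, c0 mF₁, c0 mh]
      · rintro (i | j)
        · simp only [← MvPowerSeries.constantCoeff_pderiv, map_add, map_smul]
          fin_cases i
          · simp [hF₀, d00, hh, d0h, c0 mF₀, c0 mh]
          · simp [hF₁, d10, d11, d1h, c0 mF₁, c0 mh]
        · have := congrFun hc j
          simpa [Fin.sum_univ_four, U, linRight_apply] using this
    have h3 : c 3 = 0 := by
      by_contra hne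
      have := MvPowerSeries.algHom_mem_pow g hf
      simp only [map_add, map_smul, gF, gF₀, gF₁, smul_zero, zero_add] at this
      refine gh ?_
      have := Submodule.smul_of_tower_mem _ (c 3)⁻¹ this
      rwa [smul_smul, inv_mul_cancel₀ hne, one_smul] at this
    rw [h3, zero_smul, add_zero] at hf
    obtain ⟨e0, e1, e2⟩ := hind _ _ _ hf
    intro i
    fin_cases i
    exacts [e0, e1, e2, h3]
  -- Four independent linear forms in m variables give 4 ≤ m, and m - 4 of the y complete them to a
  -- basis.
  obtain ⟨r, y, hr, hy⟩ := exists_linearIndependent_sumElim_single hU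
  simp only [Fintype.card_fin] at hr
  obtain rfl : r = m - 4 := by omega
  refine ⟨by omega, ?_⟩
  have mX : ∀ s, (MvPowerSeries.X s : MvPowerSeries (Fin 2 ⊕ Fin m) k) ∈ maximalIdeal _ :=
    fun s => MvPowerSeries.X_mem_maximalIdeal _
  have linX : ∀ j : Fin m, linRight (MvPowerSeries.X (Sum.inr j) :
      MvPowerSeries (Fin 2 ⊕ Fin m) k) = Pi.single j 1 := by
    intro j
    funext j'
    rw [linRight_apply, MvPowerSeries.coeff_index_single_X, Pi.single_apply]
    simp
  have eqv : Fin 4 ⊕ Fin (m - 4) ≃ Fin m := Fintype.equivOfCardEq (by simp; omega)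
  have hV : IsFormalCoords k (Sum.elim (fun i => MvPowerSeries.X (Sum.inl i))
      (Sum.elim U fun t => MvPowerSeries.X (Sum.inr (y t)))) := by
    refine isFormalCoords_sumElim_X eqv ?_ ?_
    · rintro (i | t)
      exacts [mU i, mX _]
    · convert hy using 1
      funext i
      rcases i with i | t
      exacts [rfl, linX _]
  have t0 : (2 : MvPowerSeries (Fin 2 ⊕ Fin m) k) = 0 := MvPowerSeries.two_eq_zero
  -- The coefficients a, b, c, d written through the derivatives of F, with all signs immaterial.
  -- Each is killed by both x-derivatives, hence is a series in the squares of the x.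
  obtain ⟨a0, ha0⟩ : ∃ a, squareLeft k (Fin 2) (Fin m) a =
      F + x 0 * F₀ + x 1 * F₁ + x 0 * x 1 * h := by
    refine exists_squareLeft_eq fun i => ?_
    fin_cases i
    · simp only [Fin.zero_eta, Fin.isValue, map_add, Derivation.leibniz, smul_eq_mul, dx00, dx01,
        hF₀, d00, hh, d0h]
      linear_combination (F₀ + x 1 * h) * t0
    · simp only [Fin.mk_one, Fin.isValue, map_add, Derivation.leibniz, smul_eq_mul, dx10, dx11,
        hF₁, d10, d11, d1h]
      linear_combination (F₁ + x 0 * h) * t0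
  obtain ⟨b0, hb0⟩ : ∃ a, squareLeft k (Fin 2) (Fin m) a = F₀ + x 1 * h := by
    refine exists_squareLeft_eq fun i => ?_
    fin_cases i
    · simp only [Fin.zero_eta, Fin.isValue, map_add, Derivation.leibniz, smul_eq_mul, dx01,
        d00, d0h]
      ring
    · simp only [Fin.mk_one, Fin.isValue, map_add, Derivation.leibniz, smul_eq_mul, dx11,
        d10, d1h]
      linear_combination h * t0
  obtain ⟨c0', hc0⟩ : ∃ a, squareLeft k (Fin 2) (Fin m) a = F₁ + x 0 * h := by
    refine exists_squareLeft_eq fun i => ?_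
    fin_cases i
    · simp only [Fin.zero_eta, Fin.isValue, map_add, Derivation.leibniz, smul_eq_mul, dx00,
        hh, d0h]
      linear_combination h * t0
    · simp only [Fin.mk_one, Fin.isValue, map_add, Derivation.leibniz, smul_eq_mul, dx10,
        d11, d1h]
      ring
  obtain ⟨d0, hd0⟩ : ∃ a, squareLeft k (Fin 2) (Fin m) a = h := by
    refine exists_squareLeft_eq fun i => ?_
    fin_cases i
    exacts [d0h, d1h]
  let U' : Fin 4 → MvPowerSeries (Fin 2 ⊕ Fin m) k := ![a0, b0, c0', d0]
  -- The corrections are products of some x with elements of 𝔪, so they do not change linear parts.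
  have hUU' : ∀ i, squareLeft k (Fin 2) (Fin m) (U' i) - U i ∈ maximalIdeal _ ^ 2 := by
    have aux : ∀ i {f : MvPowerSeries (Fin 2 ⊕ Fin m) k}, f ∈ maximalIdeal _ →
        x i * f ∈ maximalIdeal _ ^ 2 := fun i f hf => by
      rw [sq]; exact Ideal.mul_mem_mul (mx i) hf
    intro i
    fin_cases i
    · change squareLeft k (Fin 2) (Fin m) a0 - F ∈ _
      rw [ha0, show F + x 0 * F₀ + x 1 * F₁ + x 0 * x 1 * h - F =
        x 0 * F₀ + x 1 * F₁ + x 0 * (x 1 * h) by ring]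
      exact add_mem (add_mem (aux _ mF₀) (aux _ mF₁)) (aux _ (Ideal.mul_mem_left _ _ mh))
    · change squareLeft k (Fin 2) (Fin m) b0 - F₀ ∈ _
      rw [hb0, add_sub_cancel_left]
      exact aux _ mh
    · change squareLeft k (Fin 2) (Fin m) c0' - F₁ ∈ _
      rw [hc0, add_sub_cancel_left]
      exact aux _ mh
    · change squareLeft k (Fin 2) (Fin m) d0 - h ∈ _
      rw [hd0, sub_self]
      exact zero_mem _
  have linU' : ∀ i, linRight (U' i) = linRight (U i) := by
    intro i
    have h1 := linRight_of_mem_sq (hUU' i)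
    rw [map_sub, sub_eq_zero] at h1
    rw [← h1]
    funext j
    rw [linRight_apply, linRight_apply, coeff_single_inr_squareLeft]
  have mU' : ∀ i, U' i ∈ maximalIdeal _ := by
    intro i
    rw [MvPowerSeries.mem_maximalIdeal_iff, ← constantCoeff_squareLeft,
      ← MvPowerSeries.mem_maximalIdeal_iff]
    have := add_mem (Ideal.pow_le_self two_ne_zero (hUU' i)) (mU i)
    rwa [sub_add_cancel] at this
  have hV' : IsFormalCoords k (Sum.elim (fun i => MvPowerSeries.X (Sum.inl i))
      (Sum.elim U' fun t => MvPowerSeries.X (Sum.inr (y t)))) := by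
    refine isFormalCoords_sumElim_X eqv ?_ ?_
    · rintro (i | t)
      exacts [mU' i, mX _]
    · convert hy using 1
      funext i
      rcases i with i | t
      exacts [linU' i, linX _]
  -- In the order of `gammaVars`: on the critical scheme `c0'` becomes `x 0` times z, `b0` becomes
  -- `x 1` times z, and `a0` the product of all three.
  let wQ : Fin (m - 4) ⊕ Fin 6 → MvPowerSeries (Fin 2 ⊕ Fin m) k :=
    Sum.elim (fun t => MvPowerSeries.X (Sum.inr (y t))) ![x 0, c0', x 1, b0, a0, d0]
  have hQ : IsFormalCoords k wQ := by
    refine hV'.of_comp (Fintype.equivOfCardEq (by simp; omega)) ?_ hV'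
      (Sum.elim ![Sum.inr 0, Sum.inr 2] (Sum.elim ![Sum.inr 4, Sum.inr 3, Sum.inr 1, Sum.inr 5]
        Sum.inl)) ?_
    · rintro (t | i)
      · exact mX _
      · fin_cases i
        exacts [mx 0, mU' 2, mx 1, mU' 1, mU' 0, mU' 3]
    · rintro (i | i | t)
      · fin_cases i <;> rfl
      · fin_cases i <;> rfl
      · rfl
  let wK : Fin (m - 4) ⊕ Fin 3 → MvPowerSeries (Fin n) k :=
    Sum.elim (fun t => g (MvPowerSeries.X (Sum.inr (y t)))) ![g (x 0), g (x 1), g h]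
  have hK : IsFormalCoords k wK := by
    refine MvPowerSeries.isFormalCoords_X.of_span (Fintype.equivOfCardEq (by simp; omega)) ?_ ?_
    · rintro (t | i)
      · exact MvPowerSeries.algHom_mem_maximalIdeal g (mX _)
      · fin_cases i
        exacts [MvPowerSeries.algHom_mem_maximalIdeal g (mx 0),
          MvPowerSeries.algHom_mem_maximalIdeal g (mx 1),
          MvPowerSeries.algHom_mem_maximalIdeal g mh]
    -- Of the coordinates `hV`, g kills F, F₀ and F₁. The images of the others span the cotangent
    -- space.
    · intro b hb
      obtain ⟨a, ha⟩ := hg b hb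
      obtain ⟨p, hp⟩ := hV.surj 2 a
      have h1 := add_mem ha (MvPowerSeries.algHom_mem_pow g hp)
      let q : Fin 2 ⊕ (Fin 4 ⊕ Fin (m - 4)) → MvPolynomial (Fin (m - 4) ⊕ Fin 3) k :=
        Sum.elim ![MvPolynomial.X (Sum.inr 0), MvPolynomial.X (Sum.inr 1)]
          (Sum.elim ![0, 0, 0, MvPolynomial.X (Sum.inr 2)] fun t => MvPolynomial.X (Sum.inl t))
      refine ⟨MvPolynomial.aeval q p, ?_⟩
      rw [map_sub, sub_add_sub_cancel, MvPolynomial.comp_aeval_apply] at h1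
      rw [MvPolynomial.comp_aeval_apply]
      convert h1 using 5 with i
      rcases i with i | i | t
      · fin_cases i <;> simp [q, wK, x]
      · fin_cases i <;> simp [q, wK, U, gF, gF₀, gF₁]
      · simp [q, wK]
  refine ⟨hQ.toPowerSeries, hK.toPowerSeries, hK.isCompletionMap, ?_⟩
  refine hQ.algHom_ext (fun a ha => MvPowerSeries.algHom_mem_maximalIdeal _ ha)
    (fun a ha => MvPowerSeries.algHom_mem_maximalIdeal _ ha) fun s => ?_
  have sX : ∀ i, squareLeft k (Fin 2) (Fin m) (x i) = x i ^ 2 := fun i => squareLeft_X _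
  have sY : ∀ j, squareLeft k (Fin 2) (Fin m) (MvPowerSeries.X (Sum.inr j)) =
      MvPowerSeries.X (Sum.inr j) := fun i => squareLeft_X _
  have k0 : hK.toPowerSeries (g (x 0)) = MvPowerSeries.X (Sum.inr 0) :=
    hK.toPowerSeries_coord (Sum.inr 0)
  have k1 : hK.toPowerSeries (g (x 1)) = MvPowerSeries.X (Sum.inr 1) :=
    hK.toPowerSeries_coord (Sum.inr 1)
  have k2 : hK.toPowerSeries (g h) = MvPowerSeries.X (Sum.inr 2) :=
    hK.toPowerSeries_coord (Sum.inr 2)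
  have kt : ∀ t, hK.toPowerSeries (g (MvPowerSeries.X (Sum.inr (y t)))) =
      MvPowerSeries.X (Sum.inl t) := fun t => hK.toPowerSeries_coord (Sum.inl t)
  rw [AlgHom.comp_apply, hQ.toPowerSeries_coord, gammaStar, MvPowerSeries.substAlgHom_X]
  rw [AlgHom.comp_apply, AlgHom.comp_apply]
  rcases s with t | i
  · simp [wQ, gammaVars, sY, kt]
  · fin_cases i <;>
      simp [wQ, gammaVars, sX, ha0, hb0, hc0, hd0, gF, gF₀, gF₁, k0, k1, k2]

end NormalForm

/-! ### The critical scheme in étale coordinates -/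

section Critical

variable {k A B : Type u} [Field k] [CommRing A] [IsLocalRing A] [Algebra k A]
  [CommRing B] [IsLocalRing B] [Algebra k B] [Algebra A B] [IsScalarTower k A B]
  {ι : Type} {m : ℕ} {x : ι → B} {y : Fin m → A}

lemma IsEtaleCoords.pd_inl_algebraMap (hA : IsEtaleCoords k y)
    (hB : IsEtaleCoords k (Sum.elim x (algebraMap A B ∘ y))) (i : ι) (a : A) :
    hB.pd (Sum.inl i) (algebraMap A B a) = 0 := by
  classical
  have := hA.chain_rule (IsScalarTower.toAlgHom k A B) (hB.pd (Sum.inl i)) a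
  refine this.trans (Finset.sum_eq_zero fun j _ => ?_)
  have h := hB.pd_coord (Sum.inl i) (Sum.inr j)
  simp only [Sum.elim_inr, Function.comp_apply, reduceCtorEq, ↓reduceIte] at h
  exact mul_eq_zero_of_right _ h

/-- The partial derivatives relative to `A`. -/
def relPd (hA : IsEtaleCoords k y) (hB : IsEtaleCoords k (Sum.elim x (algebraMap A B ∘ y)))
    (i : ι) : Derivation A B B :=
  Derivation.mk'
    { toFun := hB.pd (Sum.inl i)
      map_add' := map_add _
      map_smul' := fun a b => by
        rw [Algebra.smul_def, Derivation.leibniz, hA.pd_inl_algebraMap hB, smul_zero, add_zero,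
          smul_eq_mul, Algebra.smul_def, RingHom.id_apply] }
    fun a b => (hB.pd (Sum.inl i)).leibniz a b

lemma derivation_sum_apply {τ R M N : Type*} [CommRing R] [CommRing M] [Algebra R M] [AddCommGroup N]
    [Module R N] [Module M N] (s : Finset τ) (D : τ → Derivation R M N) (b : M) :
    (∑ i ∈ s, D i) b = ∑ i ∈ s, D i b := by
  classical
  induction s using Finset.induction_on with
  | empty => simp
  | insert i s hi ih => rw [Finset.sum_insert hi, Finset.sum_insert hi, Derivation.add_apply, ih]

lemma relPd_apply (hA : IsEtaleCoords k y)
    (hB : IsEtaleCoords k (Sum.elim x (algebraMap A B ∘ y))) (i : ι) (b : B) :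
    relPd hA hB i b = hB.pd (Sum.inl i) b := rfl

omit [IsLocalRing A] in
lemma relDerivation_apply [Fintype ι]
    (hB : IsEtaleCoords k (Sum.elim x (algebraMap A B ∘ y))) (D : Derivation A B B) (b : B) :
    D b = ∑ i, D (x i) * hB.pd (Sum.inl i) b := by
  have := hB.derivation_apply (D.restrictScalars k) b
  rw [Fintype.sum_sum_type] at this
  refine this.trans ?_
  simp [mul_comm]

lemma relPd_coord (hA : IsEtaleCoords k y)
    (hB : IsEtaleCoords k (Sum.elim x (algebraMap A B ∘ y))) [DecidableEq ι] (i j : ι) :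
    relPd hA hB i (x j) = if j = i then 1 else 0 := by
  have h := hB.pd_coord (Sum.inl i) (Sum.inl j)
  simpa [relPd_apply] using h

/-- The basis of relative partial derivatives. -/
def relPdBasis [Fintype ι] (hA : IsEtaleCoords k y)
    (hB : IsEtaleCoords k (Sum.elim x (algebraMap A B ∘ y))) :
    Module.Basis ι B (Derivation A B B) := by
  classical
  refine Module.Basis.mk (v := relPd hA hB) ?_ ?_
  · rw [Fintype.linearIndependent_iff]
    intro c hc j
    have := congrArg (fun D : Derivation A B B => D (x j)) hc
    simpa [derivation_sum_apply, relPd_coord] using this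
  · rintro D -
    have : D = ∑ i, D (x i) • relPd hA hB i := by
      refine Derivation.ext fun b => ?_
      rw [relDerivation_apply hB D b]
      simp [derivation_sum_apply, relPd_apply]
    rw [this]
    exact Submodule.sum_mem _ fun i _ => Submodule.smul_mem _ _ (Submodule.subset_span ⟨i, rfl⟩)

/-- A change of frame acts on the Hessian by congruence: the extra term of the product rule contains
a derivative of Φ in x, which vanishes on the critical scheme. Hence the square root of the
determinant changes only by a unit. -/
lemma exists_pd_hessian [Fintype ι] (hA : IsEtaleCoords k y)
    (hB : IsEtaleCoords k (Sum.elim x (algebraMap A B ∘ y))) (Φ : B)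
    (hker : ∀ i, toCRing k A Φ m (hB.pd (Sum.inl i) Φ) = 0) {d : ℕ}
    (b : Module.Basis (Fin d) B (Derivation A B B)) [DecidableEq ι] :
    ∃ u : (CRing k A Φ m)ˣ, (hessianMatrix k Φ m b).det = u ^ 2 *
      (Matrix.of fun i j : ι =>
        toCRing k A Φ m (hB.pd (Sum.inl i) (hB.pd (Sum.inl j) Φ))).det := by
  let π := toCRing k A Φ m
  let e : Fin d ≃ ι := b.indexEquiv (relPdBasis hA hB)
  let U : Matrix ι ι B := Matrix.of fun i j => b (e.symm i) (x j)
  let V : Matrix ι ι B := Matrix.of fun i j => b.repr (relPd hA hB i) (e.symm j)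
  have hVU : V * U = 1 := by
    ext i j
    have h1 := congrArg (fun D : Derivation A B B => D (x j)) (b.sum_repr (relPd hA hB i))
    simp only [derivation_sum_apply, Derivation.smul_apply, smul_eq_mul,
      relPd_coord] at h1
    rw [Matrix.mul_apply, Matrix.one_apply, ← e.sum_comp]
    simpa [V, U, eq_comm] using h1
  have hU : IsUnit U.det := by
    have := congrArg Matrix.det hVU
    rw [Matrix.det_mul, Matrix.det_one] at this
    exact IsUnit.of_mul_eq_one_right _ this
  have hU' : IsUnit (U.map π).det := by
    have := hU.map π
    rwa [RingHom.map_det] at this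
  refine ⟨hU'.unit, ?_⟩
  have key : (hessianMatrix k Φ m b).submatrix e.symm e.symm =
      U.map π * (Matrix.of fun i j : ι => π (hB.pd (Sum.inl i) (hB.pd (Sum.inl j) Φ))) *
        (U.map π).transpose := by
    ext i j
    simp only [hessianMatrix, Matrix.submatrix_apply, Matrix.of_apply]
    rw [relDerivation_apply hB (b (e.symm j)) Φ, map_sum, map_sum, Matrix.mul_apply]
    refine Finset.sum_congr rfl fun l _ => ?_
    rw [Derivation.leibniz, map_add, smul_eq_mul, smul_eq_mul, map_mul, map_mul]
    rw [hker l, zero_mul, add_zero, relDerivation_apply hB (b (e.symm i)), map_sum, Matrix.mul_apply,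
      mul_comm]
    simp [U, π, Matrix.map_apply]
  rw [← Matrix.det_submatrix_equiv_self e.symm, key, Matrix.det_mul, Matrix.det_mul,
    Matrix.det_transpose, IsUnit.unit_spec]
  ring

/-- A vector field that kills Φ preserves the ideal of Φ, hence is tangent to the hypersurface. -/
lemma exists_derivation_quotient {k B : Type u} [Field k] [CommRing B]
    [Algebra k B] (Φ : B) (D : Derivation k B B) (hD : D Φ = 0) :
    ∃ δ : Derivation k (DRing Φ) (DRing Φ), ∀ b,
      δ (Ideal.Quotient.mk _ b) = Ideal.Quotient.mk _ (D b) := by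
  have h : ∀ b, Ideal.Quotient.mkₐ k (Ideal.span {Φ}) b = 0 →
      Ideal.Quotient.mkₐ k (Ideal.span {Φ}) (D b) = 0 := by
    intro b hb
    rw [Ideal.Quotient.mkₐ_eq_mk, Ideal.Quotient.eq_zero_iff_mem, Ideal.mem_span_singleton] at hb ⊢
    obtain ⟨c, rfl⟩ := hb
    rw [Derivation.leibniz, hD, smul_zero, add_zero]
    exact Dvd.intro _ rfl
  exact ⟨Derivation.liftOfSurjective (Ideal.Quotient.mkₐ_surjective k _) h,
    fun b => Derivation.liftOfSurjective_apply (Ideal.Quotient.mkₐ_surjective k _) h b⟩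

/-- Multiples of ∂/∂y_{j₀} correct ∂/∂xᵢ and the remaining ∂/∂yⱼ to fields tangent to the
hypersurface. Their minor with respect to y is ∂Φ/∂xᵢ up to a unit. -/
lemma pd_mem_criticalIdeal (hA : IsEtaleCoords k y)
    (hB : IsEtaleCoords k (Sum.elim x (algebraMap A B ∘ y))) (Φ : B) (j₀ : Fin m)
    (hj₀ : IsUnit (hB.pd (Sum.inr j₀) Φ)) (i : ι) :
    Ideal.Quotient.mk (Ideal.span {Φ}) (hB.pd (Sum.inl i) Φ) ∈
      criticalIdeal k ((Ideal.Quotient.mk (Ideal.span {Φ})).comp (algebraMap A B)) m := by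
  classical
  obtain ⟨s, hs⟩ := hj₀.exists_right_inv
  let T : Fin m → Derivation k B B := fun j =>
    if j = j₀ then hB.pd (Sum.inl i) else hB.pd (Sum.inr j)
  let T' : Fin m → Derivation k B B := fun j => T j - (T j Φ * s) • hB.pd (Sum.inr j₀)
  have hT' : ∀ j, T' j Φ = 0 := by
    intro j
    simp only [T', Derivation.sub_apply, Derivation.smul_apply, smul_eq_mul]
    linear_combination -T j Φ * hs
  choose δ hδ using fun j => exists_derivation_quotient Φ (T' j) (hT' j)
  have h1 : Ideal.Quotient.mk (Ideal.span {Φ})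
      ((Matrix.of fun a b => T' a (algebraMap A B (y b))).det) ∈
      criticalIdeal k ((Ideal.Quotient.mk (Ideal.span {Φ})).comp (algebraMap A B)) m := by
    refine Ideal.subset_span ⟨δ, y, ?_⟩
    rw [RingHom.map_det]
    congr 1
    ext a b
    exact (hδ a _).symm
  have hy : ∀ (a b : Fin m), hB.pd (Sum.inr a) (algebraMap A B (y b)) = if b = a then 1 else 0 := by
    intro a b
    have h := hB.pd_coord (Sum.inr a) (Sum.inr b)
    simpa using h
  -- The matrix is the identity outside column j₀, so Cramer's rule gives its determinant as the
  -- entry of that column at j₀.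
  have h2 : (Matrix.of fun a b => T' a (algebraMap A B (y b))) =
      (1 : Matrix (Fin m) (Fin m) B).updateCol j₀ fun a => -(T a Φ * s) := by
    ext a b
    simp only [T', Matrix.of_apply, Derivation.sub_apply, Derivation.smul_apply, smul_eq_mul, hy,
      Matrix.updateCol_apply]
    by_cases ha : a = j₀
    · subst ha
      simp only [T, ↓reduceIte, hA.pd_inl_algebraMap hB, zero_sub]
      by_cases hb : b = a
      · simp [hb]
      · rw [if_neg hb, if_neg hb, Matrix.one_apply_ne (Ne.symm hb)]; simp
    · simp only [T, if_neg ha, hy, Matrix.one_apply]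
      by_cases hb : b = j₀
      · subst hb
        simp [Ne.symm ha]
      · simp [hb, eq_comm]
  rw [h2, ← Matrix.cramer_apply, Matrix.cramer_one] at h1
  have h3 := Ideal.mul_mem_left _ (Ideal.Quotient.mk (Ideal.span {Φ}) (-hB.pd (Sum.inr j₀) Φ)) h1
  rw [← map_mul] at h3
  convert h3 using 2
  simp only [T, ↓reduceIte, Module.End.one_apply]
  linear_combination -hB.pd (Sum.inl i) Φ * hs

/-- By the chain rule every minor is a multiple of det N, where N has the entries δᵢ(yⱼ).
Derivations of the hypersurface kill Φ, so N maps the y-gradient of Φ into J. The adjugate of N then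
puts det N times the unit ∂Φ/∂y_{j₀} into J. -/
lemma criticalIdeal_le [Fintype ι] (hA : IsEtaleCoords k y)
    (hB : IsEtaleCoords k (Sum.elim x (algebraMap A B ∘ y))) (Φ : B) (j₀ : Fin m)
    (hj₀ : IsUnit (hB.pd (Sum.inr j₀) Φ)) :
    criticalIdeal k ((Ideal.Quotient.mk (Ideal.span {Φ})).comp (algebraMap A B)) m ≤
      Ideal.map (Ideal.Quotient.mk (Ideal.span {Φ}))
        (Ideal.span (Set.range fun i => hB.pd (Sum.inl i) Φ)) := by
  classical
  set J := Ideal.map (Ideal.Quotient.mk (Ideal.span {Φ}))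
        (Ideal.span (Set.range fun i => hB.pd (Sum.inl i) Φ)) with hJ
  refine Ideal.span_le.mpr ?_
  rintro _ ⟨δ, a, rfl⟩
  let π : B →ₐ[k] DRing Φ := Ideal.Quotient.mkₐ k (Ideal.span {Φ})
  let πA : A →ₐ[k] DRing Φ := π.comp (IsScalarTower.toAlgHom k A B)
  let N : Matrix (Fin m) (Fin m) (DRing Φ) := Matrix.of fun i j => δ i (πA (y j))
  let G : Matrix (Fin m) (Fin m) (DRing Φ) := Matrix.of fun l j => πA (hA.pd l (a j))
  have hM : (Matrix.of fun i j => δ i (((Ideal.Quotient.mk (Ideal.span {Φ})).comp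
      (algebraMap A B)) (a j))) = N * G := by
    ext i j
    rw [Matrix.mul_apply]
    refine (hA.chain_rule πA (δ i) (a j)).trans ?_
    exact Finset.sum_congr rfl fun l _ => mul_comm _ _
  rw [SetLike.mem_coe, hM, Matrix.det_mul]
  refine Ideal.mul_mem_right _ _ ?_
  let s : Fin m → DRing Φ := fun j => π (hB.pd (Sum.inr j) Φ)
  have hN : ∀ i, (N.mulVec s) i ∈ J := by
    intro i
    have h1 := hB.chain_rule π (δ i) Φ
    have h2 : π Φ = 0 := Ideal.Quotient.eq_zero_iff_mem.mpr (Ideal.mem_span_singleton_self Φ)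
    rw [h2, map_zero, Fintype.sum_sum_type] at h1
    have h3 : (N.mulVec s) i = ∑ j, π (hB.pd (Sum.inr j) Φ) *
        δ i (π ((Sum.elim x (algebraMap A B ∘ y)) (Sum.inr j))) := by
      rw [Matrix.mulVec, dotProduct]
      exact Finset.sum_congr rfl fun l _ => mul_comm _ _
    rw [h3, ← neg_eq_iff_add_eq_zero.mpr h1.symm]
    refine J.neg_mem_iff.mpr (Ideal.sum_mem _ fun l _ => Ideal.mul_mem_right _ _ ?_)
    exact Ideal.mem_map_of_mem _ (Ideal.subset_span ⟨l, rfl⟩)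
  have h4 : N.det * s j₀ ∈ J := by
    have h5 : N.det • s = N.adjugate.mulVec (N.mulVec s) := by
      rw [Matrix.mulVec_mulVec, Matrix.adjugate_mul, Matrix.smul_mulVec, Matrix.one_mulVec]
    have h6 := congrFun h5 j₀
    rw [Pi.smul_apply, smul_eq_mul] at h6
    rw [h6, Matrix.mulVec, dotProduct]
    exact Ideal.sum_mem _ fun l _ => Ideal.mul_mem_left _ _ (hN l)
  exact (Ideal.mul_unit_mem_iff_mem J (hj₀.map π)).mp h4

lemma ker_toCRing [Fintype ι] (hA : IsEtaleCoords k y)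
    (hB : IsEtaleCoords k (Sum.elim x (algebraMap A B ∘ y))) (Φ : B) (j₀ : Fin m)
    (hj₀ : IsUnit (hB.pd (Sum.inr j₀) Φ)) :
    RingHom.ker (toCRing k A Φ m) =
      Ideal.span (Set.range fun o : Option ι => o.elim Φ fun i => hB.pd (Sum.inl i) Φ) := by
  have h1 : criticalIdeal k ((Ideal.Quotient.mk (Ideal.span {Φ})).comp (algebraMap A B)) m =
      Ideal.map (Ideal.Quotient.mk (Ideal.span {Φ}))
        (Ideal.span (Set.range fun i => hB.pd (Sum.inl i) Φ)) := by
    refine le_antisymm (criticalIdeal_le hA hB Φ j₀ hj₀) ?_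
    rw [Ideal.map_span, Ideal.span_le]
    rintro _ ⟨_, ⟨i, rfl⟩, rfl⟩
    exact pd_mem_criticalIdeal hA hB Φ j₀ hj₀ i
  rw [toCRing, ← RingHom.comap_ker, Ideal.mk_ker, h1,
    Ideal.comap_map_of_surjective' _ Ideal.Quotient.mk_surjective, Ideal.mk_ker, sup_comm,
    ← Ideal.span_union]
  congr 1
  ext b
  simp [Option.exists]
  grind

end Critical

/-! ### Formal coordinates on the critical scheme -/

section CriticalCoords

lemma IsFormalCoords.lin_mul {k A : Type*} [Field k] [CommRing A] [IsLocalRing A] [Algebra k A]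
    {σ : Type*} [Finite σ] {v : σ → A} (hv : IsFormalCoords k v) {a : A}
    (ha : a ∈ maximalIdeal A) {b : A} {c : k} (hc : b - algebraMap k A c ∈ maximalIdeal A) :
    hv.lin (b * a) = c • hv.lin a := by
  have h1 : (b - algebraMap k A c) * a ∈ maximalIdeal A ^ 2 := by
    rw [sq]; exact Ideal.mul_mem_mul hc ha
  rw [hv.mem_sq_iff (Ideal.mul_mem_left _ _ ha), sub_mul, map_sub, sub_eq_zero, ← Algebra.smul_def,
    map_smul] at h1
  exact h1

/-- If a quotient by an ideal has smaller embedding dimension, then one of the given generators of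
the ideal is not in the square of the maximal ideal. -/
lemma IsFormalCoords.exists_mem_notMem_sq {k C : Type*} [Field k] [CommRing C] [IsLocalRing C]
    [Algebra k C] {r : ℕ} {w : Fin r → C} (hw : IsFormalCoords k w) (S : Set C)
    [IsLocalRing (C ⧸ Ideal.span S)] [IsNoetherianRing (C ⧸ Ideal.span S)]
    (h : (maximalIdeal (C ⧸ Ideal.span S)).spanFinrank < r) :
    ∃ g ∈ S, g ∉ maximalIdeal C ^ 2 := by
  -- If all generators were in 𝔪², passing to the quotient would not change the cotangent space.
  -- Lifts of minimal generators of the quotient's maximal ideal would span r dimensions, which are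
  -- too many.
  by_contra! hS
  have hI : Ideal.span S ≤ maximalIdeal C ^ 2 := Ideal.span_le.mpr hS
  have : IsLocalHom (Ideal.Quotient.mk (Ideal.span S)) :=
    .of_surjective _ Ideal.Quotient.mk_surjective
  obtain ⟨s, hs, hspan⟩ := Submodule.FG.exists_span_finset_card_eq_spanFinrank
    (IsNoetherian.noetherian (maximalIdeal (C ⧸ Ideal.span S)))
  choose f hf using fun t : s => Ideal.Quotient.mk_surjective (I := Ideal.span S) t.1
  have hfm : ∀ t, f t ∈ maximalIdeal C := by
    intro t ht
    have h1 : t.1 ∈ maximalIdeal (C ⧸ Ideal.span S) := by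
      rw [← hspan]; exact Submodule.subset_span t.2
    exact h1 (hf t ▸ ht.map _)
  have hle : (⊤ : Submodule k (Fin r → k)) ≤ Submodule.span k (Set.range fun t => hw.lin (f t)) := by
    rw [← (Pi.basisFun k (Fin r)).span_eq, Submodule.span_le]
    rintro _ ⟨i, rfl⟩
    have h1 : Ideal.Quotient.mk (Ideal.span S) (w i) ∈ Submodule.span (C ⧸ Ideal.span S)
        (Set.range fun t : s => (t : C ⧸ Ideal.span S)) := by
      have : (Set.range fun t : s => (t : C ⧸ Ideal.span S)) = s := by simp
      rw [this, hspan]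
      exact fun hu => hw.mem i (isUnit_of_map_unit _ _ hu)
    rw [Submodule.mem_span_range_iff_exists_fun] at h1
    obtain ⟨c, hc⟩ := h1
    choose c' hc' using fun t => Ideal.Quotient.mk_surjective (I := Ideal.span S) (c t)
    choose c₀ hc₀ using fun t => hw.exists_sub_C_mem (c' t)
    have h2 : w i - ∑ t, c' t * f t ∈ maximalIdeal C ^ 2 := by
      refine hI (Ideal.Quotient.eq_zero_iff_mem.mp ?_)
      rw [map_sub, map_sum, ← hc, sub_eq_zero]
      refine Finset.sum_congr rfl fun t _ => ?_
      rw [map_mul, hc', hf, smul_eq_mul]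
    have h3 : w i - ∑ t, c' t * f t ∈ maximalIdeal C := Ideal.pow_le_self two_ne_zero h2
    rw [hw.mem_sq_iff h3, map_sub, map_sum, sub_eq_zero, hw.lin_coord] at h2
    rw [Pi.basisFun_apply, h2]
    refine Submodule.sum_mem _ fun t _ => ?_
    rw [hw.lin_mul (hfm t) (hc₀ t)]
    exact Submodule.smul_mem _ _ (Submodule.subset_span ⟨t, rfl⟩)
  have h1 := finrank_range_le_card (R := k) fun t => hw.lin (f t)
  rw [Set.finrank, top_le_iff.mp hle, finrank_top, Module.finrank_fin_fun, Fintype.card_coe, hs] at h1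
  omega

lemma IsEtaleCoords.toPowerSeries_pd {k B : Type u} [Field k] [CommRing B] [IsLocalRing B]
    [Algebra k B] {σ : Type} [Finite σ] {v : σ → B} (hv : IsEtaleCoords k v) (i : σ) (b : B) :
    hv.isFormalCoords.toPowerSeries (hv.pd i b) =
      MvPowerSeries.pderiv k i (hv.isFormalCoords.toPowerSeries b) := by
  classical
  have := Fintype.ofFinite σ
  rw [hv.chain_rule hv.isFormalCoords.toPowerSeries (MvPowerSeries.pderiv k i) b]
  simp only [hv.isFormalCoords.toPowerSeries_coord, MvPowerSeries.pderiv_X, Pi.single_apply]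
  simp

lemma IsEtaleCoords.isUnit_pd {k B : Type u} [Field k] [CommRing B] [IsLocalRing B]
    [Algebra k B] {σ : Type} [Finite σ] {v : σ → B} (hv : IsEtaleCoords k v) {i : σ} {b : B}
    (h : hv.isFormalCoords.lin b i ≠ 0) : IsUnit (hv.pd i b) := by
  by_contra hu
  have h1 := hv.isFormalCoords.toPowerSeries_mem ((mem_maximalIdeal _).mpr hu)
  rw [hv.toPowerSeries_pd, MvPowerSeries.mem_maximalIdeal_iff,
    MvPowerSeries.constantCoeff_pderiv] at h1
  exact h h1

variable {k A B : Type u} [Field k] [CommRing A] [IsLocalRing A] [Algebra k A]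
  [CommRing B] [IsLocalRing B] [Algebra k B] [Algebra A B] [IsScalarTower k A B]
  {ι : Type} {m : ℕ} {x : ι → B} {y : Fin m → A}

variable (k A) in
/-- The restriction to the critical scheme as a homomorphism of `k`-algebras. -/
def toCRingₐ (Φ : B) (m : ℕ) : B →ₐ[k] CRing k A Φ m :=
  (Ideal.Quotient.mkₐ k _).comp (Ideal.Quotient.mkₐ k (Ideal.span {Φ}))

/-- The equations of the critical scheme. -/
def critEqs (hB : IsEtaleCoords k (Sum.elim x (algebraMap A B ∘ y))) (Φ : B) (o : Option ι) : B :=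
  o.elim Φ fun i => hB.pd (Sum.inl i) Φ

omit [IsLocalRing A] [Algebra k A] [IsScalarTower k A B] in
lemma exists_isUnit_pd [Finite ι] (hB : IsEtaleCoords k (Sum.elim x (algebraMap A B ∘ y))) {Φ : B}
    (hli : LinearIndependent k fun (o : Option ι) (j : Fin m) =>
      hB.isFormalCoords.lin (critEqs hB Φ o) (Sum.inr j)) :
    ∃ j₀, IsUnit (hB.pd (Sum.inr j₀) Φ) := by
  obtain ⟨j, hj⟩ := Function.ne_iff.mp (hli.ne_zero none)
  exact ⟨j, hB.isUnit_pd hj⟩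

lemma ker_toCRing_eq_span [Fintype ι] (hA : IsEtaleCoords k y)
    (hB : IsEtaleCoords k (Sum.elim x (algebraMap A B ∘ y))) {Φ : B}
    (hli : LinearIndependent k fun (o : Option ι) (j : Fin m) =>
      hB.isFormalCoords.lin (critEqs hB Φ o) (Sum.inr j)) :
    RingHom.ker (toCRing k A Φ m) = Ideal.span (Set.range (critEqs hB Φ)) := by
  obtain ⟨j, hj⟩ := exists_isUnit_pd hB hli
  exact ker_toCRing hA hB Φ j hj

lemma toCRing_critEqs [Fintype ι] (hA : IsEtaleCoords k y)
    (hB : IsEtaleCoords k (Sum.elim x (algebraMap A B ∘ y))) {Φ : B}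
    (hli : LinearIndependent k fun (o : Option ι) (j : Fin m) =>
      hB.isFormalCoords.lin (critEqs hB Φ o) (Sum.inr j)) (o : Option ι) :
    toCRing k A Φ m (critEqs hB Φ o) = 0 := by
  rw [← RingHom.mem_ker, ker_toCRing_eq_span hA hB hli]
  exact Ideal.subset_span ⟨o, rfl⟩

omit [IsLocalRing A] [Algebra k A] [IsScalarTower k A B] in
lemma mem_maximalIdeal_of_toCRing_eq_zero {Φ b : B} [Nontrivial (CRing k A Φ m)]
    (h : toCRing k A Φ m b = 0) : b ∈ maximalIdeal B := by
  intro hb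
  have := hb.map (toCRing k A Φ m)
  rw [h] at this
  exact not_isUnit_zero this

/-- The card ι + 1 equations form part of a coordinate system of card ι + m elements; dividing by
them leaves m - 1 coordinates. -/
lemma exists_formalCoords_CRing [Fintype ι] (hA : IsEtaleCoords k y)
    (hB : IsEtaleCoords k (Sum.elim x (algebraMap A B ∘ y))) {Φ : B} [Nontrivial (CRing k A Φ m)]
    (hli : LinearIndependent k fun (o : Option ι) (j : Fin m) =>
      hB.isFormalCoords.lin (critEqs hB Φ o) (Sum.inr j)) :
    ∃ (r : ℕ) (w : Fin r → CRing k A Φ m), r + 1 = m ∧ IsFormalCoords k w := by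
  classical
  have hli' : LinearIndependent k (hB.isFormalCoords.lin ∘ critEqs hB Φ) :=
    LinearIndependent.of_comp (LinearMap.funLeft k k Sum.inr) hli
  obtain ⟨r, g, hr, hg⟩ := exists_linearIndependent_sumElim_single hli'
  rw [Fintype.card_option, Fintype.card_sum, Fintype.card_fin] at hr
  let w : Fin r ⊕ Option ι → B :=
    Sum.elim (fun i => (Sum.elim x (algebraMap A B ∘ y)) (g i)) (critEqs hB Φ)
  have hw : IsFormalCoords k w := by
    refine hB.isFormalCoords.of_linearIndependent (Fintype.equivOfCardEq ?_) ?_ ?_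
    · simp only [Fintype.card_sum, Fintype.card_option, Fintype.card_fin]; omega
    · rintro (i | o)
      · exact hB.mem _
      · exact mem_maximalIdeal_of_toCRing_eq_zero (toCRing_critEqs hA hB hli o)
    · have h1 := hg.comp _ (Equiv.sumComm (Fin r) (Option ι)).injective
      convert h1 using 1
      funext i
      rcases i with i | o
      · exact hB.isFormalCoords.lin_coord _
      · rfl
  refine ⟨r, _, by omega, hw.quotient (toCRingₐ k A Φ m) (toCRing_surjective k A Φ m) ?_⟩
  exact ker_toCRing_eq_span hA hB hli

/-- The square root of the determinant of the Hessian is a local coordinate at a smooth point of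
the degeneracy scheme. -/
lemma exists_sq_eq_det_hessian [Fintype ι] [DecidableEq ι] (hA : IsEtaleCoords k y)
    (hB : IsEtaleCoords k (Sum.elim x (algebraMap A B ∘ y))) {Φ : B} [Nontrivial (CRing k A Φ m)]
    (hli : LinearIndependent k fun (o : Option ι) (j : Fin m) =>
      hB.isFormalCoords.lin (critEqs hB Φ o) (Sum.inr j))
    (hreg : IsRegularLocalRing (RRing k A Φ m))
    (hdim : ringKrullDim (RRing k A Φ m) = ((m - 2 : ℕ) : WithBot ℕ∞)) :
    ∃ g ∈ maximalIdeal (CRing k A Φ m), g ∉ maximalIdeal (CRing k A Φ m) ^ 2 ∧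
      g ^ 2 = (Matrix.of fun i j : ι =>
        toCRing k A Φ m (hB.pd (Sum.inl i) (hB.pd (Sum.inl j) Φ))).det := by
  obtain ⟨r, w, hr, hw⟩ := exists_formalCoords_CRing hA hB hli
  have hne : degeneracyIdeal k A Φ m ≠ ⊤ :=
    Ideal.Quotient.nontrivial_iff.mp (inferInstanceAs (Nontrivial (RRing k A Φ m)))
  have hcard := hli.fintype_card_le_finrank
  rw [Fintype.card_option, Module.finrank_fin_fun] at hcard
  -- For empty ι the empty determinant 1 would make the degeneracy ideal the unit ideal. Hence m ≥
  -- 2, and the truncated m - 2 is really smaller than r = m - 1.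
  have hpos : 0 < Fintype.card ι := by
    by_contra h0
    have h0 : Fintype.card ι = 0 := by omega
    refine hne ((Ideal.eq_top_iff_one _).mpr (Ideal.subset_span ⟨0,
      (relPdBasis hA hB).reindex (Fintype.equivFinOfCardEq h0), ?_⟩))
    rw [Matrix.det_isEmpty, one_pow]
  have hfr : (maximalIdeal (RRing k A Φ m)).spanFinrank = m - 2 := by
    have := hreg.spanFinrank_maximalIdeal
    rw [hdim] at this
    exact_mod_cast this
  have : IsLocalRing (CRing k A Φ m ⧸ Ideal.span
      {g | ∃ (d : ℕ) (b : Module.Basis (Fin d) B (Derivation A B B)),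
        g ^ 2 = (hessianMatrix k Φ m b).det}) := hreg.toIsLocalRing
  have : IsNoetherianRing (CRing k A Φ m ⧸ Ideal.span
      {g | ∃ (d : ℕ) (b : Module.Basis (Fin d) B (Derivation A B B)),
        g ^ 2 = (hessianMatrix k Φ m b).det}) := inferInstanceAs (IsNoetherianRing (RRing k A Φ m))
  -- The embedding dimension drops from m - 1 to m - 2, so some generator has a nonzero linear part.
  obtain ⟨g, ⟨d, b, hg⟩, hg2⟩ := hw.exists_mem_notMem_sq
    {g | ∃ (d : ℕ) (b : Module.Basis (Fin d) B (Derivation A B B)),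
      g ^ 2 = (hessianMatrix k Φ m b).det} (hfr.trans_lt (by omega))
  have hgm : g ∈ maximalIdeal (CRing k A Φ m) := by
    intro hu
    exact hne (Ideal.eq_top_of_isUnit_mem _ (Ideal.subset_span ⟨d, b, hg⟩) hu)
  obtain ⟨u, hu⟩ := exists_pd_hessian hA hB Φ (fun i => toCRing_critEqs hA hB hli (some i)) b
  refine ⟨(u⁻¹ : (CRing k A Φ m)ˣ) * g, Ideal.mul_mem_left _ _ hgm, fun h => hg2 ?_, ?_⟩
  · have := Ideal.mul_mem_left _ (u : CRing k A Φ m) h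
    rwa [Units.mul_inv_cancel_left] at this
  · rw [mul_pow, hg, hu, ← mul_assoc, ← mul_pow, Units.inv_mul, one_pow, one_mul]

end CriticalCoords

/-! ### Elimination of variables -/

section Elimination

/-- A symmetric matrix over a field has an invertible principal submatrix whose rows span all
rows. -/
lemma exists_principal_block {k : Type*} [Field k] {ι : Type*} [Fintype ι] (M : Matrix ι ι k)
    (hM : M.IsSymm) :
    ∃ (c r : ℕ) (e : Fin c ⊕ Fin r ≃ ι) (T : Matrix (Fin c) (Fin r) k),
      IsUnit (M.submatrix (e ∘ Sum.inr) (e ∘ Sum.inr)).det ∧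
      ∀ i l, M (e (Sum.inl i)) l = ∑ s, T i s * M (e (Sum.inr s)) l := by
  classical
  obtain ⟨κ, a, ha, hspan, hli⟩ := exists_linearIndependent' k (fun i => M i)
  have hfin : Finite κ := Finite.of_injective a ha
  have := Fintype.ofFinite κ
  let eκ : Fin (Fintype.card κ) ≃ κ := (Fintype.equivFin κ).symm
  let S : Set ι := Set.range a
  let e₁ : Fin (Fintype.card (Sᶜ : Set ι)) ≃ (Sᶜ : Set ι) := (Fintype.equivFin _).symm
  let e₂ : Fin (Fintype.card κ) ≃ S := eκ.trans (Equiv.ofInjective a ha)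
  let e : Fin (Fintype.card (Sᶜ : Set ι)) ⊕ Fin (Fintype.card κ) ≃ ι :=
    (Equiv.sumComm _ _).trans ((Equiv.sumCongr e₂ e₁).trans (Equiv.Set.sumCompl S))
  have her : ∀ s, e (Sum.inr s) = a (eκ s) := fun s => rfl
  have hrow : ∀ i, ∃ T : Fin (Fintype.card κ) → k, ∀ l, M i l = ∑ s, T s * M (e (Sum.inr s)) l := by
    intro i
    have h1 : M i ∈ Submodule.span k (Set.range ((fun i => M i) ∘ a)) := by
      rw [hspan]; exact Submodule.subset_span ⟨i, rfl⟩
    rw [Submodule.mem_span_range_iff_exists_fun] at h1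
    obtain ⟨T, hT⟩ := h1
    refine ⟨T ∘ eκ, fun l => ?_⟩
    rw [← hT, Finset.sum_apply, ← eκ.sum_comp]
    rfl
  choose T hT using hrow
  refine ⟨_, _, e, Matrix.of fun i => T (e (Sum.inl i)), ?_, fun i l => hT _ l⟩
  rw [isUnit_iff_ne_zero]
  intro h0
  obtain ⟨u, hu, hMu⟩ := Matrix.exists_mulVec_eq_zero_iff.mpr h0
  -- The rows of the block span all rows, so every row of M kills u. By symmetry this is a relation
  -- among the chosen independent rows.
  have h1 : ∀ i, ∑ s, M i (e (Sum.inr s)) * u s = 0 := by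
    intro i
    have h2 : ∀ s', ∑ s, M (e (Sum.inr s')) (e (Sum.inr s)) * u s = 0 := fun s' => congrFun hMu s'
    calc ∑ s, M i (e (Sum.inr s)) * u s
        = ∑ s, ∑ s', T i s' * (M (e (Sum.inr s')) (e (Sum.inr s)) * u s) := by
          refine Finset.sum_congr rfl fun s _ => ?_
          rw [hT i, Finset.sum_mul]
          exact Finset.sum_congr rfl fun s' _ => mul_assoc _ _ _
      _ = 0 := by
          rw [Finset.sum_comm]
          refine Finset.sum_eq_zero fun s' _ => ?_
          rw [← Finset.mul_sum, h2, mul_zero]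
  refine hu ?_
  have h3 := Fintype.linearIndependent_iff.mp (hli.comp _ eκ.injective) u (by
    funext l
    rw [Finset.sum_apply]
    refine (Finset.sum_congr rfl fun s _ => ?_).trans (h1 l)
    change u s * M (e (Sum.inr s)) l = _
    rw [mul_comm, hM.apply])
  exact funext h3

variable {k : Type*} [Field k]

lemma IsFormalCoords.constantCoeff_eq {B : Type*} [CommRing B] [IsLocalRing B] [Algebra k B]
    {σ : Type*} (f : B →ₐ[k] MvPowerSeries σ k) (hf : ∀ b ∈ maximalIdeal B, f b ∈ maximalIdeal _)
    {b : B} {c : k} (h : b - algebraMap k B c ∈ maximalIdeal B) :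
    MvPowerSeries.constantCoeff (f b) = c := by
  have := MvPowerSeries.mem_maximalIdeal_iff.mp (hf _ h)
  rwa [map_sub, map_sub, AlgHom.commutes, MvPowerSeries.algebraMap_apply,
    MvPowerSeries.constantCoeff_C, sub_eq_zero] at this

/-- Setting some of the formal coordinates equal to zero. -/
lemma IsFormalCoords.exists_elimination {B : Type*} [CommRing B] [IsLocalRing B] [Algebra k B]
    {σ ρ : Type*} [Fintype σ] [Fintype ρ] {v : σ → B} {e : ρ → B}
    (hv : IsFormalCoords k (Sum.elim v e)) :
    ∃ f : B →ₐ[k] MvPowerSeries σ k, (∀ b ∈ maximalIdeal B, f b ∈ maximalIdeal _) ∧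
      (∀ i, f (v i) = MvPowerSeries.X i) ∧ (∀ s, f (e s) = 0) ∧
      (∀ b, f b ∈ maximalIdeal _ ^ 2 → ∃ d : ρ → k, b - ∑ s, d s • e s ∈ maximalIdeal B ^ 2) ∧
      ∀ {τ : Type} [Finite τ] (q : B →ₐ[k] MvPowerSeries τ k),
        (∀ b ∈ maximalIdeal B, q b ∈ maximalIdeal _) → (∀ s, q (e s) = 0) →
        ∃ g : MvPowerSeries σ k →ₐ[k] MvPowerSeries τ k, ∀ b, g (f b) = q b := by
  classical
  let I : Ideal B := Ideal.span (Set.range e)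
  have he : ∀ s, e s ∈ maximalIdeal B := fun s => hv.mem (Sum.inr s)
  have hI : I ≤ maximalIdeal B := by
    rw [Ideal.span_le]
    rintro _ ⟨s, rfl⟩
    exact he s
  have hnt : Nontrivial (B ⧸ I) := Ideal.Quotient.nontrivial_iff.mpr
    (ne_top_of_le_ne_top (maximalIdeal.isMaximal B).ne_top hI)
  have hloc : IsLocalRing (B ⧸ I) :=
    IsLocalRing.of_surjective' (Ideal.Quotient.mk I) Ideal.Quotient.mk_surjective
  have hlh : IsLocalHom (Ideal.Quotient.mk I) := .of_surjective _ Ideal.Quotient.mk_surjective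
  let π : B →ₐ[k] B ⧸ I := Ideal.Quotient.mkₐ k I
  have hπ : Function.Surjective π := Ideal.Quotient.mkₐ_surjective k I
  have hπm : ∀ b ∈ maximalIdeal B, π b ∈ maximalIdeal (B ⧸ I) := fun b hb hu =>
    hb (isUnit_of_map_unit (Ideal.Quotient.mk I) b hu)
  have hE : IsFormalCoords k (π ∘ v) :=
    hv.quotient π hπ (Ideal.Quotient.mkₐ_ker k I)
  have hπe : ∀ s, π (e s) = 0 := fun s =>
    Ideal.Quotient.eq_zero_iff_mem.mpr (Ideal.subset_span ⟨s, rfl⟩)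
  refine ⟨hE.toPowerSeries.comp π, fun b hb => hE.toPowerSeries_mem (hπm b hb), fun i =>
    hE.toPowerSeries_coord i, fun s => ?_, fun b hb => ?_, ?_⟩
  · rw [AlgHom.comp_apply, hπe, map_zero]
  · rw [AlgHom.comp_apply, hE.isCompletionMap.mem_iff] at hb
    have hmap : maximalIdeal (B ⧸ I) = (maximalIdeal B).map (Ideal.Quotient.mk I) := by
      refine le_antisymm (fun z hz => ?_)
        (Ideal.map_le_iff_le_comap.mpr hπm)
      obtain ⟨b, rfl⟩ := Ideal.Quotient.mk_surjective z
      exact Ideal.mem_map_of_mem _ fun hu => hz (hu.map _)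
    rw [hmap, ← Ideal.map_pow] at hb
    obtain ⟨z, hz, hzb⟩ := (Ideal.mem_map_iff_of_surjective _ Ideal.Quotient.mk_surjective).mp hb
    have h1 : b - z ∈ I := Ideal.Quotient.eq.mp hzb.symm
    obtain ⟨c, hc⟩ := Submodule.mem_span_range_iff_exists_fun B |>.mp h1
    -- As the e lie in 𝔪, replacing coefficients by their constant values changes the sum only
    -- modulo 𝔪².
    choose d hd using fun s => hv.exists_sub_C_mem (c s)
    refine ⟨d, ?_⟩
    have h2 : b - ∑ s, d s • e s = z + ∑ s, (c s - algebraMap k B (d s)) * e s := by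
      simp only [sub_mul, Finset.sum_sub_distrib, ← Algebra.smul_def]
      simp only [smul_eq_mul] at hc
      rw [hc]
      ring
    rw [h2]
    refine add_mem hz (Ideal.sum_mem _ fun s _ => ?_)
    rw [sq]
    exact Ideal.mul_mem_mul (hd s) (he s)
  · intro τ _ q hq hqe
    have hqI : ∀ b ∈ I, q b = 0 := by
      have : I ≤ RingHom.ker q := by
        rw [Ideal.span_le]
        rintro _ ⟨s, rfl⟩
        exact hqe s
      exact this
    let qE : B ⧸ I →ₐ[k] MvPowerSeries τ k := Ideal.Quotient.liftₐ I q hqI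
    have hqE : ∀ b, qE (π b) = q b := fun b => rfl
    have hs : MvPowerSeries.HasSubst fun i => q (v i) :=
      MvPowerSeries.hasSubst_of_mem fun i => hq _ (hv.mem (Sum.inl i))
    refine ⟨MvPowerSeries.substAlgHom hs, fun b => ?_⟩
    have key : (MvPowerSeries.substAlgHom hs).comp hE.toPowerSeries = qE := by
      refine hE.algHom_ext (fun a ha => ?_) (fun a ha => ?_) fun i => ?_
      · rw [AlgHom.comp_apply]
        exact MvPowerSeries.algHom_mem_maximalIdeal _ (hE.toPowerSeries_mem ha)
      · obtain ⟨b, rfl⟩ := hπ a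
        rw [hqE]
        exact hq b fun hu => ha (hu.map π)
      · rw [AlgHom.comp_apply, hE.toPowerSeries_coord, MvPowerSeries.substAlgHom_X]
        rfl
    rw [AlgHom.comp_apply, ← AlgHom.comp_apply, key, hqE]

end Elimination

/-! ### The normal form of the projection of the critical scheme -/

section CriticalNormalForm

/-- The order is multiplicative: a series of order one has a square of order two. -/
lemma MvPowerSeries.mem_sq_of_sq_mem {k σ : Type*} [Field k] [Finite σ] {f : MvPowerSeries σ k}
    (hf : f ∈ maximalIdeal (MvPowerSeries σ k)) (h : f ^ 2 ∈ maximalIdeal (MvPowerSeries σ k) ^ 3) :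
    f ∈ maximalIdeal (MvPowerSeries σ k) ^ 2 := by
  rw [← pow_one (maximalIdeal _)] at hf
  rw [MvPowerSeries.mem_pow_maximalIdeal_iff_le_order] at *
  rw [sq, MvPowerSeries.order_mul] at h
  by_contra hlt
  rw [not_le] at hlt
  have h1 : f.order = 1 := le_antisymm (Order.le_of_lt_add_one (by exact_mod_cast hlt))
    (by exact_mod_cast hf)
  rw [h1] at h
  norm_num at h

lemma det_mem_pow {R n : Type*} [CommRing R] [Fintype n] [DecidableEq n] (I : Ideal R)
    (M : Matrix n n R) (hM : ∀ i j, M i j ∈ I) : M.det ∈ I ^ Fintype.card n := by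
  rw [Matrix.det_apply]
  refine Ideal.sum_mem _ fun σ _ => ?_
  rw [Units.smul_def]
  refine zsmul_mem ?_ _
  have := Ideal.prod_mem_prod (s := Finset.univ) (I := fun _ : n => I) (x := fun i => M (σ i) i)
    fun i _ => hM _ _
  simpa using this

variable {k A B : Type u} [Field k] [CommRing A] [IsLocalRing A] [Algebra k A]
  [CommRing B] [IsLocalRing B] [Algebra k B] [Algebra A B] [IsScalarTower k A B]

/-- The invertible block lets the derivatives of Φ in the x of the second group replace these x as
coordinates. Once they are set to zero, the problem concerns F in the first group of x and in y, and
the order of γ forces that group to have two elements. -/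
theorem exists_normalForm_of_block [CharP k 2] {m n c r : ℕ} (hn : n + 1 = m)
    {x : Fin c ⊕ Fin r → B} {y : Fin m → A} (hA : IsEtaleCoords k y)
    (hB : IsEtaleCoords k (Sum.elim x (algebraMap A B ∘ y)))
    (hloc : ∀ a ∈ maximalIdeal A, algebraMap A B a ∈ maximalIdeal B) {Φ : B}
    (hmem : ∀ o, critEqs hB Φ o ∈ maximalIdeal B)
    (hli : LinearIndependent k (hB.isFormalCoords.lin ∘ critEqs hB Φ))
    {M : Matrix (Fin c ⊕ Fin r) (Fin c ⊕ Fin r) k}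
    (hM : ∀ i j, hB.pd (Sum.inl i) (hB.pd (Sum.inl j) Φ) - algebraMap k B (M i j) ∈ maximalIdeal B)
    (hdet : IsUnit (M.submatrix Sum.inr Sum.inr).det) (T : Matrix (Fin c) (Fin r) k)
    (hT : ∀ i l, M (Sum.inl i) l = ∑ s, T i s * M (Sum.inr s) l)
    (q : B →ₐ[k] MvPowerSeries (Fin n) k) (hq : ∀ b ∈ maximalIdeal B, q b ∈ maximalIdeal _)
    (hqd : ∀ b ∈ maximalIdeal (MvPowerSeries (Fin n) k), ∃ a, b - q a ∈ maximalIdeal _ ^ 2)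
    (hqc : ∀ o, q (critEqs hB Φ o) = 0)
    {γ : MvPowerSeries (Fin n) k} (hγ : γ ∈ maximalIdeal _) (hγ2 : γ ∉ maximalIdeal _ ^ 2)
    (hγd : γ ^ 2 = q (Matrix.of fun i j => hB.pd (Sum.inl i) (hB.pd (Sum.inl j) Φ)).det) :
    4 ≤ m ∧ ∃ (ρ : A →ₐ[k] TargetRing k (m - 4))
      (θ : MvPowerSeries (Fin n) k →ₐ[k] SourceRing k (m - 4)), IsCompletionMap k θ ∧
        ∀ a, gammaStar k (m - 4) (ρ a) = θ (q (algebraMap A B a)) := by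
  classical
  let e : Fin r → B := fun s => hB.pd (Sum.inl (Sum.inr s)) Φ
  let v : Fin c ⊕ Fin m → B := Sum.elim (x ∘ Sum.inl) (algebraMap A B ∘ y)
  have hlinM : ∀ i j, hB.isFormalCoords.lin (hB.pd (Sum.inl j) Φ) (Sum.inl i) = M i j := by
    intro i j
    rw [IsFormalCoords.lin_apply, ← MvPowerSeries.constantCoeff_pderiv, ← hB.toPowerSeries_pd]
    exact IsFormalCoords.constantCoeff_eq _ (fun b hb => hB.isFormalCoords.toPowerSeries_mem hb)
      (hM i j)
  -- The linear parts of e in the eliminated x form the invertible block of M.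
  have hve : IsFormalCoords k (Sum.elim v e) := by
    have hmem' : ∀ i, Sum.elim v e i ∈ maximalIdeal B := by
      rintro ((i | j) | s)
      exacts [hB.mem (Sum.inl (Sum.inl i)), hB.mem (Sum.inr j), hmem (some (Sum.inr s))]
    refine hB.isFormalCoords.of_linearIndependent (Fintype.equivOfCardEq (by simp; omega)) hmem'
      (hB.isFormalCoords.linearIndependent_lin hmem' fun d hd => ?_)
    rw [hB.isFormalCoords.mem_sq_iff (Ideal.sum_mem _ fun i _ =>
      Submodule.smul_of_tower_mem _ _ (hmem' i))] at hd
    simp only [Fintype.sum_sum_type, Sum.elim_inl, Sum.elim_inr, map_add, map_sum, map_smul] at hd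
    have hx : ∀ i, hB.isFormalCoords.lin (v (Sum.inl i)) = Pi.single (Sum.inl (Sum.inl i)) 1 :=
      fun i => hB.isFormalCoords.lin_coord (Sum.inl (Sum.inl i))
    have hy : ∀ j, hB.isFormalCoords.lin (v (Sum.inr j)) = Pi.single (Sum.inr j) 1 :=
      fun j => hB.isFormalCoords.lin_coord (Sum.inr j)
    simp only [hx, hy] at hd
    have h1 : ∀ s, d (Sum.inr s) = 0 := by
      have : (M.submatrix Sum.inr Sum.inr).mulVec (fun s => d (Sum.inr s)) = 0 := by
        funext s
        have := congrFun hd (Sum.inl (Sum.inr s))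
        simp only [Pi.add_apply, Finset.sum_apply, Pi.smul_apply, Pi.single_apply, smul_eq_mul] at this
        simpa [e, hlinM, Matrix.mulVec, dotProduct, mul_comm] using this
      exact congrFun (Matrix.eq_zero_of_mulVec_eq_zero hdet.ne_zero this)
    funext i
    rcases i with (i | j) | s
    · have := congrFun hd (Sum.inl (Sum.inl i))
      simpa [h1, Pi.single_apply] using this
    · have := congrFun hd (Sum.inr j)
      simpa [h1, Pi.single_apply] using this
    · exact h1 s
  obtain ⟨f, hf, hfv, hfe, hfsq, hfu⟩ := hve.exists_elimination
  obtain ⟨g, hg⟩ := hfu q hq fun s => hqc (some (Sum.inr s))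
  -- Derivatives of the eliminated x as implicit functions of the remaining ones.
  let W : Matrix (Fin r) (Fin c) (MvPowerSeries (Fin c ⊕ Fin m) k) := Matrix.of fun s i =>
    MvPowerSeries.pderiv k (Sum.inl i) (f (x (Sum.inr s)))
  have hchain : ∀ i b, MvPowerSeries.pderiv k (Sum.inl i) (f b) =
      f (hB.pd (Sum.inl (Sum.inl i)) b) + ∑ s, f (hB.pd (Sum.inl (Sum.inr s)) b) * W s i := by
    intro i b
    have hx : ∀ i, f (x (Sum.inl i)) = MvPowerSeries.X (Sum.inl i) := fun i => hfv (Sum.inl i)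
    have hy : ∀ j, f (algebraMap A B (y j)) = MvPowerSeries.X (Sum.inr j) := fun j => hfv (Sum.inr j)
    rw [hB.chain_rule f (MvPowerSeries.pderiv k (Sum.inl i)) b]
    simp only [Fintype.sum_sum_type, Sum.elim_inl, Sum.elim_inr, Function.comp_apply, hx, hy,
      MvPowerSeries.pderiv_X, Pi.single_apply]
    simp [W]
  let F := f Φ
  -- The eliminated variables contribute nothing, because f kills the derivatives of Φ in them.
  have hF : ∀ i, MvPowerSeries.pderiv k (Sum.inl i) F = f (hB.pd (Sum.inl (Sum.inl i)) Φ) := by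
    intro i
    rw [hchain, Finset.sum_eq_zero fun s _ => ?_, add_zero]
    rw [show f (hB.pd (Sum.inl (Sum.inr s)) Φ) = 0 from hfe s, zero_mul]
  let h : Matrix (Fin c) (Fin c) (MvPowerSeries (Fin c ⊕ Fin m) k) := Matrix.of fun i l =>
    MvPowerSeries.pderiv k (Sum.inl l) (MvPowerSeries.pderiv k (Sum.inl i) F)
  have hh : ∀ i l, h i l = f (hB.pd (Sum.inl (Sum.inl l)) (hB.pd (Sum.inl (Sum.inl i)) Φ)) +
      ∑ s, f (hB.pd (Sum.inl (Sum.inr s)) (hB.pd (Sum.inl (Sum.inl i)) Φ)) * W s l := by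
    intro i l
    rw [← hchain, ← hF]
    rfl
  have hh0 : ∀ s l, f (hB.pd (Sum.inl (Sum.inl l)) (hB.pd (Sum.inl (Sum.inr s)) Φ)) +
      ∑ s', f (hB.pd (Sum.inl (Sum.inr s')) (hB.pd (Sum.inl (Sum.inr s)) Φ)) * W s' l = 0 := by
    intro s l
    rw [← hchain, show f (hB.pd (Sum.inl (Sum.inr s)) Φ) = 0 from hfe s, map_zero]
  let H : Matrix (Fin c ⊕ Fin r) (Fin c ⊕ Fin r) (MvPowerSeries (Fin c ⊕ Fin m) k) :=
    Matrix.of fun i j => f (hB.pd (Sum.inl i) (hB.pd (Sum.inl j) Φ))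
  have hHsymm : ∀ i j, H i j = f (hB.pd (Sum.inl j) (hB.pd (Sum.inl i) Φ)) := fun i j =>
    congrArg f (hB.pd_comm _ _ _)
  have hHM : ∀ i j, MvPowerSeries.constantCoeff (H i j) = M i j := fun i j =>
    IsFormalCoords.constantCoeff_eq f hf (hM i j)
  -- Schur complement: the column operation given by W produces h in the upper left corner by `hh`
  -- and zero below it by `hh0`.
  have hprod : H * Matrix.fromBlocks 1 0 W 1 =
      Matrix.fromBlocks h (H.submatrix Sum.inl Sum.inr) 0 (H.submatrix Sum.inr Sum.inr) := by
    ext (i | s) (l | s')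
    · rw [Matrix.fromBlocks_apply₁₁, hh, Matrix.mul_apply, Fintype.sum_sum_type]
      simp only [Matrix.fromBlocks_apply₁₁, Matrix.fromBlocks_apply₂₁, Matrix.one_apply, hHsymm]
      simp
    · rw [Matrix.fromBlocks_apply₁₂, Matrix.mul_apply, Fintype.sum_sum_type]
      simp only [Matrix.fromBlocks_apply₁₂, Matrix.fromBlocks_apply₂₂, Matrix.one_apply]
      simp
    · rw [Matrix.fromBlocks_apply₂₁, Matrix.mul_apply, Fintype.sum_sum_type, Matrix.zero_apply,
        ← hh0 s l]
      simp only [Matrix.fromBlocks_apply₁₁, Matrix.fromBlocks_apply₂₁, Matrix.one_apply, hHsymm]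
      simp
    · rw [Matrix.fromBlocks_apply₂₂, Matrix.mul_apply, Fintype.sum_sum_type]
      simp only [Matrix.fromBlocks_apply₁₂, Matrix.fromBlocks_apply₂₂, Matrix.one_apply]
      simp
  have hdetH : H.det = h.det * (H.submatrix Sum.inr Sum.inr).det := by
    have := congrArg Matrix.det hprod
    rwa [Matrix.det_mul, Matrix.det_fromBlocks_zero₁₂, Matrix.det_fromBlocks_zero₂₁,
      Matrix.det_one, Matrix.det_one, mul_one, mul_one] at this
  have hunit : IsUnit (H.submatrix Sum.inr Sum.inr).det := by
    rw [MvPowerSeries.isUnit_iff_constantCoeff, RingHom.map_det]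
    convert hdet using 2
    ext s s'
    exact hHM _ _
  -- At the origin the upper rows of M are the combinations T of the lower ones, and `hh0` says that
  -- the lower ones contribute zero.
  have hhm : ∀ i l, h i l ∈ maximalIdeal _ := by
    intro i l
    rw [MvPowerSeries.mem_maximalIdeal_iff, hh, map_add, map_sum]
    have h1 : ∀ s l, M (Sum.inr s) (Sum.inl l) + ∑ s', M (Sum.inr s) (Sum.inr s') *
        MvPowerSeries.constantCoeff (W s' l) = 0 := by
      intro s l
      have := congrArg MvPowerSeries.constantCoeff (hh0 s l)
      simpa only [map_add, map_sum, map_mul, ← hHsymm, hHM, map_zero] using this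
    simp only [map_mul, ← hHsymm, hHM]
    calc M (Sum.inl i) (Sum.inl l) + ∑ s', M (Sum.inl i) (Sum.inr s') *
          MvPowerSeries.constantCoeff (W s' l)
        = ∑ s, T i s * (M (Sum.inr s) (Sum.inl l) + ∑ s', M (Sum.inr s) (Sum.inr s') *
            MvPowerSeries.constantCoeff (W s' l)) := by
          simp only [mul_add, Finset.sum_add_distrib, Finset.mul_sum, hT i, Finset.sum_mul]
          rw [Finset.sum_comm]
          simp only [mul_assoc]
      _ = 0 := Finset.sum_eq_zero fun s _ => by rw [h1, mul_zero]
  have hγh : γ ^ 2 = g h.det * g (H.submatrix Sum.inr Sum.inr).det := by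
    rw [hγd, ← hg, ← map_mul, ← hdetH, AlgHom.map_det]
    rfl
  have hdiag : ∀ i, h i i = 0 := fun i => MvPowerSeries.pderiv_pderiv_self _ _
  -- Size 0 would make γ a unit and size 1 would make it zero. For size at least 3 the square of γ
  -- would have order at least 3, against γ having order one.
  have hc0 : c ≠ 0 := by
    rintro rfl
    rw [Matrix.det_isEmpty, map_one, one_mul] at hγh
    have := hunit.map g
    rw [← hγh] at this
    exact hγ (isUnit_pow_iff two_ne_zero |>.mp this)
  have hc1 : c ≠ 1 := by
    rintro rfl
    rw [Matrix.det_fin_one, hdiag, map_zero, zero_mul] at hγh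
    rw [pow_eq_zero_iff two_ne_zero] at hγh
    exact hγ2 (hγh ▸ zero_mem _)
  have hc3 : ¬ 3 ≤ c := by
    intro hge
    refine hγ2 (MvPowerSeries.mem_sq_of_sq_mem hγ ?_)
    rw [hγh]
    refine Ideal.mul_mem_right _ _ (MvPowerSeries.algHom_mem_pow g ?_)
    have := det_mem_pow _ h hhm
    rw [Fintype.card_fin] at this
    exact Ideal.pow_le_pow_right hge this
  obtain rfl : c = 2 := by omega
  have hsymm : h 1 0 = h 0 1 := MvPowerSeries.pderiv_comm _ _ _
  have hgh : g (h 1 0) ∉ maximalIdeal _ ^ 2 := by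
    intro hmem4
    refine hγ2 (MvPowerSeries.mem_sq_of_sq_mem hγ ?_)
    rw [hγh, Matrix.det_fin_two, hdiag, zero_mul, zero_sub, map_neg, map_mul, ← hsymm]
    refine Ideal.mul_mem_right _ _ ((Ideal.neg_mem_iff _).mpr ?_)
    refine Ideal.pow_le_pow_right (show 3 ≤ 2 + 2 by norm_num) ?_
    rw [pow_add]
    exact Ideal.mul_mem_mul hmem4 hmem4
  have hcrit : ∀ o : Option (Fin 2), f (critEqs hB Φ (o.map Sum.inl)) ∈ maximalIdeal _ := fun o =>
    hf _ (hmem _)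
  -- Such a relation modulo 𝔪² lifts along f to one among all critical equations of Φ, with extra
  -- coefficients `-d'` at the eliminated ones.
  have hind : ∀ a b d : k, a • f Φ + b • f (hB.pd (Sum.inl (Sum.inl 0)) Φ) +
      d • f (hB.pd (Sum.inl (Sum.inl 1)) Φ) ∈ maximalIdeal _ ^ 2 → a = 0 ∧ b = 0 ∧ d = 0 := by
    intro a b d habd
    obtain ⟨d', hd'⟩ := hfsq (a • Φ + b • hB.pd (Sum.inl (Sum.inl 0)) Φ +
      d • hB.pd (Sum.inl (Sum.inl 1)) Φ) (by simpa only [map_add, map_smul] using habd)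
    let t : Option (Fin 2 ⊕ Fin r) → k := fun o =>
      o.elim a (Sum.elim ![b, d] fun s => - d' s)
    have ht : ∑ o, t o • critEqs hB Φ o ∈ maximalIdeal B ^ 2 := by
      convert hd' using 1
      rw [Fintype.sum_option, Fintype.sum_sum_type, Fin.sum_univ_two]
      simp [t, critEqs, e]
      ring
    have ht0 : ∀ o, t o = 0 := by
      refine Fintype.linearIndependent_iff.mp hli t ?_
      rw [hB.isFormalCoords.mem_sq_iff (Ideal.pow_le_self two_ne_zero ht), map_sum] at ht
      simpa using ht
    exact ⟨ht0 none, ht0 (some (Sum.inl 0)), ht0 (some (Sum.inl 1))⟩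
  obtain ⟨h4, ρ, θ, hθ, hcomm⟩ := exists_normalForm hn (F := F)
    (F₀ := f (hB.pd (Sum.inl (Sum.inl 0)) Φ))
    (F₁ := f (hB.pd (Sum.inl (Sum.inl 1)) Φ)) (h := h 1 0) (hF 0) (hF 1) (by rw [← hF]; rfl)
    (hcrit none) (hcrit (some 0)) (hcrit (some 1)) (hhm 1 0) hind g
    (fun b hb => (hqd b hb).imp' f fun a ha => by rwa [hg]) ((hg _).trans (hqc none))
    ((hg _).trans (hqc (some (Sum.inl 0))))
    ((hg _).trans (hqc (some (Sum.inl 1)))) hgh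
  refine ⟨h4, (ρ.comp f).comp (IsScalarTower.toAlgHom k A B), θ, hθ, fun a => ?_⟩
  -- Functions from the base involve only y and are fixed by `squareLeft`. Thus the projection
  -- factors through series in the squares of the x and in y.
  have key : (squareLeft k (Fin 2) (Fin m)).comp (f.comp (IsScalarTower.toAlgHom k A B)) =
      f.comp (IsScalarTower.toAlgHom k A B) := by
    refine hA.isFormalCoords.algHom_ext (fun a ha => ?_) (fun a ha => hf _ (hloc a ha)) fun j => ?_
    · change squareLeft k (Fin 2) (Fin m) (f (algebraMap A B a)) ∈ _
      exact MvPowerSeries.algHom_mem_maximalIdeal _ (hf _ (hloc a ha))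
    · have hy : f (algebraMap A B (y j)) = MvPowerSeries.X (Sum.inr j) := hfv (Sum.inr j)
      change squareLeft k (Fin 2) (Fin m) (f (algebraMap A B (y j))) = f (algebraMap A B (y j))
      rw [hy]
      exact squareLeft_X _
  have h1 := AlgHom.congr_fun hcomm (f (algebraMap A B a))
  have h2 := AlgHom.congr_fun key a
  change squareLeft k (Fin 2) (Fin m) (f (algebraMap A B a)) = f (algebraMap A B a) at h2
  rw [AlgHom.comp_apply, AlgHom.comp_apply, AlgHom.comp_apply, h2, hg] at h1
  exact h1

lemma IsCompletionMap.comp {k A B C : Type*} [Field k] [CommRing A] [IsLocalRing A] [Algebra k A]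
    [CommRing B] [IsLocalRing B] [Algebra k B] [CommRing C] [IsLocalRing C] [Algebra k C]
    {f : A →ₐ[k] B} {g : B →ₐ[k] C} (hf : IsCompletionMap k f) (hg : IsCompletionMap k g) :
    IsCompletionMap k (g.comp f) where
  mem_iff n a := (hg.mem_iff n _).trans (hf.mem_iff n a)
  dense n c := by
    obtain ⟨b, hb⟩ := hg.dense n c
    obtain ⟨a, ha⟩ := hf.dense n b
    refine ⟨a, ?_⟩
    have := add_mem hb ((hg.mem_iff n _).mpr ha)
    rwa [map_sub, sub_add_sub_cancel] at this

lemma IsEtaleCoords.pd_reindex {k B : Type u} [Field k] [CommRing B] [IsLocalRing B] [Algebra k B]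
    {σ τ : Type} [Fintype τ] {v : σ → B} {w : τ → B} (hv : IsEtaleCoords k v)
    (hw : IsEtaleCoords k w) (e : τ ≃ σ) (h : ∀ i, w i = v (e i)) (i : τ) :
    hw.pd i = hv.pd (e i) := by
  classical
  refine hw.derivation_ext fun j => ?_
  rw [hw.pd_coord, h j, hv.pd_coord]
  simp

lemma IsEtaleCoords.lin_reindex {k B : Type u} [Field k] [CommRing B] [IsLocalRing B] [Algebra k B]
    {σ τ : Type} [Fintype τ] [Finite σ] {v : σ → B} {w : τ → B} (hv : IsEtaleCoords k v)
    (hw : IsEtaleCoords k w) (e : τ ≃ σ) (h : ∀ i, w i = v (e i)) (i : τ) (b : B) :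
    hw.isFormalCoords.lin b i = hv.isFormalCoords.lin b (e i) := by
  rw [IsFormalCoords.lin_apply, IsFormalCoords.lin_apply, ← MvPowerSeries.constantCoeff_pderiv,
    ← MvPowerSeries.constantCoeff_pderiv, ← hv.toPowerSeries_pd, ← hw.toPowerSeries_pd,
    hv.pd_reindex hw e h]
  obtain ⟨c, hc⟩ := hv.residue (hv.pd (e i) b)
  rw [IsFormalCoords.constantCoeff_eq _ (fun b hb => hv.isFormalCoords.toPowerSeries_mem hb) hc,
    IsFormalCoords.constantCoeff_eq _ (fun b hb => hw.isFormalCoords.toPowerSeries_mem hb) hc]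

/-- Reorders the x so that an invertible principal block of the Hessian at the point, of maximal
rank, comes last, and takes for γ the Taylor series of the square root of the determinant. -/
theorem exists_normalForm_CRing [CharP k 2] {m : ℕ} {ι : Type} [Fintype ι]
    {x : ι → B} {y : Fin m → A} (hA : IsEtaleCoords k y)
    (hB : IsEtaleCoords k (Sum.elim x (algebraMap A B ∘ y)))
    (hloc : ∀ a ∈ maximalIdeal A, algebraMap A B a ∈ maximalIdeal B) {Φ : B}
    [Nontrivial (CRing k A Φ m)]
    (hli : LinearIndependent k fun (o : Option ι) (j : Fin m) =>
      hB.isFormalCoords.lin (critEqs hB Φ o) (Sum.inr j))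
    (hreg : IsRegularLocalRing (RRing k A Φ m))
    (hdim : ringKrullDim (RRing k A Φ m) = ((m - 2 : ℕ) : WithBot ℕ∞)) :
    4 ≤ m ∧ ∃ (ρ : A →ₐ[k] TargetRing k (m - 4))
      (j : CRing k A Φ m →ₐ[k] SourceRing k (m - 4)), IsCompletionMap k j ∧
        ∀ a, gammaStar k (m - 4) (ρ a) = j (toCRing k A Φ m (algebraMap A B a)) := by
  classical
  let M : Matrix ι ι k := Matrix.of fun i j => MvPowerSeries.constantCoeff
    (hB.isFormalCoords.toPowerSeries (hB.pd (Sum.inl i) (hB.pd (Sum.inl j) Φ)))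
  have hM : ∀ i j, hB.pd (Sum.inl i) (hB.pd (Sum.inl j) Φ) - algebraMap k B (M i j) ∈
      maximalIdeal B := by
    intro i j
    obtain ⟨c, hc⟩ := hB.residue (hB.pd (Sum.inl i) (hB.pd (Sum.inl j) Φ))
    have : M i j = c := IsFormalCoords.constantCoeff_eq _
      (fun b hb => hB.isFormalCoords.toPowerSeries_mem hb) hc
    rwa [this]
  obtain ⟨c, r, e, T, hdet, hT⟩ := exists_principal_block M (by
    ext i j
    change MvPowerSeries.constantCoeff _ = MvPowerSeries.constantCoeff _
    rw [hB.pd_comm])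
  let e' : (Fin c ⊕ Fin r) ⊕ Fin m ≃ ι ⊕ Fin m := Equiv.sumCongr e (Equiv.refl _)
  have he' : ∀ i, Sum.elim (x ∘ e) (algebraMap A B ∘ y) i =
      Sum.elim x (algebraMap A B ∘ y) (e' i) := by
    rintro (i | j) <;> rfl
  have hB' : IsEtaleCoords k (Sum.elim (x ∘ e) (algebraMap A B ∘ y)) := by
    rw [show Sum.elim (x ∘ e) (algebraMap A B ∘ y) = Sum.elim x (algebraMap A B ∘ y) ∘ e' from
      funext he']
    exact hB.reindex e'
  have hpd : ∀ i, hB'.pd (Sum.inl i) = hB.pd (Sum.inl (e i)) := fun i => hB.pd_reindex hB' e' he' _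
  have hcr : ∀ o : Option (Fin c ⊕ Fin r), critEqs hB' Φ o = critEqs hB Φ (o.map e) := by
    rintro (_ | i)
    · rfl
    · exact DFunLike.congr_fun (hpd i) Φ
  have hli' : LinearIndependent k fun (o : Option (Fin c ⊕ Fin r)) (j : Fin m) =>
      hB'.isFormalCoords.lin (critEqs hB' Φ o) (Sum.inr j) := by
    convert hli.comp _ (Option.map_injective e.injective) using 1
    funext o j
    rw [hcr]
    exact hB.lin_reindex hB' e' he' (Sum.inr j) _
  obtain ⟨n, w, hn, hw⟩ := exists_formalCoords_CRing hA hB' hli'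
  obtain ⟨g, hgm, hg2, hg⟩ := exists_sq_eq_det_hessian hA hB' hli' hreg hdim
  have hC : ∀ a ∈ maximalIdeal B, toCRing k A Φ m a ∈ maximalIdeal (CRing k A Φ m) :=
    fun a ha hu => ha (isUnit_of_map_unit (toCRing k A Φ m) a hu)
  have hd : ∀ b ∈ maximalIdeal (MvPowerSeries (Fin n) k), ∃ a,
      b - hw.toPowerSeries.comp (toCRingₐ k A Φ m) a ∈ maximalIdeal _ ^ 2 := by
    intro b _
    obtain ⟨a, ha⟩ := hw.isCompletionMap.dense 2 b
    obtain ⟨a, rfl⟩ := toCRing_surjective k A Φ m a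
    exact ⟨a, ha⟩
  have hq : ∀ o, hw.toPowerSeries.comp (toCRingₐ k A Φ m) (critEqs hB' Φ o) = 0 := by
    intro o
    change hw.toPowerSeries (toCRing k A Φ m _) = 0
    rw [toCRing_critEqs hA hB' hli', map_zero]
  have hg' : hw.toPowerSeries g ^ 2 = hw.toPowerSeries.comp (toCRingₐ k A Φ m)
      (Matrix.of fun i j => hB'.pd (Sum.inl i) (hB'.pd (Sum.inl j) Φ)).det := by
    change _ = hw.toPowerSeries (toCRing k A Φ m _)
    rw [← map_pow, hg, RingHom.map_det]
    rfl
  obtain ⟨h4, ρ, θ, hθ, hcomm⟩ := exists_normalForm_of_block hn hA hB' hloc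
    (fun o => mem_maximalIdeal_of_toCRing_eq_zero (toCRing_critEqs hA hB' hli' o))
    (LinearIndependent.of_comp (LinearMap.funLeft k k Sum.inr) hli')
    (M := M.submatrix e e) (fun i j => by rw [hpd, hpd]; exact hM _ _) hdet T (fun i l => hT i (e l))
    (hw.toPowerSeries.comp (toCRingₐ k A Φ m)) (fun b hb => hw.toPowerSeries_mem (hC b hb))
    hd hq (γ := hw.toPowerSeries g) (hw.toPowerSeries_mem hgm)
    (fun h => hg2 ((hw.isCompletionMap.mem_iff 2 g).mp h)) hg'
  exact ⟨h4, ρ, θ.comp hw.toPowerSeries, hw.isCompletionMap.comp hθ, hcomm⟩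

end CriticalNormalForm

/-! ### Morphisms of completions given by a normal form -/

section Main

/-- The geometric conclusion from the algebraic normal form. -/
lemma exists_iso_of_normalForm {k A C : Type u} [Field k] [CommRing A] [IsLocalRing A] [Algebra k A]
    [CommRing C] [IsLocalRing C] [Algebra k C] {m r : ℕ} {y : Fin m → A} (hA : IsFormalCoords k y)
    (φ : A →+* C) [IsLocalHom φ] (ρ : A →ₐ[k] TargetRing k r) (j : C →ₐ[k] SourceRing k r)
    (hρ : ∀ a ∈ maximalIdeal A, ρ a ∈ maximalIdeal _)
    (hj : IsCompletionMap k j) (hφ : ∀ a, gammaStar k r (ρ a) = j (φ a)) :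
    ∃ (ι : formalCompletion C ≅ Spec (.of (SourceRing k r)))
      (ψ : Gamma k r ⟶ formalCompletion A),
      ι.hom ≫ Spec.map (CommRingCat.ofHom (algebraMap k (SourceRing k r))) =
        Spec.map (CommRingCat.ofHom (algebraMap k (AdicCompletion (maximalIdeal C) C))) ∧
      ψ ≫ Spec.map (CommRingCat.ofHom (algebraMap k (AdicCompletion (maximalIdeal A) A))) =
        Gamma.str k r ∧
      Spec.map (CommRingCat.ofHom (completionMap φ)) = ι.hom ≫ gammaMap k r ≫ ψ := by
  let eA := hA.isCompletionMap.completionEquiv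
  let eC := hj.completionEquiv
  -- Since ρ is defined on A only, it is extended to the completion by substituting its values on
  -- the coordinates.
  let R : MvPowerSeries (Fin m) k →ₐ[k] TargetRing k r := MvPowerSeries.substAlgHom
    (MvPowerSeries.hasSubst_of_mem fun i => hρ _ (hA.mem i))
  have hR : R.comp hA.toPowerSeries = ρ := by
    refine hA.algHom_ext (fun a ha => ?_) hρ fun i => ?_
    · change R (hA.toPowerSeries a) ∈ _
      exact MvPowerSeries.algHom_mem_maximalIdeal _ (hA.toPowerSeries_mem ha)
    · rw [AlgHom.comp_apply, hA.toPowerSeries_coord]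
      exact MvPowerSeries.substAlgHom_X _ i
  let γ : MvPowerSeries (Fin m) k →ₐ[k] SourceRing k r := (gammaStar k r).comp R
  have hγ : IsLocalHom (γ : MvPowerSeries (Fin m) k →+* SourceRing k r) :=
    ⟨fun a ha => by
      by_contra hu
      exact MvPowerSeries.algHom_mem_maximalIdeal γ hu ha⟩
  have key : ∀ z, gammaStar k r (R (eA z)) = eC (completionMap φ z) := fun z =>
    IsCompletionMap.completionEquiv_completionMap hA.isCompletionMap hj φ
      (γ : MvPowerSeries (Fin m) k →+* SourceRing k r)
      (fun a => by
        rw [← hφ, ← hR]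
        rfl) z
  let q : TargetRing k r →ₐ[k] TargetRing k r ⧸ RingHom.ker (gammaStar k r) := Ideal.Quotient.mkₐ k _
  let Ψ : AdicCompletion (maximalIdeal A) A →ₐ[k] TargetRing k r ⧸ RingHom.ker (gammaStar k r) :=
    q.comp (R.comp eA.toAlgHom)
  let ι : formalCompletion C ≅ Spec (.of (SourceRing k r)) :=
    { hom := Spec.map (CommRingCat.ofHom eC.symm.toAlgHom.toRingHom)
      inv := Spec.map (CommRingCat.ofHom eC.toAlgHom.toRingHom)
      hom_inv_id := by
        rw [← Spec.map_comp, ← Spec.map_id]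
        exact congrArg Spec.map (CommRingCat.hom_ext (RingHom.ext fun z => eC.symm_apply_apply z))
      inv_hom_id := by
        rw [← Spec.map_comp, ← Spec.map_id]
        exact congrArg Spec.map (CommRingCat.hom_ext (RingHom.ext fun z => eC.apply_symm_apply z)) }
  refine ⟨ι, Spec.map (CommRingCat.ofHom Ψ.toRingHom), ?_, ?_, ?_⟩
  · exact (Spec.map_comp _ _).symm.trans (congrArg Spec.map (CommRingCat.hom_ext
      (RingHom.ext fun z => eC.symm.commutes z)))
  · exact (Spec.map_comp _ _).symm.trans (congrArg Spec.map (CommRingCat.hom_ext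
      (RingHom.ext fun z => Ψ.commutes z)))
  · have h1 : Spec.map (CommRingCat.ofHom (completionMap φ)) =
        Spec.map ((CommRingCat.ofHom Ψ.toRingHom ≫ CommRingCat.ofHom
          (RingHom.kerLift (gammaStar k r : TargetRing k r →+* SourceRing k r))) ≫
          CommRingCat.ofHom eC.symm.toAlgHom.toRingHom) := by
      refine congrArg Spec.map (CommRingCat.hom_ext (RingHom.ext fun z => ?_))
      change completionMap φ z = eC.symm (gammaStar k r (R (eA z)))
      rw [key, AlgEquiv.symm_apply_apply]
    rw [h1, Spec.map_comp, Spec.map_comp]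
    rfl

end Main

/-! ### Étale charts of schemes -/

section Charts

variable {k : Type u} [Field k]

lemma toSpecΓ_SpecMap_ΓSpecIso_inv (R : CommRingCat.{u}) :
    (Spec R).toSpecΓ ≫ Spec.map (Scheme.ΓSpecIso R).inv = 𝟙 _ := by
  rw [← SpecMap_ΓSpecIso_hom, ← Spec.map_comp, Iso.inv_hom_id, Spec.map_id]

lemma fromSpecStalk_str {W : Scheme.{u}} (str : W ⟶ Spec (.of k)) (w : W) :
    W.fromSpecStalk w ≫ str = Spec.map (CommRingCat.ofHom (baseToStalk str w)) := by
  rw [baseToStalk, CommRingCat.ofHom_hom, Spec.map_comp, Spec.map_comp, ← Scheme.fromSpecStalk_toSpecΓ,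
    Category.assoc, Category.assoc, ← Scheme.toSpecΓ_naturality_assoc, toSpecΓ_SpecMap_ΓSpecIso_inv,
    Category.comp_id]

/-- An étale morphism from an open neighbourhood of the point `w` to the affine space. -/
structure EtaleChart {W : Scheme.{u}} (str : W ⟶ Spec (.of k)) (w : W) (σ : Type) where
  U : Scheme.{u}
  i : U ⟶ W
  g : U ⟶ Spec (.of (MvPolynomial σ k))
  isOpenImmersion : IsOpenImmersion i
  etale : Etale g
  comm : i ≫ str = g ≫ Spec.map (CommRingCat.ofHom MvPolynomial.C)
  mem : w ∈ Set.range i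

namespace EtaleChart

variable {W : Scheme.{u}} {str : W ⟶ Spec (.of k)} {w : W} {σ : Type} (c : EtaleChart str w σ)

instance : IsOpenImmersion c.i := c.isOpenImmersion

instance : Etale c.g := c.etale

lemma range_fromSpecStalk_subset : Set.range (W.fromSpecStalk w) ⊆ Set.range c.i := by
  rw [Scheme.range_fromSpecStalk]
  intro y hy
  exact hy.mem_open c.i.isOpenEmbedding.isOpen_range c.mem

/-- The germ at `w` as a morphism to the domain of the chart. -/
def lift : Spec (W.presheaf.stalk w) ⟶ c.U :=
  IsOpenImmersion.lift c.i (W.fromSpecStalk w) c.range_fromSpecStalk_subset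

lemma lift_i : c.lift ≫ c.i = W.fromSpecStalk w := IsOpenImmersion.lift_fac _ _ _

/-- The homomorphism from the polynomial ring to the local ring given by a chart. -/
def hom : MvPolynomial σ k →+* W.presheaf.stalk w := (Spec.preimage (c.lift ≫ c.g)).hom

lemma map_hom : Spec.map (CommRingCat.ofHom c.hom) = c.lift ≫ c.g := by
  rw [hom, CommRingCat.ofHom_hom, Spec.map_preimage]

lemma hom_comp_C : c.hom.comp MvPolynomial.C = baseToStalk str w := by
  have : CommRingCat.ofHom (c.hom.comp MvPolynomial.C) = CommRingCat.ofHom (baseToStalk str w) := by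
    apply Spec.map_injective
    rw [CommRingCat.ofHom_comp, Spec.map_comp, map_hom, Category.assoc, ← c.comm, ← Category.assoc,
      lift_i, fromSpecStalk_str]
  exact congrArg CommRingCat.Hom.hom this

/-- On an affine neighbourhood the germ map is an étale ring map followed by a localization. -/
lemma formallyEtale_germ {U : Scheme.{u}} (u : U) {R : CommRingCat.{u}} (g : U ⟶ Spec R) [Etale g] :
    (Spec.preimage (U.fromSpecStalk u ≫ g)).hom.FormallyEtale := by
  obtain ⟨_, ⟨V, hV, rfl⟩, hu, -⟩ := U.isBasis_affineOpens.exists_subset_of_mem_open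
    (Set.mem_univ u) isOpen_univ
  have hV : IsAffineOpen V := hV
  have h1 : Spec.preimage (U.fromSpecStalk u ≫ g) = Spec.preimage (hV.fromSpec ≫ g) ≫
      U.presheaf.germ V u hu := by
    apply Spec.map_injective
    rw [Spec.map_comp, Spec.map_preimage, Spec.map_preimage,
      ← hV.fromSpecStalk_eq_fromSpecStalk hu, IsAffineOpen.fromSpecStalk, Category.assoc]
  have h2 : (Spec.preimage (hV.fromSpec ≫ g)).hom.Etale := by
    rw [← HasRingHomProperty.Spec_iff (P := @Etale), Spec.map_preimage]
    infer_instance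
  have h3 : (U.presheaf.germ V u hu).hom.FormallyEtale := by
    let := (U.presheaf.germ V u hu).hom.toAlgebra
    have := hV.isLocalization_stalk ⟨u, hu⟩
    exact Algebra.FormallyEtale.of_isLocalization (hV.primeIdealOf ⟨u, hu⟩).asIdeal.primeCompl
  rw [h1, CommRingCat.hom_comp]
  exact RingHom.FormallyEtale.comp h2.formallyEtale h3

/-- The stalk map of an open immersion is an isomorphism, which reduces the claim to a point of U.
-/
lemma formallyEtale_of_lift {U W : Scheme.{u}} {w : W} {R : CommRingCat.{u}} (i : U ⟶ W)
    [IsOpenImmersion i] (g : U ⟶ Spec R) [Etale g] {u : U} (hu : i u = w)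
    {l : Spec (W.presheaf.stalk w) ⟶ U} (hl : l ≫ i = W.fromSpecStalk w) :
    (Spec.preimage (l ≫ g)).hom.FormallyEtale := by
  subst hu
  have h1 : l = Spec.map (inv (i.stalkMap u)) ≫ U.fromSpecStalk u := by
    rw [← cancel_mono i, hl, Category.assoc, ← Scheme.SpecMap_stalkMap_fromSpecStalk,
      ← Spec.map_comp_assoc, IsIso.hom_inv_id, Spec.map_id, Category.id_comp]
  have h2 : Spec.preimage (l ≫ g) = Spec.preimage (U.fromSpecStalk u ≫ g) ≫
      inv (i.stalkMap u) := by
    apply Spec.map_injective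
    rw [Spec.map_comp, Spec.map_preimage, Spec.map_preimage, h1, Category.assoc]
  rw [h2, CommRingCat.hom_comp]
  refine RingHom.FormallyEtale.comp (formallyEtale_germ u g) ?_
  exact (RingHom.Etale.of_bijective
    (ConcreteCategory.bijective_of_isIso (inv (i.stalkMap u)))).formallyEtale

lemma formallyEtale_hom : c.hom.FormallyEtale :=
  formallyEtale_of_lift c.i c.g c.mem.choose_spec c.lift_i

end EtaleChart

lemma isPushout_mvPolynomial (k : Type u) [Field k] (σ τ : Type) :
    IsPushout (CommRingCat.ofHom (MvPolynomial.C : k →+* MvPolynomial σ k))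
      (CommRingCat.ofHom (MvPolynomial.C : k →+* MvPolynomial τ k))
      (CommRingCat.ofHom (MvPolynomial.rename (R := k) (Sum.inl : σ → σ ⊕ τ)).toRingHom)
      (CommRingCat.ofHom (MvPolynomial.rename (R := k) (Sum.inr : τ → σ ⊕ τ)).toRingHom) := by
  have w : CommRingCat.ofHom (MvPolynomial.C : k →+* MvPolynomial σ k) ≫
      CommRingCat.ofHom (MvPolynomial.rename (R := k) (Sum.inl : σ → σ ⊕ τ)).toRingHom =
      CommRingCat.ofHom (MvPolynomial.C : k →+* MvPolynomial τ k) ≫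
      CommRingCat.ofHom (MvPolynomial.rename (R := k) (Sum.inr : τ → σ ⊕ τ)).toRingHom := by
    ext a
    simp
  refine ⟨⟨w⟩, ⟨Limits.PushoutCocone.IsColimit.mk w
    (fun s => CommRingCat.ofHom (MvPolynomial.eval₂Hom
      (s.inl.hom.comp (MvPolynomial.C : k →+* MvPolynomial σ k))
      (Sum.elim (fun i => s.inl (MvPolynomial.X i : MvPolynomial σ k))
        fun i => s.inr (MvPolynomial.X i : MvPolynomial τ k))))
    (fun s => ?_) (fun s => ?_) fun s f h₁ h₂ => ?_⟩⟩
  · refine CommRingCat.hom_ext (MvPolynomial.ringHom_ext (fun a => ?_) fun i => ?_)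
    · simp
    · simp
  · have h := fun a => congrArg (fun f => f.hom a) s.condition
    refine CommRingCat.hom_ext (MvPolynomial.ringHom_ext (fun a => ?_) fun i => ?_)
    · simpa using h a
    · simp
  · refine CommRingCat.hom_ext (MvPolynomial.ringHom_ext (fun a => ?_) fun i => ?_)
    · have h := congrArg (fun f => f.hom (MvPolynomial.C a)) h₁
      simpa using h
    · rcases i with i | i
      · have h := congrArg (fun f => f.hom (MvPolynomial.X i)) h₁
        simpa using h
      · have h := congrArg (fun f => f.hom (MvPolynomial.X i)) h₂
        simpa using h

/-! ### Products of étale charts -/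

section Product

open Limits

variable {X Y : Scheme.{u}} {sX : X ⟶ Spec (.of k)} {sY : Y ⟶ Spec (.of k)} {P : ↥(pullback sX sY)}
  {σ τ : Type} (cX : EtaleChart sX (pullback.fst sX sY P) σ)
  (cY : EtaleChart sY (pullback.snd sX sY P) τ)

/-- The morphism to the product of affine spaces. -/
def EtaleChart.prodMap : pullback (cX.i ≫ sX) (cY.i ≫ sY) ⟶
    pullback (Spec.map (CommRingCat.ofHom (MvPolynomial.C : k →+* MvPolynomial σ k)))
      (Spec.map (CommRingCat.ofHom (MvPolynomial.C : k →+* MvPolynomial τ k))) :=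
  pullback.map _ _ _ _ cX.g cY.g (𝟙 _) (by rw [Category.comp_id, cX.comm])
    (by rw [Category.comp_id, cY.comm])

/-- The product of affine spaces is an affine space. -/
def mvPolynomialPullbackIso (k : Type u) [Field k] (σ τ : Type) :
    Spec (.of (MvPolynomial (σ ⊕ τ) k)) ≅
    pullback (Spec.map (CommRingCat.ofHom (MvPolynomial.C : k →+* MvPolynomial σ k)))
      (Spec.map (CommRingCat.ofHom (MvPolynomial.C : k →+* MvPolynomial τ k))) :=
  (isPullback_SpecMap_of_isPushout _ _ _ _ (isPushout_mvPolynomial k σ τ)).isoPullback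

lemma mvPolynomialPullbackIso_inv_inl : (mvPolynomialPullbackIso k σ τ).inv ≫ Spec.map
    (CommRingCat.ofHom (MvPolynomial.rename (R := k) (Sum.inl : σ → σ ⊕ τ)).toRingHom) =
      pullback.fst _ _ :=
  IsPullback.isoPullback_inv_fst _

lemma mvPolynomialPullbackIso_inv_inr : (mvPolynomialPullbackIso k σ τ).inv ≫ Spec.map
    (CommRingCat.ofHom (MvPolynomial.rename (R := k) (Sum.inr : τ → σ ⊕ τ)).toRingHom) =
      pullback.snd _ _ :=
  IsPullback.isoPullback_inv_snd _

/-- The product of two étale charts. -/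
def EtaleChart.prod : EtaleChart (pullback.fst sX sY ≫ sX) P (σ ⊕ τ) where
  U := pullback (cX.i ≫ sX) (cY.i ≫ sY)
  i := pullback.map _ _ _ _ cX.i cY.i (𝟙 _) (Category.comp_id _) (Category.comp_id _)
  g := EtaleChart.prodMap cX cY ≫ (mvPolynomialPullbackIso k σ τ).inv
  isOpenImmersion := inferInstance
  etale := by
    have : Etale (EtaleChart.prodMap cX cY) := by
      have : MorphismProperty.IsMultiplicative (C := Scheme.{u}) @Etale := inferInstance
      have : MorphismProperty.IsStableUnderComposition (C := Scheme.{u}) @Etale :=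
        this.toIsStableUnderComposition
      exact MorphismProperty.pullbackMap (P := @Etale) cX.etale cY.etale cX.comm cY.comm
    infer_instance
  comm := by
    have h : CommRingCat.ofHom (MvPolynomial.C : k →+* MvPolynomial (σ ⊕ τ) k) =
        CommRingCat.ofHom (MvPolynomial.C : k →+* MvPolynomial σ k) ≫ CommRingCat.ofHom
          (MvPolynomial.rename (R := k) (Sum.inl : σ → σ ⊕ τ)).toRingHom := by
      ext a
      simp
    rw [h, Spec.map_comp, Category.assoc, ← Category.assoc _ (Spec.map _) (Spec.map _),
      mvPolynomialPullbackIso_inv_inl, prodMap, pullback.lift_fst_assoc, pullback.lift_fst_assoc,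
      Category.assoc, Category.assoc]
    exact congrArg (pullback.fst (cX.i ≫ sX) (cY.i ≫ sY) ≫ ·) cX.comm
  mem := by
    rw [Scheme.Pullback.range_map]
    exact ⟨cX.mem, cY.mem⟩

namespace EtaleChart

/-- The projection from the product of two charts to the first factor. -/
def prodFst : (prod cX cY).U ⟶ cX.U := pullback.fst (cX.i ≫ sX) (cY.i ≫ sY)

/-- The projection from the product of two charts to the second factor. -/
def prodSnd : (prod cX cY).U ⟶ cY.U := pullback.snd (cX.i ≫ sX) (cY.i ≫ sY)

lemma prodFst_i : prodFst cX cY ≫ cX.i = (prod cX cY).i ≫ pullback.fst sX sY :=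
  (pullback.lift_fst _ _ _).symm

lemma prodSnd_i : prodSnd cX cY ≫ cY.i = (prod cX cY).i ≫ pullback.snd sX sY :=
  (pullback.lift_snd _ _ _).symm

lemma prod_g_inl : (prod cX cY).g ≫ Spec.map
    (CommRingCat.ofHom (MvPolynomial.rename (R := k) (Sum.inl : σ → σ ⊕ τ)).toRingHom) =
      prodFst cX cY ≫ cX.g := by
  change (prodMap cX cY ≫ (mvPolynomialPullbackIso k σ τ).inv) ≫ _ = _
  rw [Category.assoc, mvPolynomialPullbackIso_inv_inl]
  exact pullback.lift_fst _ _ _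

lemma prod_g_inr : (prod cX cY).g ≫ Spec.map
    (CommRingCat.ofHom (MvPolynomial.rename (R := k) (Sum.inr : τ → σ ⊕ τ)).toRingHom) =
      prodSnd cX cY ≫ cY.g := by
  change (prodMap cX cY ≫ (mvPolynomialPullbackIso k σ τ).inv) ≫ _ = _
  rw [Category.assoc, mvPolynomialPullbackIso_inv_inr]
  exact pullback.lift_snd _ _ _

/-- The coordinates of the product chart are pulled back from the factors; this separates the x from
the y. -/
lemma prod_hom_inl (i : σ) : (prod cX cY).hom (MvPolynomial.X (Sum.inl i)) =
    ((pullback.fst sX sY).stalkMap P).hom (cX.hom (MvPolynomial.X i)) := by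
  have h1 : (prod cX cY).lift ≫ prodFst cX cY =
      Spec.map ((pullback.fst sX sY).stalkMap P) ≫ cX.lift := by
    rw [← cancel_mono cX.i, Category.assoc, Category.assoc, lift_i, prodFst_i,
      Scheme.SpecMap_stalkMap_fromSpecStalk, ← (prod cX cY).lift_i, Category.assoc]
  have h2 : CommRingCat.ofHom (MvPolynomial.rename (R := k) (Sum.inl : σ → σ ⊕ τ)).toRingHom ≫
      CommRingCat.ofHom (prod cX cY).hom =
      CommRingCat.ofHom cX.hom ≫ (pullback.fst sX sY).stalkMap P := by
    apply Spec.map_injective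
    rw [Spec.map_comp, Spec.map_comp, map_hom, map_hom, Category.assoc, prod_g_inl, ← Category.assoc,
      h1, Category.assoc]
  have h3 := congrArg (fun f => f.hom (MvPolynomial.X i)) h2
  simpa using h3

lemma prod_hom_inr (i : τ) : (prod cX cY).hom (MvPolynomial.X (Sum.inr i)) =
    ((pullback.snd sX sY).stalkMap P).hom (cY.hom (MvPolynomial.X i)) := by
  have h1 : (prod cX cY).lift ≫ prodSnd cX cY =
      Spec.map ((pullback.snd sX sY).stalkMap P) ≫ cY.lift := by
    rw [← cancel_mono cY.i, Category.assoc, Category.assoc, lift_i, prodSnd_i,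
      Scheme.SpecMap_stalkMap_fromSpecStalk, ← (prod cX cY).lift_i, Category.assoc]
  have h2 : CommRingCat.ofHom (MvPolynomial.rename (R := k) (Sum.inr : τ → σ ⊕ τ)).toRingHom ≫
      CommRingCat.ofHom (prod cX cY).hom =
      CommRingCat.ofHom cY.hom ≫ (pullback.snd sX sY).stalkMap P := by
    apply Spec.map_injective
    rw [Spec.map_comp, Spec.map_comp, map_hom, map_hom, Category.assoc, prod_g_inr, ← Category.assoc,
      h1, Category.assoc]
  have h3 := congrArg (fun f => f.hom (MvPolynomial.X i)) h2
  simpa using h3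

end EtaleChart

end Product

end Charts

/-! ### Existence of étale charts -/

section ShiftCoords

variable {k : Type u} [Field k] {B : Type u} [CommRing B] [IsLocalRing B] [Algebra k B] {σ : Type}

/-- Recentring at the point is composition with a translation of affine space, an automorphism of
the polynomial ring. -/
lemma isEtaleCoords_sub_algebraMap {φ : MvPolynomial σ k →+* B} (hφ : φ.FormallyEtale)
    (hC : φ.comp MvPolynomial.C = algebraMap k B)
    (hres : ∀ b : B, ∃ c : k, b - algebraMap k B c ∈ maximalIdeal B) {c : σ → k}
    (hc : ∀ i, φ (MvPolynomial.X i) - algebraMap k B (c i) ∈ maximalIdeal B) :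
    IsEtaleCoords k fun i => φ (MvPolynomial.X i) - algebraMap k B (c i) := by
  refine ⟨hc, hres, ?_⟩
  let s : MvPolynomial σ k →ₐ[k] MvPolynomial σ k :=
    MvPolynomial.aeval fun i => MvPolynomial.X i - MvPolynomial.C (c i)
  let t : MvPolynomial σ k →ₐ[k] MvPolynomial σ k :=
    MvPolynomial.aeval fun i => MvPolynomial.X i + MvPolynomial.C (c i)
  have hst : s.comp t = AlgHom.id k _ := by
    ext i
    simp [s, t]
  have hts : t.comp s = AlgHom.id k _ := by
    ext i
    simp [s, t]
  have hC' := fun a => congrArg (fun f => f a) hC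
  have h : (MvPolynomial.aeval fun i => φ (MvPolynomial.X i) - algebraMap k B (c i) :
      MvPolynomial σ k →ₐ[k] B).toRingHom = φ.comp (AlgEquiv.ofAlgHom s t hst hts).toRingHom := by
    refine MvPolynomial.ringHom_ext (fun a => ?_) fun i => ?_
    · simpa [s] using (hC' a).symm
    · have := hC' (c i)
      simp only [RingHom.comp_apply] at this
      simp [s, this]
  rw [h]
  exact RingHom.FormallyEtale.comp
    (RingHom.Etale.of_bijective (AlgEquiv.ofAlgHom s t hst hts).bijective).formallyEtale hφ

end ShiftCoords

/-! ### Étale charts at smooth points -/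

section SmoothChart

variable {k : Type u} [Field k]

/-- An étale chart of an open subscheme. -/
def EtaleChart.ofOpen {W Z : Scheme.{u}} {str : W ⟶ Spec (.of k)} {z : Z} {σ : Type} (j : Z ⟶ W)
    [IsOpenImmersion j] (c : EtaleChart (j ≫ str) z σ) : EtaleChart str (j z) σ where
  U := c.U
  i := c.i ≫ j
  g := c.g
  isOpenImmersion := inferInstance
  etale := c.etale
  comm := by rw [Category.assoc, c.comm]
  mem := by
    obtain ⟨y, hy⟩ := c.mem
    exact ⟨y, by rw [Scheme.Hom.comp_apply, hy]⟩

lemma exists_etaleChart_of_smooth {W : Scheme.{u}} (str : W ⟶ Spec (.of k)) [Smooth str] (w : W) :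
    ∃ n : ℕ, Nonempty (EtaleChart str w (Fin n)) := by
  obtain ⟨V, hV, V', hV', hw', e, h⟩ := Smooth.exists_isStandardSmooth str w
  -- The spectrum of a field has only one point.
  obtain rfl : V = ⊤ := by
    have hV : str w ∈ V := e hw'
    ext y
    simp only [TopologicalSpace.Opens.coe_top, Set.mem_univ, iff_true, SetLike.mem_coe]
    rwa [Subsingleton.elim y (str w)]
  have h' : ((Scheme.ΓSpecIso (.of k)).inv ≫ str.appLE ⊤ V' e).hom.IsStandardSmooth := by
    rw [CommRingCat.hom_comp]
    exact RingHom.IsStandardSmooth.comp h (RingHom.IsStandardSmoothOfRelativeDimension.equiv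
      (Scheme.ΓSpecIso (.of k)).symm.commRingCatIsoToRingEquiv).isStandardSmooth
  obtain ⟨n, g, hg, hg'⟩ := h'.exists_etale_mvPolynomial
  refine ⟨n, ⟨?_⟩⟩
  exact
  { U := Spec Γ(W, V')
    i := hV'.fromSpec
    g := Spec.map (CommRingCat.ofHom g)
    isOpenImmersion := inferInstance
    etale := HasRingHomProperty.Spec_iff.mpr hg'
    comm := by
      rw [← Spec.map_comp, ← CommRingCat.ofHom_comp, hg, CommRingCat.ofHom_hom, Spec.map_comp,
        ← IsAffineOpen.SpecMap_appLE_fromSpec str hV hV' e]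
      congr 1
      rw [IsAffineOpen.fromSpec_top, Scheme.isoSpec_Spec_inv]
    mem := by
      rw [hV'.range_fromSpec]
      exact hw' }

lemma exists_etaleChart_of_smooth_ι {W : Scheme.{u}} (str : W ⟶ Spec (.of k)) {w : W} {U : W.Opens}
    (hw : w ∈ U) [Smooth (U.ι ≫ str)] : ∃ n : ℕ, Nonempty (EtaleChart str w (Fin n)) := by
  obtain ⟨n, ⟨c⟩⟩ := exists_etaleChart_of_smooth (U.ι ≫ str) (⟨w, hw⟩ : U.toScheme)
  exact ⟨n, ⟨c.ofOpen U.ι⟩⟩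

end SmoothChart

/-! ### Standard affine charts of projective space -/

section ProjectiveChart

attribute [local instance] MvPolynomial.gradedAlgebra

variable (k : Type u) [Field k] {m : ℕ} (j : Fin (m + 1))

/-- The quotient of two homogeneous coordinates on the affine chart. -/
def awayRatio (i : Fin (m + 1)) : HomogeneousLocalization.Away
    (MvPolynomial.homogeneousSubmodule (Fin (m + 1)) k) (MvPolynomial.X j) :=
  HomogeneousLocalization.mk
    { deg := 1
      num := ⟨MvPolynomial.X i, MvPolynomial.isHomogeneous_X k i⟩
      den := ⟨MvPolynomial.X j, MvPolynomial.isHomogeneous_X k j⟩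
      den_mem := Submonoid.mem_powers _ }

/-- The identification of the affine chart of the projective space with the affine space. -/
def mvPolynomialToAway : MvPolynomial (Fin m) k →+* HomogeneousLocalization.Away
    (MvPolynomial.homogeneousSubmodule (Fin (m + 1)) k) (MvPolynomial.X j) :=
  MvPolynomial.eval₂Hom ((HomogeneousLocalization.fromZeroRingHom
    (MvPolynomial.homogeneousSubmodule (Fin (m + 1)) k) _).comp
      (algebraMap k (MvPolynomial.homogeneousSubmodule (Fin (m + 1)) k 0)))
    fun i => awayRatio k j (j.succAbove i)

variable {k j}

lemma val_awayRatio (i : Fin (m + 1)) : (awayRatio k j i).val =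
    Localization.mk (MvPolynomial.X i) ⟨MvPolynomial.X j, Submonoid.mem_powers _⟩ := rfl

lemma val_mvPolynomialToAway_C (a : k) : (mvPolynomialToAway k j (MvPolynomial.C a)).val =
    algebraMap (MvPolynomial (Fin (m + 1)) k) _ (MvPolynomial.C a) := by
  rw [mvPolynomialToAway, MvPolynomial.coe_eval₂Hom, MvPolynomial.eval₂_C, RingHom.comp_apply]
  rw [← Localization.mk_one_eq_algebraMap]
  rfl

lemma mvPolynomialToAway_C (a : k) : mvPolynomialToAway k j (MvPolynomial.C a) =
    HomogeneousLocalization.fromZeroRingHom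
      (MvPolynomial.homogeneousSubmodule (Fin (m + 1)) k) _
      (algebraMap k (MvPolynomial.homogeneousSubmodule (Fin (m + 1)) k 0) a) :=
  MvPolynomial.eval₂_C ..

lemma mvPolynomialToAway_X (i : Fin m) :
    mvPolynomialToAway k j (MvPolynomial.X i) = awayRatio k j (j.succAbove i) :=
  MvPolynomial.eval₂_X ..

/-- Setting the coordinate j equal to 1 is a left inverse. -/
lemma mvPolynomialToAway_injective : Function.Injective (mvPolynomialToAway k j) := by
  let ev : MvPolynomial (Fin (m + 1)) k →+* MvPolynomial (Fin m) k :=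
    (MvPolynomial.aeval (R := k) (j.insertNth 1 MvPolynomial.X)).toRingHom
  have hev : ∀ y : Submonoid.powers (MvPolynomial.X j : MvPolynomial (Fin (m + 1)) k),
      IsUnit (ev y) := by
    rintro ⟨_, n, rfl⟩
    simp [ev]
  let g := IsLocalization.lift (S := Localization
    (Submonoid.powers (MvPolynomial.X j : MvPolynomial (Fin (m + 1)) k))) hev
  have h : (g.comp (algebraMap (HomogeneousLocalization.Away
      (MvPolynomial.homogeneousSubmodule (Fin (m + 1)) k) (MvPolynomial.X j))
      (Localization (Submonoid.powers (MvPolynomial.X j))))).comp (mvPolynomialToAway k j) =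
        RingHom.id _ := by
    refine MvPolynomial.ringHom_ext (fun a => ?_) fun i => ?_
    · simp only [RingHom.comp_apply, HomogeneousLocalization.algebraMap_apply,
        val_mvPolynomialToAway_C, RingHom.id_apply]
      rw [IsLocalization.lift_eq]
      simp [ev]
    · simp only [RingHom.comp_apply, HomogeneousLocalization.algebraMap_apply,
        mvPolynomialToAway_X, RingHom.id_apply, val_awayRatio, Localization.mk_eq_mk']
      rw [IsLocalization.lift_mk'_spec]
      simp [ev]
  intro x y hxy
  have h' := fun x => congrArg (fun f => f x) h
  exact (h' x).symm.trans ((congrArg (g.comp (algebraMap _ _)) hxy).trans (h' y))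

lemma eval₂_mul_of_isHomogeneous {ι R T : Type*} [Fintype ι] [CommSemiring R] [CommSemiring T]
    (f : R →+* T) (g : ι → T) (t : T) {a : MvPolynomial ι R} {n : ℕ} (ha : a.IsHomogeneous n) :
    MvPolynomial.eval₂ f (fun i => t * g i) a = t ^ n * MvPolynomial.eval₂ f g a := by
  rw [MvPolynomial.eval₂_eq', MvPolynomial.eval₂_eq', Finset.mul_sum]
  refine Finset.sum_congr rfl fun d hd => ?_
  have h : ∑ i, d i = n := by
    rw [← ha (MvPolynomial.mem_support_iff.mp hd), Finsupp.weight_apply,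
      Finsupp.sum_fintype _ _ (by simp)]
    simp
  rw [← h, ← Finset.prod_pow_eq_pow_sum, mul_left_comm, ← Finset.prod_mul_distrib]
  simp_rw [mul_pow]

/-- Dehomogenizing and mapping back evaluates a polynomial at the ratios of the coordinates to the
j-th one. For homogeneous a this yields a over a power of that coordinate, hence surjectivity. -/
lemma val_mvPolynomialToAway_aeval (a : MvPolynomial (Fin (m + 1)) k) :
    (mvPolynomialToAway k j (MvPolynomial.aeval (R := k) (j.insertNth 1 MvPolynomial.X) a)).val =
      MvPolynomial.eval₂ ((algebraMap (MvPolynomial (Fin (m + 1)) k) (Localization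
          (Submonoid.powers (MvPolynomial.X j)))).comp MvPolynomial.C)
        (fun i => Localization.mk (1 : MvPolynomial (Fin (m + 1)) k)
          (⟨MvPolynomial.X j, Submonoid.mem_powers _⟩ : Submonoid.powers (MvPolynomial.X j)) *
          algebraMap (MvPolynomial (Fin (m + 1)) k) (Localization
          (Submonoid.powers (MvPolynomial.X j))) (MvPolynomial.X i)) a := by
  induction a using MvPolynomial.induction_on with
  | C a =>
    rw [MvPolynomial.aeval_C, MvPolynomial.eval₂_C]
    exact val_mvPolynomialToAway_C a
  | add p q hp hq =>
    rw [map_add, map_add, HomogeneousLocalization.val_add, hp, hq, MvPolynomial.eval₂_add]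
  | mul_X p i hp =>
    rw [map_mul, map_mul, HomogeneousLocalization.val_mul, hp, MvPolynomial.eval₂_mul,
      MvPolynomial.aeval_X, MvPolynomial.eval₂_X]
    congr 1
    rw [← Localization.mk_one_eq_algebraMap, Localization.mk_mul, one_mul, mul_one]
    obtain rfl | ⟨i, rfl⟩ := j.eq_self_or_eq_succAbove i
    · rw [Fin.insertNth_apply_same, map_one, HomogeneousLocalization.val_one]
      exact (Localization.mk_self ⟨MvPolynomial.X i, Submonoid.mem_powers _⟩).symm
    · rw [Fin.insertNth_apply_succAbove, mvPolynomialToAway_X, val_awayRatio]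

lemma mvPolynomialToAway_surjective : Function.Surjective (mvPolynomialToAway k j) := by
  intro x
  obtain ⟨⟨n, ⟨a, ha⟩, ⟨b, hb⟩, l, hl⟩, rfl⟩ := HomogeneousLocalization.mk_surjective x
  obtain rfl : MvPolynomial.X j ^ l = b := hl
  obtain rfl : l = n := by
    have h := (MvPolynomial.isHomogeneous_X k j).pow l
    rw [one_mul] at h
    exact h.inj_right hb (pow_ne_zero _ (MvPolynomial.X_ne_zero j))
  refine ⟨MvPolynomial.aeval (R := k) (j.insertNth 1 MvPolynomial.X) a, ?_⟩
  apply HomogeneousLocalization.val_injective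
  rw [val_mvPolynomialToAway_aeval, eval₂_mul_of_isHomogeneous _ _ _ ha,
    HomogeneousLocalization.val_mk]
  have h : MvPolynomial.eval₂ ((algebraMap (MvPolynomial (Fin (m + 1)) k) (Localization
      (Submonoid.powers (MvPolynomial.X j : MvPolynomial (Fin (m + 1)) k)))).comp MvPolynomial.C)
        (fun i => algebraMap (MvPolynomial (Fin (m + 1)) k) (Localization
          (Submonoid.powers (MvPolynomial.X j : MvPolynomial (Fin (m + 1)) k))) (MvPolynomial.X i)) a =
        algebraMap (MvPolynomial (Fin (m + 1)) k) (Localization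
          (Submonoid.powers (MvPolynomial.X j : MvPolynomial (Fin (m + 1)) k))) a := by
    have h := MvPolynomial.eval₂_comp_left (algebraMap (MvPolynomial (Fin (m + 1)) k) (Localization
      (Submonoid.powers (MvPolynomial.X j : MvPolynomial (Fin (m + 1)) k)))) MvPolynomial.C
      MvPolynomial.X a
    rw [MvPolynomial.eval₂_eta] at h
    exact h.symm
  rw [h, Localization.mk_pow, one_pow, ← Localization.mk_one_eq_algebraMap, Localization.mk_mul,
    one_mul, mul_one]
  rfl

variable (k j) in
lemma X_mem_homogeneousSubmodule_one : (MvPolynomial.X j : MvPolynomial (Fin (m + 1)) k) ∈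
    MvPolynomial.homogeneousSubmodule (Fin (m + 1)) k 1 :=
  MvPolynomial.isHomogeneous_X k j

lemma PSpace.CoordNe.mem_basicOpen {y : PSpace k m} (hj : PSpace.CoordNe y j) :
    y ∈ Proj.basicOpen (MvPolynomial.homogeneousSubmodule (Fin (m + 1)) k) (MvPolynomial.X j) :=
  hj

/-- The affine chart of the projective space. -/
def PSpace.chart {y : PSpace k m} (hj : PSpace.CoordNe y j) :
    EtaleChart (PSpace.str k m) y (Fin m) where
  U := Spec (.of (HomogeneousLocalization.Away
    (MvPolynomial.homogeneousSubmodule (Fin (m + 1)) k) (MvPolynomial.X j)))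
  i := Proj.awayι _ (MvPolynomial.X j) (X_mem_homogeneousSubmodule_one k j) one_pos
  g := Spec.map (CommRingCat.ofHom (mvPolynomialToAway k j))
  isOpenImmersion := inferInstance
  etale := HasRingHomProperty.Spec_iff.mpr
    (RingHom.Etale.of_bijective ⟨mvPolynomialToAway_injective, mvPolynomialToAway_surjective⟩)
  comm := by
    rw [PSpace.str, Proj.awayι_toSpecZero_assoc, ← Spec.map_comp, ← Spec.map_comp,
      ← CommRingCat.ofHom_comp, ← CommRingCat.ofHom_comp]
    congr 2
    ext a
    exact congrArg HomogeneousLocalization.val (mvPolynomialToAway_C a).symm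
  mem := (Proj.opensRange_awayι (MvPolynomial.homogeneousSubmodule (Fin (m + 1)) k) _
    (X_mem_homogeneousSubmodule_one k j) one_pos).ge hj.mem_basicOpen

lemma PSpace.SpecMap_germ_awayι {y : PSpace k m} (hj : PSpace.CoordNe y j) :
    Spec.map (Proj.awayToSection (MvPolynomial.homogeneousSubmodule (Fin (m + 1)) k)
      (MvPolynomial.X j) ≫ (PSpace k m).presheaf.germ _ y hj.mem_basicOpen) ≫
      Proj.awayι _ (MvPolynomial.X j) (X_mem_homogeneousSubmodule_one k j) one_pos =
        (PSpace k m).fromSpecStalk y := by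
  have h : (Proj.basicOpen (MvPolynomial.homogeneousSubmodule (Fin (m + 1)) k)
      (MvPolynomial.X j)).toSpecΓ ≫ Spec.map (Proj.awayToSection
        (MvPolynomial.homogeneousSubmodule (Fin (m + 1)) k) (MvPolynomial.X j)) =
      (Proj.basicOpenIsoSpec _ _ (X_mem_homogeneousSubmodule_one k j) one_pos).hom :=
    (Proj.basicOpenIsoSpec_hom _ _ _ _).symm
  rw [Spec.map_comp, ← Scheme.Opens.fromSpecStalkOfMem_toSpecΓ, Category.assoc, Category.assoc,
    ← Proj.basicOpenIsoSpec_inv_ι, ← Category.assoc (Scheme.Opens.toSpecΓ _) (Spec.map _), h,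
    Iso.hom_inv_id_assoc, Scheme.Opens.fromSpecStalkOfMem_ι]

/-- Links the abstract chart to the ratios that occur in the equation of the universal divisor. -/
lemma PSpace.chart_hom_X {y : PSpace k m} (hj : PSpace.CoordNe y j) (i : Fin m) :
    (PSpace.chart hj).hom (MvPolynomial.X i) = PSpace.coordRatio y (j.succAbove i) j hj := by
  have h1 : (PSpace.chart hj).lift =
      Spec.map (Proj.awayToSection (MvPolynomial.homogeneousSubmodule (Fin (m + 1)) k)
        (MvPolynomial.X j) ≫ (PSpace k m).presheaf.germ _ y hj.mem_basicOpen) :=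
    (cancel_mono (PSpace.chart hj).i).mp
      ((PSpace.chart hj).lift_i.trans (PSpace.SpecMap_germ_awayι hj).symm)
  have h2 : CommRingCat.ofHom (PSpace.chart hj).hom =
      CommRingCat.ofHom (mvPolynomialToAway k j) ≫
      Proj.awayToSection (MvPolynomial.homogeneousSubmodule (Fin (m + 1)) k)
        (MvPolynomial.X j) ≫ (PSpace k m).presheaf.germ _ y hj.mem_basicOpen := by
    apply Spec.map_injective
    rw [EtaleChart.map_hom, Spec.map_comp (CommRingCat.ofHom _)]
    exact congrArg (· ≫ (PSpace.chart hj).g) h1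
  have h3 : Proj.awayToSection (MvPolynomial.homogeneousSubmodule (Fin (m + 1)) k)
        (MvPolynomial.X j) ≫ (PSpace k m).presheaf.germ _ y hj.mem_basicOpen = _ :=
    ProjectiveSpectrum.Proj.awayToSection_germ _ _ _ hj.mem_basicOpen
  rw [h3] at h2
  refine (congrArg (fun f => f.hom (MvPolynomial.X i)) h2).trans ?_
  change (Proj.stalkIso' _ y).symm (HomogeneousLocalization.mapId _
    (Submonoid.powers_le.mpr hj) (mvPolynomialToAway k j (MvPolynomial.X i))) = _
  rw [mvPolynomialToAway_X]
  rfl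

lemma PSpace.coordRatio_self {y : PSpace k m} (hj : PSpace.CoordNe y j) :
    PSpace.coordRatio y j j hj = 1 := by
  refine (congrArg (Proj.stalkIso (MvPolynomial.homogeneousSubmodule (Fin (m + 1)) k) y).inv.hom
    ?_).trans (map_one _)
  apply HomogeneousLocalization.val_injective
  rw [HomogeneousLocalization.val_mk, HomogeneousLocalization.val_one]
  exact Localization.mk_self ⟨MvPolynomial.X j, hj⟩

end ProjectiveChart

/-! ### Residue fields and compatibilities of the local rings -/

section FiniteType

attribute [local instance] MvPolynomial.gradedAlgebra

variable (k : Type u) [Field k] (m : ℕ)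

instance : LocallyOfFiniteType (PSpace.str k m) := by
  have : IsScalarTower k (MvPolynomial.homogeneousSubmodule (Fin (m + 1)) k 0)
      (MvPolynomial (Fin (m + 1)) k) := ⟨fun a b c => smul_mul_assoc a b.1 c⟩
  have : Algebra.FiniteType (MvPolynomial.homogeneousSubmodule (Fin (m + 1)) k 0)
      (MvPolynomial (Fin (m + 1)) k) := .of_restrictScalars_finiteType k _ _
  have h : Function.Surjective
      (algebraMap k (MvPolynomial.homogeneousSubmodule (Fin (m + 1)) k 0)) := by
    rintro ⟨p, hp⟩
    have hp : p.IsHomogeneous 0 := hp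
    have h := MvPolynomial.totalDegree_eq_zero_iff_eq_C.mp
      (Nat.le_zero.mp hp.totalDegree_le)
    exact ⟨p.coeff 0, Subtype.ext h.symm⟩
  have : LocallyOfFiniteType (Spec.map (CommRingCat.ofHom
      (algebraMap k (MvPolynomial.homogeneousSubmodule (Fin (m + 1)) k 0)))) :=
    HasRingHomProperty.Spec_iff.mpr (RingHom.FiniteType.of_surjective _ h)
  rw [PSpace.str]
  infer_instance

variable {k}

lemma IsProjective.locallyOfFiniteType {X : Scheme.{u}} {str : X ⟶ Spec (.of k)}
    (h : IsProjective str) : LocallyOfFiniteType str := by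
  obtain ⟨N, i, hi, rfl⟩ := h
  infer_instance

end FiniteType

/-! ### Constants in local rings -/

section BaseToStalk

variable {k : Type u} [Field k]

/-- Nullstellensatz: the residue field at a closed point is k. -/
lemma exists_sub_baseToStalk_mem [IsAlgClosed k] {W : Scheme.{u}} (str : W ⟶ Spec (.of k))
    [LocallyOfFiniteType str] {w : W} (hw : IsClosed {w}) (b : W.presheaf.stalk w) :
    ∃ c : k, b - baseToStalk str w c ∈ maximalIdeal (W.presheaf.stalk w) := by
  have h : CommRingCat.ofHom (baseToStalk str w) ≫ W.residue w =
      (residueFieldIsoBase str w hw).inv := by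
    apply Spec.map_injective
    rw [SpecMap_residueFieldIsoBase_inv, Spec.map_comp, ← fromSpecStalk_str]
    rfl
  refine ⟨(residueFieldIsoBase str w hw).hom (W.residue w b), ?_⟩
  rw [← IsLocalRing.residue_eq_zero_iff, map_sub, sub_eq_zero]
  have h1 := congrArg (fun f => f.hom ((residueFieldIsoBase str w hw).hom (W.residue w b))) h
  have h2 := congrArg (fun f => f.hom (W.residue w b)) (residueFieldIsoBase str w hw).hom_inv_id
  exact (h1.trans h2).symm

lemma baseToStalk_comp {X Y : Scheme.{u}} (f : X ⟶ Y) (str : Y ⟶ Spec (.of k)) (x : X) :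
    baseToStalk (f ≫ str) x = (f.stalkMap x).hom.comp (baseToStalk str (f x)) := by
  have h : CommRingCat.ofHom (baseToStalk (f ≫ str) x) =
      CommRingCat.ofHom (baseToStalk str (f x)) ≫ f.stalkMap x := by
    apply Spec.map_injective
    rw [Spec.map_comp, ← fromSpecStalk_str, ← fromSpecStalk_str,
      Scheme.SpecMap_stalkMap_fromSpecStalk_assoc]
  exact congrArg CommRingCat.Hom.hom h

end BaseToStalk

namespace LinearSystem

variable {k : Type u} [Field k] (S : LinearSystem k) (P : S.Prod)

lemma fromX_baseToStalk (c : k) :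
    S.fromX P (baseToStalk S.str (S.pr₁ P) c) = algebraMap k (S.ProdRing P) c :=
  (congrArg (fun f => f c) (baseToStalk_comp S.pr₁ S.str P)).symm

instance : IsScalarTower k (S.BaseRing P) (S.ProdRing P) := by
  refine .of_algebraMap_eq' ?_
  have h : baseToStalk (S.pr₁ ≫ S.str) P = baseToStalk (S.pr₂ ≫ PSpace.str k S.m) P := by
    rw [Limits.pullback.condition]
  exact h.trans (baseToStalk_comp S.pr₂ (PSpace.str k S.m) P)

instance : IsLocalHom (S.fromX P) := inferInstanceAs (IsLocalHom (S.pr₁.stalkMap P).hom)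

variable {P}

lemma exists_sub_algebraMap_prodRing_mem [IsAlgClosed k] (hP : IsClosed {P}) (b : S.ProdRing P) :
    ∃ c : k, b - algebraMap k (S.ProdRing P) c ∈ maximalIdeal (S.ProdRing P) := by
  have := S.projective.locallyOfFiniteType
  exact exists_sub_baseToStalk_mem (S.pr₁ ≫ S.str) hP b

/-- The constant is found in the local ring of the product; a local homomorphism reflects the
maximal ideal. -/
lemma exists_sub_algebraMap_baseRing_mem [IsAlgClosed k] (hP : IsClosed {P}) (b : S.BaseRing P) :
    ∃ c : k, b - algebraMap k (S.BaseRing P) c ∈ maximalIdeal (S.BaseRing P) := by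
  obtain ⟨c, hc⟩ := S.exists_sub_algebraMap_prodRing_mem hP (algebraMap _ _ b)
  refine ⟨c, ?_⟩
  rw [IsScalarTower.algebraMap_apply k (S.BaseRing P), ← map_sub] at hc
  exact fun h => hc (h.map _)

lemma exists_sub_baseToStalk_pr₁_mem [IsAlgClosed k] (hP : IsClosed {P})
    (b : S.X.presheaf.stalk (S.pr₁ P)) :
    ∃ c : k, b - baseToStalk S.str (S.pr₁ P) c ∈ maximalIdeal (S.X.presheaf.stalk (S.pr₁ P)) := by
  obtain ⟨c, hc⟩ := S.exists_sub_algebraMap_prodRing_mem hP (S.fromX P b)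
  refine ⟨c, ?_⟩
  rw [← fromX_baseToStalk, ← map_sub] at hc
  exact fun h => hc (h.map _)

end LinearSystem

/-! ### Independence of the critical equations at an immersion point -/

section Immersion

variable {k O A B : Type u} [Field k] [CommRing O] [IsLocalRing O] [Algebra k O] [CommRing A]
  [IsLocalRing A] [Algebra k A] [CommRing B] [IsLocalRing B] [Algebra k B] [Algebra A B]
  [IsScalarTower k A B]

lemma mem_maximalIdeal_iff_of_algHom (ev : B →ₐ[k] k) (b : B) : b ∈ maximalIdeal B ↔ ev b = 0 := by
  have h : (RingHom.ker (ev : B →+* k)).IsMaximal :=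
    RingHom.ker_isMaximal_of_surjective _ fun c => ⟨algebraMap k B c, ev.commutes c⟩
  rw [← IsLocalRing.eq_maximalIdeal h, RingHom.mem_ker]
  rfl

/-- The value of a function at the origin of a formal coordinate system. -/
def IsFormalCoords.eval {σ : Type*} [Finite σ] {v : σ → B} (hv : IsFormalCoords k v) : B →ₐ[k] k :=
  { (MvPowerSeries.constantCoeff (σ := σ) (R := k)).comp (hv.toPowerSeries : B →+* _) with
    commutes' := fun c => by simp [MvPowerSeries.algebraMap_apply] }

lemma IsEtaleCoords.lin_eq_eval_pd {σ : Type} [Finite σ] {v : σ → B} (hv : IsEtaleCoords k v)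
    (b : B) (i : σ) : hv.isFormalCoords.lin b i = hv.isFormalCoords.eval (hv.pd i b) := by
  change _ = MvPowerSeries.constantCoeff (hv.isFormalCoords.toPowerSeries (hv.pd i b))
  rw [hv.toPowerSeries_pd, MvPowerSeries.constantCoeff_pderiv]
  rfl

variable {ι : Type} [Fintype ι] {m : ℕ} {x : ι → O} {y : Fin m → A} {f : O →ₐ[k] B}

omit [IsLocalRing A] [Algebra k A] [IsScalarTower k A B] in
lemma IsEtaleCoords.pd_inl_map (hX : IsEtaleCoords k x)
    (hB : IsEtaleCoords k (Sum.elim (f ∘ x) (algebraMap A B ∘ y))) (i : ι) (a : O) :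
    hB.pd (Sum.inl i) (f a) = f (hX.pd i a) := by
  classical
  rw [hX.chain_rule f]
  have h : ∀ l, hB.pd (Sum.inl i) (f (x l)) = if l = i then 1 else 0 := fun l => by
    simpa using hB.pd_coord (Sum.inl i) (Sum.inl l)
  simp [h]

omit [IsLocalRing A] [Algebra k A] [IsScalarTower k A B] in
lemma IsEtaleCoords.pd_inr_map (hX : IsEtaleCoords k x)
    (hB : IsEtaleCoords k (Sum.elim (f ∘ x) (algebraMap A B ∘ y))) (l : Fin m) (a : O) :
    hB.pd (Sum.inr l) (f a) = 0 := by
  classical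
  rw [hX.chain_rule f]
  have h : ∀ i, hB.pd (Sum.inr l) (f (x i)) = 0 := fun i => by
    simpa using hB.pd_coord (Sum.inr l) (Sum.inl i)
  simp [h]

/-- The derivatives of Φ in y are the values of the sections, and its mixed derivatives are their
derivatives in x. So a relation is a number a₀ and a vector field D with a₀ gₗ + D gₗ = 0 at the
point for all l. By the quotient rule D kills all ratios of sections there, so it vanishes there by
immersivity; then a₀ = 0 because some section does not vanish. -/
lemma linearIndependent_lin_critEqs (hX : IsEtaleCoords k x) (hA : IsEtaleCoords k y)
    (hB : IsEtaleCoords k (Sum.elim (f ∘ x) (algebraMap A B ∘ y)))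
    {j₀ : Fin (m + 1)} {g : Fin (m + 1) → O} {r : Fin (m + 1) → A} {c : Fin m → k}
    (hr₀ : r j₀ = 1) (hr : ∀ l, r (j₀.succAbove l) = y l + algebraMap k A (c l)) {Φ : B}
    (hΦ : Φ = ∑ i, f (g i) * algebraMap A B (r i)) [Nontrivial (CRing k A Φ m)]
    {j : Fin (m + 1)} {q : Fin (m + 1) → O} (hj : IsUnit (g j)) (hq : ∀ i, g i = q i * g j)
    (himm : ∀ D : Derivation k O O, (∀ i, D (q i) ∈ maximalIdeal O) →
      ∀ a ∈ maximalIdeal O, D a ∈ maximalIdeal O) :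
    LinearIndependent k fun (o : Option ι) (l : Fin m) =>
      hB.isFormalCoords.lin (critEqs hB Φ o) (Sum.inr l) := by
  classical
  let ev : B →ₐ[k] k := hB.isFormalCoords.eval
  let evO : O →ₐ[k] k := ev.comp f
  have hpd_r : ∀ l i, hB.pd (Sum.inr l) (algebraMap A B (r i)) =
      if i = j₀.succAbove l then 1 else 0 := by
    intro l i
    obtain rfl | ⟨i, rfl⟩ := j₀.eq_self_or_eq_succAbove i
    · rw [hr₀, map_one, Derivation.map_one_eq_zero, if_neg (Fin.succAbove_ne _ _).symm]
    · have h := hB.pd_coord (Sum.inr l) (Sum.inr i)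
      simp only [Sum.elim_inr, Function.comp_apply, Sum.inr.injEq] at h
      rw [hr, map_add, map_add, h, ← IsScalarTower.algebraMap_apply, Derivation.map_algebraMap,
        add_zero]
      simp
  have hinr : ∀ l, hB.pd (Sum.inr l) Φ = f (g (j₀.succAbove l)) := by
    intro l
    rw [hΦ, map_sum]
    simp only [Derivation.leibniz, hX.pd_inr_map hB, hpd_r, smul_eq_mul, mul_zero, add_zero]
    simp
  have hinl : ∀ i, hB.pd (Sum.inl i) Φ = ∑ l, f (hX.pd i (g l)) * algebraMap A B (r l) := by
    intro i
    rw [hΦ, map_sum]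
    refine Finset.sum_congr rfl fun l _ => ?_
    rw [Derivation.leibniz, hX.pd_inl_map hB, hA.pd_inl_algebraMap hB, smul_zero, zero_add,
      smul_eq_mul, mul_comm]
  have hmem : ∀ b : B, b ∈ maximalIdeal B ↔ ev b = 0 := mem_maximalIdeal_iff_of_algHom ev
  have hmemO : ∀ b : O, b ∈ maximalIdeal O ↔ evO b = 0 := mem_maximalIdeal_iff_of_algHom evO
  have hevΦ : ev Φ = 0 := by
    rw [← hmem]
    apply mem_maximalIdeal_of_toCRing_eq_zero (k := k) (A := A) (m := m) (Φ := Φ)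
    rw [toCRing, RingHom.comp_apply, Ideal.Quotient.eq_zero_iff_mem.mpr
      (Ideal.mem_span_singleton_self Φ), map_zero]
  -- The chart omits the index j₀. As r j₀ = 1, the value at j₀ is recovered from the equation Φ = 0
  -- or from its x-derivatives.
  have hsum : ∀ h : Fin (m + 1) → k, (∑ l, h l * ev (algebraMap A B (r l)) = 0) →
      (∀ l, h (j₀.succAbove l) = 0) → ∀ l, h l = 0 := by
    intro h h1 h2 l
    obtain rfl | ⟨l, rfl⟩ := j₀.eq_self_or_eq_succAbove l
    · rw [Fin.sum_univ_succAbove _ l, hr₀] at h1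
      simpa [h2] using h1
    · exact h2 l
  have hj' : evO (g j) ≠ 0 := by
    rw [Ne, ← hmemO]
    exact fun h => h hj
  -- Otherwise all sections would vanish at the point, making it a base point. The unit is needed to
  -- apply `ker_toCRing`.
  obtain ⟨l₀, hl₀⟩ : ∃ l₀, IsUnit (hB.pd (Sum.inr l₀) Φ) := by
    by_contra! hcon
    refine hj' (hsum (fun l => evO (g l)) ?_ (fun l => ?_) j)
    · rw [← hevΦ, hΦ, map_sum]
      simp only [map_mul]
      rfl
    · have h := (hmem _).mp ((mem_maximalIdeal _).mpr (hcon l))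
      rwa [hinr] at h
  have hevpd : ∀ i, ev (hB.pd (Sum.inl i) Φ) = 0 := by
    intro i
    rw [← hmem]
    apply mem_maximalIdeal_of_toCRing_eq_zero (k := k) (A := A) (m := m) (Φ := Φ)
    rw [← RingHom.mem_ker, ker_toCRing hA hB Φ l₀ hl₀]
    exact Ideal.subset_span ⟨some i, rfl⟩
  have hlin₀ : ∀ l, hB.isFormalCoords.lin Φ (Sum.inr l) = evO (g (j₀.succAbove l)) := fun l => by
    rw [hB.lin_eq_eval_pd, hinr]
    rfl
  have hlin : ∀ i l, hB.isFormalCoords.lin (hB.pd (Sum.inl i) Φ) (Sum.inr l) =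
      evO (hX.pd i (g (j₀.succAbove l))) := fun i l => by
    rw [hB.lin_eq_eval_pd, hB.pd_comm, hinr, hX.pd_inl_map hB]
    rfl
  rw [Fintype.linearIndependent_iff]
  intro a ha
  let D : Derivation k O O := ∑ i, a (some i) • hX.pd i
  have hD : ∀ b, evO (D b) = ∑ i, a (some i) * evO (hX.pd i b) := fun b => by
    rw [derivation_sum_apply, map_sum]
    simp
  -- The given relation covers l ≠ j₀; the vanishing of Φ and of its x-derivatives at the point
  -- covers j₀, by `hsum`.
  have h1 : ∀ l, a none * evO (g l) + evO (D (g l)) = 0 := by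
    refine hsum _ ?_ fun l => ?_
    · have h2 : ∑ l, evO (g l) * ev (algebraMap A B (r l)) = 0 := by
        rw [← hevΦ, hΦ, map_sum]
        simp only [map_mul]
        rfl
      have h3 : ∀ i, ∑ l, evO (hX.pd i (g l)) * ev (algebraMap A B (r l)) = 0 := fun i => by
        rw [← hevpd i, hinl, map_sum]
        simp only [map_mul]
        rfl
      simp_rw [hD, add_mul, Finset.sum_add_distrib, mul_assoc, ← Finset.mul_sum, h2,
        Finset.sum_mul, mul_assoc]
      rw [Finset.sum_comm]
      simp_rw [← Finset.mul_sum, h3]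
      simp
    · have h2 := congrFun ha l
      rw [Fintype.sum_option] at h2
      simp only [Pi.add_apply, Pi.smul_apply, Finset.sum_apply, smul_eq_mul, Pi.zero_apply] at h2
      rw [hD, ← hlin₀]
      simp_rw [← hlin]
      exact h2
  have h2 : ∀ i, D (q i) ∈ maximalIdeal O := by
    intro i
    rw [hmemO]
    have h3 := h1 i
    rw [hq i, D.leibniz, map_add, smul_eq_mul, smul_eq_mul, map_mul, map_mul, map_mul] at h3
    have h4 : evO (g j) * evO (D (q i)) = 0 := by linear_combination h3 - evO (q i) * h1 j
    exact (mul_eq_zero.mp h4).resolve_left hj'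
  have h3 := himm D h2
  have h4 : ∀ i, a (some i) = 0 := by
    intro i
    have h5 := (hmemO _).mp (h3 (x i) (hX.mem i))
    rw [hD] at h5
    simpa [hX.pd_coord, apply_ite] using h5
  have h5 : a none = 0 := by
    have h6 := h1 j
    rw [hD] at h6
    simpa [h4, hj'] using h6
  rintro (_ | i)
  · exact h5
  · exact h4 i

end Immersion

/-! ### Frames and immersion points -/

section Frame

variable {X : Scheme.{u}} {L : X.Modules}

lemma LocalFrame.exists_smul_eq {p : X} (F : LocalFrame L p) {V : X.Opens} (h : V ≤ F.U)
    (t : Γ(L, V)) : ∃ a : Γ(X, V), a • (L.presheaf.map (homOfLE h).op F.e : Γ(L, V)) = t :=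
  (F.bijective V h).2 t

lemma map_homOfLE_map {U V W : X.Opens} (h : V ≤ U) (h' : W ≤ V) (t : Γ(L, U)) :
    L.presheaf.map (homOfLE h').op (L.presheaf.map (homOfLE h).op t) =
      L.presheaf.map (homOfLE (h'.trans h)).op t := by
  rw [← ConcreteCategory.comp_apply, ← Functor.map_comp]
  rfl

/-- The coordinate of a section can be computed on a smaller neighbourhood. -/
lemma LocalFrame.coord_eq_germ {p : X} (F : LocalFrame L p) {V : X.Opens} (h : V ≤ F.U) (hp : p ∈ V)
    (s : Γ(L, ⊤)) {a : Γ(X, V)}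
    (ha : a • (L.presheaf.map (homOfLE h).op F.e : Γ(L, V)) =
      L.presheaf.map (homOfLE le_top).op s) :
    F.coord s = X.presheaf.germ V p hp a := by
  set b := (Equiv.ofBijective _ (F.bijective F.U le_rfl)).symm
      (L.presheaf.map (homOfLE (le_top : F.U ≤ ⊤)).op s) with hb
  have h1 : b • (L.presheaf.map (homOfLE le_rfl).op F.e : Γ(L, F.U)) =
      L.presheaf.map (homOfLE (le_top : F.U ≤ ⊤)).op s :=
    (Equiv.ofBijective _ (F.bijective F.U le_rfl)).apply_symm_apply _
  have h2 : X.presheaf.map (homOfLE h).op b = a := by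
    apply (F.bijective V h).1
    have h3 := congrArg (L.presheaf.map (homOfLE h).op) h1
    rw [Scheme.Modules.map_smul, map_homOfLE_map, map_homOfLE_map] at h3
    exact h3.trans ha.symm
  rw [← h2, TopCat.Presheaf.germ_res_apply]
  rfl

/-- The coordinates of sections in two frames differ by a unit. -/
lemma LocalFrame.exists_coord_eq_mul {p : X} (F G : LocalFrame L p) :
    ∃ u : (X.presheaf.stalk p)ˣ, ∀ s, F.coord s = u * G.coord s := by
  have hF : F.U ⊓ G.U ≤ F.U := inf_le_left
  have hG : F.U ⊓ G.U ≤ G.U := inf_le_right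
  have hp : p ∈ F.U ⊓ G.U := ⟨F.mem, G.mem⟩
  obtain ⟨a, ha⟩ := F.exists_smul_eq hF (L.presheaf.map (homOfLE hG).op G.e)
  obtain ⟨b, hb⟩ := G.exists_smul_eq hG (L.presheaf.map (homOfLE hF).op F.e)
  have hab : a * b = 1 := by
    apply (G.bijective _ hG).1
    change (a * b) • _ = (1 : Γ(X, F.U ⊓ G.U)) • _
    rw [mul_smul, hb, ha, one_smul]
  refine ⟨⟨X.presheaf.germ _ p hp a, X.presheaf.germ _ p hp b, by rw [← map_mul, hab, map_one],
    by rw [← map_mul, mul_comm, hab, map_one]⟩, fun s => ?_⟩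
  obtain ⟨c, hc⟩ := G.exists_smul_eq hG (L.presheaf.map (homOfLE le_top).op s)
  rw [G.coord_eq_germ hG hp s hc, F.coord_eq_germ hF hp s (a := a * c)]
  · exact map_mul _ _ _
  · rw [mul_comm, mul_smul, ha, hc]

end Frame

/-! ### Tangent vectors from derivations -/

section Tangent

/-- By the Leibniz rule, a derivation followed by reduction to the residue field is linear on 𝔪 and
kills 𝔪². -/
lemma exists_dual_cotangentSpace {k O : Type u} [Field k] [CommRing O] [IsLocalRing O] [Algebra k O]
    (D : Derivation k O O) : ∃ v : Module.Dual (ResidueField O) (CotangentSpace O),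
      ∀ a, v ((maximalIdeal O).toCotangent a) = residue O (D a) := by
  let f : maximalIdeal O →ₗ[O] ResidueField O :=
    { toFun := fun a => residue O (D a)
      map_add' := fun a b => by simp
      map_smul' := fun r a => by
        have h : residue O (a * D r) = 0 :=
          (residue_eq_zero_iff _).mpr (Ideal.mul_mem_right _ _ a.2)
        simp only [Submodule.coe_smul, smul_eq_mul, Derivation.leibniz, map_add, h, add_zero,
          RingHom.id_apply, Algebra.smul_def, map_mul]
        rfl }
  have hf : ∀ a b : maximalIdeal O, f (a * b) = 0 := fun a b => by
    refine (residue_eq_zero_iff _).mpr ?_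
    change D (a * b : O) ∈ _
    rw [Derivation.leibniz]
    exact Ideal.add_mem _ (Ideal.mul_mem_right _ _ a.2) (Ideal.mul_mem_right _ _ b.2)
  exact ⟨(Ideal.Cotangent.lift f hf).extendScalarsOfSurjective residue_surjective, fun a => rfl⟩

end Tangent

/-! ### The linear system in coordinates -/

namespace LinearSystem

variable {k : Type u} [Field k] (S : LinearSystem k)

/-- The algebra structure of a local ring of the variety. -/
abbrev stalkAlgebra (p : S.X) : Algebra k (S.X.presheaf.stalk p) := (baseToStalk S.str p).toAlgebra

attribute [local instance] stalkAlgebra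

variable {S}

/-- The ratios of sections do not depend on the frame, so immersivity, given in some frame, can be
used in the frame of the trivialization. -/
lemma ImmersedAt.exists_ratio {p : S.X} (h : S.ImmersedAt p)
    (G : LocalFrame S.L p) :
    ∃ (j : Fin (S.m + 1)) (q : Fin (S.m + 1) → S.X.presheaf.stalk p),
      IsUnit (G.coord (S.s j)) ∧ (∀ i, G.coord (S.s i) = q i * G.coord (S.s j)) ∧
      ∀ D : Derivation k (S.X.presheaf.stalk p) (S.X.presheaf.stalk p),
        (∀ i, D (q i) ∈ maximalIdeal (S.X.presheaf.stalk p)) →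
        ∀ a ∈ maximalIdeal (S.X.presheaf.stalk p), D a ∈ maximalIdeal (S.X.presheaf.stalk p) := by
  obtain ⟨F, j, hj, hv⟩ := h
  obtain ⟨u, hu⟩ := G.exists_coord_eq_mul F
  refine ⟨j, fun i => F.coord (S.s i) * ((hj.unit⁻¹ : (S.X.presheaf.stalk p)ˣ) :
    S.X.presheaf.stalk p), ?_, fun i => ?_, fun D hD a ha => ?_⟩
  · rw [hu]
    exact u.isUnit.mul hj
  · rw [hu, hu, mul_assoc, mul_left_comm _ (u : S.X.presheaf.stalk p), IsUnit.val_inv_mul, mul_one,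
      mul_comm]
  · obtain ⟨v, hv'⟩ := exists_dual_cotangentSpace D
    have hv₀ : v = 0 := hv v fun i c h => by
      rw [hv', map_sub, residue_eq_zero_iff]
      have h0 : D (baseToStalk S.str p c) = 0 := D.map_algebraMap c
      rw [h0, sub_zero]
      exact hD i
    have h1 := hv' ⟨a, ha⟩
    rw [hv₀, LinearMap.zero_apply] at h1
    exact (residue_eq_zero_iff _).mp h1.symm

/-- The pullback of functions along the first projection, as a homomorphism of algebras. -/
def fromXₐ (S : LinearSystem k) (P : S.Prod) :
    S.X.presheaf.stalk (S.pr₁ P) →ₐ[k] S.ProdRing P :=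
  { S.fromX P with commutes' := S.fromX_baseToStalk P }

variable {P : S.Prod} (τ : S.Trivialization P)

/-- Étale coordinates on the product, obtained from étale coordinates on the two factors. -/
lemma Trivialization.exists_etaleCoords [IsAlgClosed k] (hP : IsClosed {P})
    (hX : S.pr₁ P ∈ S.immersionPoints) :
    ∃ (n : ℕ) (x : Fin n → S.X.presheaf.stalk (S.pr₁ P)) (y : Fin S.m → S.BaseRing P)
      (c : Fin S.m → k), IsEtaleCoords k x ∧ IsEtaleCoords k y ∧
      IsEtaleCoords k (Sum.elim (S.fromXₐ P ∘ x)
        (algebraMap (S.BaseRing P) (S.ProdRing P) ∘ y)) ∧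
      ∀ l, (PSpace.coordRatio (S.pr₂ P) (τ.chart.succAbove l) τ.chart τ.chart_ne : S.BaseRing P) =
        y l + algebraMap k (S.BaseRing P) (c l) := by
  obtain ⟨-, ⟨U, hU, hsm⟩, -⟩ := hX
  obtain ⟨n, ⟨cX⟩⟩ := exists_etaleChart_of_smooth_ι S.str hU
  let cY := PSpace.chart τ.chart_ne
  let φY : MvPolynomial (Fin S.m) k →+* S.BaseRing P := cY.hom
  let φ : MvPolynomial (Fin n ⊕ Fin S.m) k →+* S.ProdRing P := (EtaleChart.prod cX cY).hom
  have hinl : ∀ i, φ (MvPolynomial.X (Sum.inl i)) = S.fromXₐ P (cX.hom (MvPolynomial.X i)) :=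
    EtaleChart.prod_hom_inl cX cY
  have hinr : ∀ l, φ (MvPolynomial.X (Sum.inr l)) =
      algebraMap (S.BaseRing P) (S.ProdRing P) (φY (MvPolynomial.X l)) :=
    EtaleChart.prod_hom_inr cX cY
  choose a ha using fun i => S.exists_sub_baseToStalk_pr₁_mem hP (cX.hom (MvPolynomial.X i))
  choose c hc using fun l => S.exists_sub_algebraMap_baseRing_mem hP (φY (MvPolynomial.X l))
  have hx : IsEtaleCoords k fun i => cX.hom (MvPolynomial.X i) -
      algebraMap k (S.X.presheaf.stalk (S.pr₁ P)) (a i) :=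
    isEtaleCoords_sub_algebraMap cX.formallyEtale_hom cX.hom_comp_C
      (S.exists_sub_baseToStalk_pr₁_mem hP) ha
  have hφY : φY.FormallyEtale := cY.formallyEtale_hom
  have hφ : φ.FormallyEtale := (EtaleChart.prod cX cY).formallyEtale_hom
  have hy : IsEtaleCoords k fun l => φY (MvPolynomial.X l) - algebraMap k (S.BaseRing P) (c l) :=
    isEtaleCoords_sub_algebraMap hφY cY.hom_comp_C (S.exists_sub_algebraMap_baseRing_mem hP) hc
  have hxy : (Sum.elim (S.fromXₐ P ∘ fun i => cX.hom (MvPolynomial.X i) -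
      algebraMap k (S.X.presheaf.stalk (S.pr₁ P)) (a i)) (algebraMap (S.BaseRing P) (S.ProdRing P) ∘
        fun l => φY (MvPolynomial.X l) - algebraMap k (S.BaseRing P) (c l))) =
      fun o => φ (MvPolynomial.X o) - algebraMap k (S.ProdRing P) (Sum.elim a c o) := by
    funext o
    rcases o with i | l
    · simp only [Sum.elim_inl, Function.comp_apply, map_sub, hinl, AlgHom.commutes]
    · simp only [Sum.elim_inr, Function.comp_apply, map_sub, hinr]
      rw [← IsScalarTower.algebraMap_apply]
  refine ⟨n, _, _, c, hx, hy, ?_, fun l => ?_⟩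
  · rw [hxy]
    refine isEtaleCoords_sub_algebraMap hφ (EtaleChart.prod cX cY).hom_comp_C
      (S.exists_sub_algebraMap_prodRing_mem hP) fun o => ?_
    rw [← congrFun hxy o]
    rcases o with i | l
    · exact map_nonunit (S.fromX P) _ (ha i)
    · exact map_nonunit (algebraMap (S.BaseRing P) (S.ProdRing P)) _ (hc l)
  · rw [sub_add_cancel]
    exact (PSpace.chart_hom_X τ.chart_ne l).symm

/-- The normal form of the projection `π₂` at a smooth point of the degeneracy scheme. -/
theorem Trivialization.exists_normalForm [IsAlgClosed k] [CharP k 2] [Nontrivial τ.OC]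
    (hP : τ.IsSmoothPointOfR) :
    4 ≤ S.m ∧ ∃ (ρ : S.BaseRing P →ₐ[k] TargetRing k (S.m - 4))
      (j : τ.OC →ₐ[k] SourceRing k (S.m - 4)), IsCompletionMap k j ∧
        (∀ a, gammaStar k (S.m - 4) (ρ a) = j (τ.π₂ a)) ∧
        ∃ y : Fin S.m → S.BaseRing P, IsFormalCoords k y := by
  obtain ⟨hclosed, hX, hreg, hdim⟩ := hP
  obtain ⟨n, x, y, c, hx, hy, hxy, hc⟩ := τ.exists_etaleCoords hclosed hX
  obtain ⟨j₁, q, hj₁, hq, hD⟩ := hX.2.2.exists_ratio τ.frame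
  have hli := linearIndependent_lin_critEqs hx hy hxy (j₀ := τ.chart)
    (r := fun i => PSpace.coordRatio (S.pr₂ P) i τ.chart τ.chart_ne)
    (PSpace.coordRatio_self τ.chart_ne) hc (g := fun i => τ.frame.coord (S.s i))
    (Φ := τ.equation) rfl hj₁ hq hD
  obtain ⟨hm, ρ, j, hj, hρ⟩ := exists_normalForm_CRing hy hxy
    (fun a ha => map_nonunit (algebraMap (S.BaseRing P) (S.ProdRing P)) a ha) hli hreg hdim
  exact ⟨hm, ρ, j, hj, hρ, y, hy.isFormalCoords⟩

end LinearSystem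

lemma algHom_mem_maximalIdeal {k A : Type u} [Field k] [CommRing A] [IsLocalRing A] [Algebra k A]
    {σ : Type*} (ρ : A →ₐ[k] MvPowerSeries σ k) {a : A} (ha : a ∈ maximalIdeal A) :
    ρ a ∈ maximalIdeal (MvPowerSeries σ k) := by
  rw [MvPowerSeries.mem_maximalIdeal_iff]
  let ev : A →ₐ[k] k :=
    { (MvPowerSeries.constantCoeff (σ := σ) (R := k)).comp (ρ : A →+* _) with
      commutes' := fun c => by simp [MvPowerSeries.algebraMap_apply] }
  exact (mem_maximalIdeal_iff_of_algHom ev a).mp ha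

end DualVar

end

/-- The instance argument `Nontrivial τ.OC` says that `P` is a point of `𝒞`; it is part of `hP` and
is only there to make the local ring `τ.OC` available as one. -/
theorem corollary5p4 {k : Type u} [Field k] [IsAlgClosed k] [CharP k 2]
    (S : DualVar.LinearSystem k) (n : ℕ) (hn : 0 < n) (hn_even : Even n)
    (hdim : topologicalKrullDim S.X = (n : WithBot ℕ∞)) (hmn : n < S.m)
    (hdense : Dense S.immersionPoints)
    (P : S.Prod) (τ : S.Trivialization P) [Nontrivial τ.OC] (hP : τ.IsSmoothPointOfR) :
    4 ≤ S.m ∧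
    ∃ (ι : DualVar.formalCompletion τ.OC ≅ Spec (.of (DualVar.SourceRing k (S.m - 4))))
      (ψ : DualVar.Gamma k (S.m - 4) ⟶ DualVar.formalCompletion (S.BaseRing P)),
      ι.hom ≫ Spec.map (CommRingCat.ofHom (algebraMap k (DualVar.SourceRing k (S.m - 4)))) =
        Spec.map (CommRingCat.ofHom
          (algebraMap k (AdicCompletion (maximalIdeal τ.OC) τ.OC))) ∧
      ψ ≫ Spec.map (CommRingCat.ofHom
          (algebraMap k (AdicCompletion (maximalIdeal (S.BaseRing P)) (S.BaseRing P)))) =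
        DualVar.Gamma.str k (S.m - 4) ∧
      Spec.map (CommRingCat.ofHom (DualVar.completionMap τ.π₂)) =
        ι.hom ≫ DualVar.gammaMap k (S.m - 4) ≫ ψ := by
  obtain ⟨hm, ρ, j, hj, hρ, y, hy⟩ := τ.exists_normalForm hP
  exact ⟨hm, DualVar.exists_iso_of_normalForm hy τ.π₂ ρ j
    (fun a ha => DualVar.algHom_mem_maximalIdeal ρ ha) hj hρ⟩
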